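/- Let $d\ge1$, let $\Omega\subset\mathbb R^d$ be a bounded domain with smooth boundary, $T>0$ and $Q=\Omega\times(0,T)$. Let $a_{ij}=a_{ji}\in C^1([0,T];L^\infty(\Omega))$ for $1\le i,j\le d$, let $b=(b_1,\dots,b_d)$ with $b_k\in L^\infty(Q)$, let $c\in L^\infty(Q)$, and let $\sigma\in C(\overline\Omega)$, $\sigma\ge0$ on $\overline\Omega$, be such that $$\sum_{i,j}a_{ij}(x,t)\xi_i\xi_j\ge\sigma(x)|\xi|^2\quad\text{for all }\xi\in\mathbb R^d\text{ and a.e. }(x,t)\in Q.$$ Zeros of $\sigma$ are allowed. Assume that there are constants $\lambda_1>0$ and $K>0$ such that, for all $\xi\in\mathbb R^d$ and a.e. $(x,t)\in Q$, $$\sum_{i,j}(\lambda_1a_{ij}-\partial_ta_{ij})(x,t)\,\xi_i\xi_j\ge0,\qquad |b(x,t)|\le K\sqrt{\sigma(x)}.$$ Let $H^{2,1}(Q)$ be the space of all $u\in L^2(Q)$ whose weak derivatives $\partial_tu,\partial_iu,\partial_i\partial_ju$ $(1\le i,j\le d)$ lie in $L^2(Q)$. Consider the equation $$\partial_tu-\sum_{i,j}\partial_i(a_{ij}\partial_ju)-\sum_kb_k\partial_ku-cu=0\quad\text{in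 }Q\qquad(1)$$ with the Dirichlet condition $$u=0\quad\text{on }\partial\Omega\times(0,T),\qquad(2)$$ or with the Robin condition $$\sum_{i,j}a_{ij}\nu_i\partial_ju+r\,u=0\quad\text{on }\partial\Omega\times(0,T),\qquad(3)$$ where $r\in C(\partial\Omega)$ and $\nu$ is the outward unit normal; the first term of (3) is the normal trace of the flux $(\sum_ja_{ij}\partial_ju)_{1\le i\le d}$, in the weak sense of Gauss' formula. Case (2). For all $M>0$ and $\alpha\in(0,1)$ there is a constant $C>0$ such that every $u\in H^{2,1}(Q)$ with $\partial_tu,\partial_t^2u\in H^{2,1}(Q)$ that satisfies (1), (2) and $$\sum_{k=0}^2\|\partial_t^ku(\cdot,0)\|_{H^1(\Omega)}\le M,\qquad D:=\sum_{k=0}^2\|\partial_t^ku(\cdot,T)\|_{H^1(\Omega)}<1$$ satisfies $$\|u(\cdot,0)\|_{L^2(\Omega)}\le C\Big(\log\frac1D\Big)^{-\alpha},$$ where the right-hand side is read as $0$ if $D=0$. Case (3). If in addition $\sigma>0$ on $\partial\Omega$, then the same holds, for every $r\in C(\partial\Omega)$, with (3) in place of (2); here $C$ may depend on $r$ too. In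 both cases $C$ may depend on $\Omega,T$, the coefficients, $M$ and $\alpha$, but not on $u$. -/

import Mathlib

open MeasureTheory Set Filter Topology
open scoped ENNReal ContDiff

noncomputable section

/-- The Euclidean space `ℝ^d`. -/
abbrev Eu (d : ℕ) : Type := EuclideanSpace ℝ (Fin d)

/-- The `i`-th standard basis vector of `ℝ^d`. -/
def basisVec {d : ℕ} (i : Fin d) : Eu d := EuclideanSpace.single i (1 : ℝ)

/-! ### Domains -/

/-- `Ω` has a smooth (`C^∞`) boundary: near every boundary point, `Ω` is the sublevel set
`{ρ < 0}` of a smooth function `ρ` without critical points. -/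
def HasSmoothBoundary {d : ℕ} (Ω : Set (Eu d)) : Prop :=
  ∀ x ∈ frontier Ω, ∃ U : Set (Eu d), IsOpen U ∧ x ∈ U ∧ ∃ ρ : Eu d → ℝ,
    ContDiffOn ℝ ∞ ρ U ∧ (∀ y ∈ U, fderiv ℝ ρ y ≠ 0) ∧ Ω ∩ U = {y ∈ U | ρ y < 0}

/-- The surface measure `dS` on `∂Ω`: the `(d-1)`-dimensional Hausdorff measure, normalized so as
to agree with Lebesgue measure on `ℝ^(d-1)`, restricted to `∂Ω` (used for `d ≥ 1` only). -/
def surfaceMeasure {d : ℕ} (Ω : Set (Eu d)) : Measure (Eu d) :=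
  (Measure.euclideanHausdorffMeasure (d - 1)).restrict (frontier Ω)

/-- The space-time cylinder `Q = Ω × (0,T)`. -/
def stCylinder {d : ℕ} (Ω : Set (Eu d)) (T : ℝ) : Set (Eu d × ℝ) := Ω ×ˢ Ioo 0 T

/-! ### Weak derivatives and Sobolev spaces -/

/-- `φ ∈ C_c^∞(U)`. -/
def IsTestFunction {V : Type*} [NormedAddCommGroup V] [NormedSpace ℝ V]
    (U : Set V) (φ : V → ℝ) : Prop :=
  ContDiff ℝ ∞ φ ∧ HasCompactSupport φ ∧ tsupport φ ⊆ U

/-- On the open set `U`, `g` is the weak derivative of `f` in the direction `e`. -/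
def HasWeakDeriv {V : Type*} [NormedAddCommGroup V] [NormedSpace ℝ V] [MeasureSpace V]
    (U : Set V) (e : V) (f g : V → ℝ) : Prop :=
  LocallyIntegrableOn f U ∧ LocallyIntegrableOn g U ∧
    ∀ φ : V → ℝ, IsTestFunction U φ →
      ∫ x in U, f x * fderiv ℝ φ x e = -∫ x in U, g x * φ x

/-- `g = ∂_i f` weakly in `Ω ⊆ ℝ^d`. -/
def HasWeakPartial {d : ℕ} (Ω : Set (Eu d)) (i : Fin d) (f g : Eu d → ℝ) : Prop :=
  HasWeakDeriv Ω (basisVec i) f g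

/-- `g = ∂_i f` (spatial derivative) weakly in `Q = Ω × (0,T)`. -/
def HasWeakSpaceDeriv {d : ℕ} (Ω : Set (Eu d)) (T : ℝ) (i : Fin d) (f g : Eu d × ℝ → ℝ) : Prop :=
  HasWeakDeriv (stCylinder Ω T) (basisVec i, 0) f g

/-- `g = ∂_t f` weakly in `Q = Ω × (0,T)`. -/
def HasWeakTimeDeriv {d : ℕ} (Ω : Set (Eu d)) (T : ℝ) (f g : Eu d × ℝ → ℝ) : Prop :=
  HasWeakDeriv (stCylinder Ω T) (0, 1) f g

/-- `f ∈ L²(Q)`. -/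
def MemL2Q {d : ℕ} (Ω : Set (Eu d)) (T : ℝ) (f : Eu d × ℝ → ℝ) : Prop :=
  MemLp f 2 (volume.restrict (stCylinder Ω T))

/-- `f ∈ H^{2,1}(Q)`: `f, ∂_t f, ∂_i f, ∂_i ∂_j f ∈ L²(Q)` for all `i, j`. -/
def MemH21 {d : ℕ} (Ω : Set (Eu d)) (T : ℝ) (f : Eu d × ℝ → ℝ) : Prop :=
  MemL2Q Ω T f ∧
  (∃ ft, MemL2Q Ω T ft ∧ HasWeakTimeDeriv Ω T f ft) ∧
  ∀ i : Fin d, ∃ fi, MemL2Q Ω T fi ∧ HasWeakSpaceDeriv Ω T i f fi ∧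
    ∀ j : Fin d, ∃ fij, MemL2Q Ω T fij ∧ HasWeakSpaceDeriv Ω T j fi fij

/-- The norm `‖v‖_{H¹(Ω)} = (‖v‖² + ∑ᵢ ‖∂ᵢ v‖²)^{1/2}` (norms in `L²(Ω)`) with values in `[0,∞]`;
it is `∞` when `v ∉ H¹(Ω)`. The weak gradient being unique up to null sets, the infimum is over
one value, or over the empty set when there is no weak gradient. -/
def h1Norm {d : ℕ} (Ω : Set (Eu d)) (v : Eu d → ℝ) : ℝ≥0∞ :=
  ⨅ (G : Fin d → Eu d → ℝ) (_ : ∀ i, HasWeakPartial Ω i v (G i)),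
    (eLpNorm v 2 (volume.restrict Ω) ^ 2
      + ∑ i, eLpNorm (G i) 2 (volume.restrict Ω) ^ 2) ^ (1 / 2 : ℝ)

/-- `v ∈ H¹(Ω)` and the smooth functions `φ n` converge to `v` in `H¹(Ω)`. -/
def TendstoH1 {d : ℕ} (Ω : Set (Eu d)) (φ : ℕ → Eu d → ℝ) (v : Eu d → ℝ) : Prop :=
  MemLp v 2 (volume.restrict Ω) ∧
  Tendsto (fun n => eLpNorm (fun x => φ n x - v x) 2 (volume.restrict Ω)) atTop (𝓝 0) ∧
  ∃ G : Fin d → Eu d → ℝ, ∀ i,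
    MemLp (G i) 2 (volume.restrict Ω) ∧ HasWeakPartial Ω i v (G i) ∧
    Tendsto (fun n => eLpNorm (fun x => fderiv ℝ (φ n) x (basisVec i) - G i x) 2
      (volume.restrict Ω)) atTop (𝓝 0)

/-- `v ∈ H¹₀(Ω)`, the closure of `C_c^∞(Ω)` in `H¹(Ω)`. -/
def MemH10 {d : ℕ} (Ω : Set (Eu d)) (v : Eu d → ℝ) : Prop :=
  ∃ φ : ℕ → Eu d → ℝ, (∀ n, IsTestFunction Ω (φ n)) ∧ TendstoH1 Ω φ v

/-- `g ∈ L²(∂Ω)` is the trace on `∂Ω` of `v ∈ H¹(Ω)`: functions that are smooth up to the boundary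
converge to `v` in `H¹(Ω)` while their restrictions to `∂Ω` converge to `g` in `L²(∂Ω)`. -/
def HasTrace {d : ℕ} (Ω : Set (Eu d)) (v g : Eu d → ℝ) : Prop :=
  MemLp g 2 (surfaceMeasure Ω) ∧
  ∃ φ : ℕ → Eu d → ℝ, (∀ n, ContDiff ℝ ∞ (φ n)) ∧ TendstoH1 Ω φ v ∧
    Tendsto (fun n => eLpNorm (fun x => φ n x - g x) 2 (surfaceMeasure Ω)) atTop (𝓝 0)

/-- The vector field `q ∈ L²(Ω)^d` has weak divergence `δ ∈ L²(Ω)` and (outward) normal trace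
`q · ν = h ∈ L²(∂Ω)`, in the sense of Gauss' formula
`∫_Ω (q · ∇φ + δ φ) dx = ∫_∂Ω h φ dS` for all `φ ∈ C_c^∞(ℝ^d)`. -/
def HasNormalTrace {d : ℕ} (Ω : Set (Eu d)) (q : Fin d → Eu d → ℝ) (h : Eu d → ℝ) : Prop :=
  (∀ i, MemLp (q i) 2 (volume.restrict Ω)) ∧ MemLp h 2 (surfaceMeasure Ω) ∧
  ∃ δ : Eu d → ℝ, MemLp δ 2 (volume.restrict Ω) ∧
    ∀ φ : Eu d → ℝ, IsTestFunction univ φ →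
      ∫ x in Ω, ((∑ i, q i x * fderiv ℝ φ x (basisVec i)) + δ x * φ x)
        = ∫ x, h x * φ x ∂(surfaceMeasure Ω)

/-- `g = f(·,t₀)` for `t₀ ∈ [0,T]`, where `f` is identified with the function
`t ↦ f(·,t)` of `C([0,T]; L²(Ω))` to which it is equal for almost every `t`. -/
def IsTimeSlice {d : ℕ} (Ω : Set (Eu d)) (T : ℝ) (f : Eu d × ℝ → ℝ) (t₀ : ℝ)
    (g : Eu d → ℝ) : Prop :=
  ∃ U : ℝ → Lp ℝ 2 (volume.restrict Ω), ContinuousOn U (Icc 0 T) ∧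
    (∀ᵐ t ∂(volume.restrict (Ioo 0 T)), U t =ᵐ[volume.restrict Ω] fun x => f (x, t)) ∧
    U t₀ =ᵐ[volume.restrict Ω] g

/-! ### The equation and the boundary conditions -/

/-- `a ∈ C¹([0,T]; L^∞(Ω))` with time derivative `a'`. -/
def IsC1Linfty {d : ℕ} (Ω : Set (Eu d)) (T : ℝ) (a a' : Eu d × ℝ → ℝ) : Prop :=
  AEStronglyMeasurable a (volume.restrict (stCylinder Ω T)) ∧
  AEStronglyMeasurable a' (volume.restrict (stCylinder Ω T)) ∧
  ∃ A : ℝ → Lp ℝ ∞ (volume.restrict Ω), ContDiffOn ℝ 1 A (Icc 0 T) ∧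
    ∀ t ∈ Icc 0 T, (A t =ᵐ[volume.restrict Ω] fun x => a (x, t)) ∧
      ((derivWithin A (Icc 0 T) t : Lp ℝ ∞ (volume.restrict Ω)) =ᵐ[volume.restrict Ω]
        fun x => a' (x, t))

/-- The equation
`∂_t u - ∑_{i,j} ∂_i (a_ij ∂_j u) - ∑_k b_k ∂_k u - c u = F` in `Q`, in the sense of distributions;
`ut` stands for `∂_t u` and `Du j` for `∂_j u`. -/
def SolvesEquation {d : ℕ} (Ω : Set (Eu d)) (T : ℝ) (a : Fin d → Fin d → Eu d × ℝ → ℝ)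
    (b : Fin d → Eu d × ℝ → ℝ) (c F u ut : Eu d × ℝ → ℝ) (Du : Fin d → Eu d × ℝ → ℝ) : Prop :=
  ∀ φ : Eu d × ℝ → ℝ, IsTestFunction (stCylinder Ω T) φ →
    ∫ p in stCylinder Ω T, (ut p * φ p
        + (∑ i, ∑ j, a i j p * Du j p * fderiv ℝ φ p (basisVec i, 0))
        - (∑ k, b k p * Du k p) * φ p - c p * u p * φ p)
      = ∫ p in stCylinder Ω T, F p * φ p

/-- The Dirichlet condition `u = 0` on `∂Ω × (0,T)`. -/
def DirichletBC {d : ℕ} (Ω : Set (Eu d)) (T : ℝ) (u : Eu d × ℝ → ℝ) : Prop :=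
  ∀ᵐ t ∂(volume.restrict (Ioo 0 T)), MemH10 Ω (fun x => u (x, t))

/-- The Robin condition `∂_{ν_A} u + r u = 0` on `∂Ω × (0,T)`, where
`∂_{ν_A} u = ∑_{i,j} a_ij ν_i ∂_j u` is the normal trace of the flux `A ∇u` and `Du j = ∂_j u`. -/
def RobinBC {d : ℕ} (Ω : Set (Eu d)) (T : ℝ) (a : Fin d → Fin d → Eu d × ℝ → ℝ)
    (r : Eu d → ℝ) (u : Eu d × ℝ → ℝ) (Du : Fin d → Eu d × ℝ → ℝ) : Prop :=
  ∀ᵐ t ∂(volume.restrict (Ioo 0 T)), ∃ g h : Eu d → ℝ,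
    HasTrace Ω (fun x => u (x, t)) g ∧
    HasNormalTrace Ω (fun i x => ∑ j, a i j (x, t) * Du j (x, t)) h ∧
    ∀ᵐ x ∂(surfaceMeasure Ω), h x + r x * g x = 0

/-- `u 0` is a solution of the homogeneous equation in `Q`, with `u k = ∂_t^k (u 0) ∈ H^{2,1}(Q)` for
`k = 0, 1, 2` and spatial gradient `Du`; moreover `v k = (u k)(·,0)` and `w k = (u k)(·,T)`. -/
structure IsRegularSolution {d : ℕ} (Ω : Set (Eu d)) (T : ℝ)
    (a : Fin d → Fin d → Eu d × ℝ → ℝ) (b : Fin d → Eu d × ℝ → ℝ) (c : Eu d × ℝ → ℝ)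
    (u : Fin 3 → Eu d × ℝ → ℝ) (Du : Fin d → Eu d × ℝ → ℝ) (v w : Fin 3 → Eu d → ℝ) : Prop where
  memH21 : ∀ k, MemH21 Ω T (u k)
  deriv_one : HasWeakTimeDeriv Ω T (u 0) (u 1)
  deriv_two : HasWeakTimeDeriv Ω T (u 1) (u 2)
  grad : ∀ i, HasWeakSpaceDeriv Ω T i (u 0) (Du i)
  equation : SolvesEquation Ω T a b c (fun _ => 0) (u 0) (u 1) Du
  initial : ∀ k, IsTimeSlice Ω T (u k) 0 (v k)
  final : ∀ k, IsTimeSlice Ω T (u k) T (w k)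

/-- `‖v‖_{L²(Ω)} ≤ C (log (1/D))^{-α}` for `0 < D < 1`; for `D = 0` the right-hand side is read as
its limit `0`. -/
def LogBound {d : ℕ} (Ω : Set (Eu d)) (C α : ℝ) (D : ℝ≥0∞) (v : Eu d → ℝ) : Prop :=
  (D = 0 → eLpNorm v 2 (volume.restrict Ω) = 0) ∧
  (0 < D → D < 1 →
    eLpNorm v 2 (volume.restrict Ω) ≤ ENNReal.ofReal (C * Real.log (1 / D.toReal) ^ (-α)))

end

/-! ### Test functions on an interval -/

/-! The theorem is quantitative backward uniqueness, proved with the Dirichlet quotient. Write the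
problem as `u' + A(t) u = f` in `L²(Ω)`, with `y = u'` and `f = b · ∇u + c u`. Let `e` be the
quadratic form of `A(t)` at `u`: the integral of `∑ a_ij ∂_j u ∂_i u`, plus the boundary term and a
multiple of `‖u‖²` in the Robin case. Testing with `u` gives `e = ⟨f - y, u⟩`. Testing with `y` and
using the bound on `∂_t a` gives `e' ≤ λ e + 2⟨f - y, y⟩`. The bound `|b| ≤ K √σ` yields `‖f‖² ≤ B
(e + ‖u‖²)` even where `σ` vanishes. No ellipticity is needed beyond this.

By Cauchy-Schwarz (`two_mul_inner_sub_le`) the quotient `(e + ‖u‖²)/‖u‖²` grows at most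
exponentially. It bounds the logarithmic decay rate of `‖u‖²`, so `‖u(T)‖² ≥ ‖u(0)‖² exp(-A (1 +
‖y(0)‖/‖u(0)‖))`; this is `norm_sq_lower_bound`. With `x = ‖u(0)‖`, taking logarithms and
multiplying by `x` gives `x log(1/D) ≤ 1 + A M`, because `x log x ≥ -1`. This is the rate `α = 1`,
and it implies every `α < 1` (`le_mul_log_rpow_of_exp_le`).

Two points need care. First, the energy must be differentiable and `y` must be an admissible test
function. Since `∂_t` commutes with `∂_i`, the regularity of `u, ∂_t u, ∂_t² u` makes `∇u` a
continuously differentiable curve in `L²` (`IsRegularSolution.exists_curves`). The boundary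
condition is encoded by a closed space of triples (function, gradient, trace); a differentiable
curve in a closed subspace has its derivative there, so `y` inherits the boundary condition
(`exists_lift_hasDerivAt`). `energy_lower_bound` combines this with the quotient argument.

Second, the Robin term has no sign. As `σ > 0` on the boundary, `HasSmoothBoundary.trace_inequality`
bounds the boundary integral of `φ²` by `ε ∫ σ |∇φ|² + C ∫ φ²`. For small `ε` the first part is
absorbed by half of the energy and the second by the added multiple of `‖u‖²`. The inequality comes
from integrating along short coordinate segments that enter the domain from the boundary. -/

theorem IsCompact.exists_Icc_superset_of_subset_Ioo {K : Set ℝ} (hK : IsCompact K) {s t : ℝ}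
    (hst : s < t) (h : K ⊆ Ioo s t) : ∃ a b, s < a ∧ a < b ∧ b < t ∧ K ⊆ Icc a b := by
  -- The midpoint makes the set nonempty, so that it has a least and a greatest element.
  have hK' : IsCompact (insert ((s + t) / 2) K) := hK.insert _
  have h' : insert ((s + t) / 2) K ⊆ Ioo s t :=
    insert_subset ⟨by linarith, by linarith⟩ h
  obtain ⟨a, ha⟩ := hK'.exists_isLeast (insert_nonempty _ _)
  obtain ⟨b, hb⟩ := hK'.exists_isGreatest (insert_nonempty _ _)
  have ha' := h' ha.1
  have hb' := h' hb.1
  refine ⟨a, (b + t) / 2, ha'.1, ?_, by linarith [hb'.2], fun x hx => ⟨ha.2 (mem_insert_of_mem _ hx),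
    (hb.2 (mem_insert_of_mem _ hx)).trans (by linarith [hb'.2])⟩⟩
  have := hb.2 ha.1
  linarith [hb'.2]

/-- The primitive vanishes to the left of the support trivially, and to the right because the total
integral is zero. Hence mean-zero test functions are derivatives of test functions. -/
theorem isTestFunction_primitive {T : ℝ} (hT : 0 < T) {χ : ℝ → ℝ} (hχ : IsTestFunction (Ioo 0 T) χ)
    (h0 : ∫ t in (0 : ℝ)..T, χ t = 0) :
    IsTestFunction (Ioo 0 T) (fun t => ∫ s in (0 : ℝ)..t, χ s) ∧
      ∀ t, HasDerivAt (fun t => ∫ s in (0 : ℝ)..t, χ s) (χ t) t := by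
  obtain ⟨hd, hc, hs⟩ := hχ
  obtain ⟨a, b, ha, hab, hb, hK⟩ := hc.isCompact.exists_Icc_superset_of_subset_Ioo hT hs
  have hz : ∀ t, t ∉ Icc a b → χ t = 0 := fun t ht => image_eq_zero_of_notMem_tsupport
    fun h => ht (hK h)
  have hder : ∀ t, HasDerivAt (fun t => ∫ s in (0 : ℝ)..t, χ s) (χ t) t := fun t =>
    intervalIntegral.integral_hasDerivAt_right (hd.continuous.intervalIntegrable _ _)
      (hd.continuous.stronglyMeasurableAtFilter _ _) hd.continuous.continuousAt
  have hsupp : tsupport (fun t => ∫ s in (0 : ℝ)..t, χ s) ⊆ Icc a b := by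
    refine closure_minimal ?_ isClosed_Icc
    intro t ht
    by_contra hcon
    apply ht
    rcases not_and_or.1 hcon with h | h
    · change ∫ s in (0 : ℝ)..t, χ s = 0
      refine Eq.trans ?_ (intervalIntegral.integral_zero (a := 0) (b := t) (μ := volume) (E := ℝ))
      refine intervalIntegral.integral_congr fun s hs => hz s fun hs' => ?_
      have : s ≤ max 0 t := hs.2
      have h1 := hs'.1
      rcases le_max_iff.1 this with h2 | h2 <;> linarith
    · have : ∫ s in t..T, χ s = 0 := by
        rw [← intervalIntegral.integral_zero (a := t) (b := T)]
        refine intervalIntegral.integral_congr fun s hs => hz s fun hs' => ?_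
        have : min t T ≤ s := hs.1
        have h1 := hs'.2
        rcases min_le_iff.1 this with h2 | h2 <;> linarith
      have h3 := intervalIntegral.integral_add_adjacent_intervals
        (hd.continuous.intervalIntegrable (μ := volume) 0 t) (hd.continuous.intervalIntegrable t T)
      linarith
  refine ⟨⟨?_, IsCompact.of_isClosed_subset isCompact_Icc (isClosed_tsupport _) hsupp,
    hsupp.trans fun t ht => ⟨ha.trans_le ht.1, ht.2.trans_lt hb⟩⟩, hder⟩
  rw [contDiff_infty_iff_deriv]
  exact ⟨fun t => (hder t).differentiableAt, by rwa [funext fun t => (hder t).deriv]⟩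

theorem IsTestFunction.add {V : Type*} [NormedAddCommGroup V] [NormedSpace ℝ V] {U : Set V}
    {φ ψ : V → ℝ} (hφ : IsTestFunction U φ) (hψ : IsTestFunction U ψ) :
    IsTestFunction U (φ + ψ) :=
  ⟨hφ.1.add hψ.1, hφ.2.1.add hψ.2.1,
    (tsupport_add φ ψ).trans (union_subset hφ.2.2 hψ.2.2)⟩

theorem IsTestFunction.const_smul {V : Type*} [NormedAddCommGroup V] [NormedSpace ℝ V] {U : Set V}
    {φ : V → ℝ} (hφ : IsTestFunction U φ) (c : ℝ) : IsTestFunction U (c • φ) :=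
  ⟨hφ.1.const_smul c, hφ.2.1.mono (Function.support_const_smul_subset c φ),
    (closure_mono (Function.support_const_smul_subset c φ)).trans hφ.2.2⟩

theorem isTestFunction_zero {V : Type*} [NormedAddCommGroup V] [NormedSpace ℝ V] {U : Set V} :
    IsTestFunction U (0 : V → ℝ) :=
  ⟨contDiff_const, HasCompactSupport.zero, by simp [tsupport]⟩

theorem exists_isTestFunction_integral_eq_one {T : ℝ} (hT : 0 < T) :
    ∃ η : ℝ → ℝ, IsTestFunction (Ioo 0 T) η ∧ ∫ t in (0 : ℝ)..T, η t = 1 := by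
  let f : ContDiffBump (T / 2) := ⟨T / 8, T / 4, by linarith, by linarith⟩
  have hs : tsupport (f.normed volume) ⊆ Ioo 0 T := by
    rw [f.tsupport_normed_eq, Real.closedBall_eq_Icc]
    exact fun x hx => ⟨by have := hx.1; simp only [f] at this; linarith,
      by have := hx.2; simp only [f] at this; linarith⟩
  refine ⟨f.normed volume, ⟨f.contDiff_normed, f.hasCompactSupport_normed, hs⟩, ?_⟩
  rw [intervalIntegral.integral_of_le hT.le, setIntegral_eq_integral_of_forall_compl_eq_zero,
    f.integral_normed]
  intro x hx
  exact image_eq_zero_of_notMem_tsupport fun h => hx ⟨(hs h).1, (hs h).2.le⟩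

/-- A function with an integrable weak derivative on an interval is a primitive of it. -/
theorem exists_ae_eq_const_add_integral {T : ℝ} (hT : 0 < T) {p q : ℝ → ℝ}
    (hp : IntegrableOn p (Ioo 0 T)) (hq : IntegrableOn q (Ioo 0 T))
    (h : ∀ χ, IsTestFunction (Ioo 0 T) χ →
      ∫ t in Ioo 0 T, p t * deriv χ t = -∫ t in Ioo 0 T, q t * χ t) :
    ∃ c, ∀ᵐ t ∂(volume.restrict (Ioo 0 T)), p t = c + ∫ s in (0 : ℝ)..t, q s := by
  obtain ⟨η, hη, hη1⟩ := exists_isTestFunction_integral_eq_one hT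
  have conv : ∀ f : ℝ → ℝ, ∫ t in Ioo 0 T, f t = ∫ t in (0 : ℝ)..T, f t := fun f => by
    rw [intervalIntegral.integral_of_le hT.le, integral_Ioc_eq_integral_Ioo]
  have hqi : IntervalIntegrable q volume 0 T :=
    (intervalIntegrable_iff_integrableOn_Ioo_of_le hT.le).2 hq
  set P : ℝ → ℝ := fun t => ∫ s in (0 : ℝ)..t, q s with hP
  have hPac : AbsolutelyContinuousOnInterval P 0 T :=
    hqi.absolutelyContinuousOnInterval_intervalIntegral (by simp)
  have hPi : IntegrableOn P (Ioo 0 T) :=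
    (intervalIntegrable_iff_integrableOn_Ioo_of_le hT.le).1 hPac.continuousOn.intervalIntegrable
  have mulI : ∀ {f g : ℝ → ℝ}, IntegrableOn f (Ioo 0 T) → Continuous g →
      IntegrableOn (fun t => f t * g t) (Ioo 0 T) := fun {f g} hf hg =>
    (intervalIntegrable_iff_integrableOn_Ioo_of_le hT.le).1
      (((intervalIntegrable_iff_integrableOn_Ioo_of_le hT.le).2 hf).mul_continuousOn hg.continuousOn)
  have hk : ∀ χ, IsTestFunction (Ioo 0 T) χ → ∫ t in Ioo 0 T, (p t - P t) * deriv χ t = 0 := by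
    intro χ hχ
    have hχc : Continuous (deriv χ) := (contDiff_infty_iff_deriv.1 hχ.1).2.continuous
    have hχac : AbsolutelyContinuousOnInterval χ 0 T :=
      (hχ.1.of_le (by simp : (1 : ℕ∞ω) ≤ (∞ : ℕ∞ω))).contDiffOn.absolutelyContinuousOnInterval
    have hχ0 : ∀ t, t ∉ Ioo 0 T → χ t = 0 := fun t ht =>
      image_eq_zero_of_notMem_tsupport fun h => ht (hχ.2.2 h)
    have e1 : ∫ t in Ioo 0 T, P t * deriv χ t = -∫ t in Ioo 0 T, q t * χ t := by
      rw [conv, conv, hPac.integral_mul_deriv_eq_deriv_mul hχac, hχ0 0 (by simp), hχ0 T (by simp)]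
      simp only [mul_zero, sub_self, zero_sub, neg_inj]
      refine intervalIntegral.integral_congr_ae ?_
      filter_upwards [hqi.ae_hasDerivAt_integral] with t ht ht'
      rw [(ht (uIoc_subset_uIcc ht') 0 (by simp)).deriv]
    simp only [sub_mul]
    rw [integral_sub (mulI hp hχc) (mulI hPi hχc), h χ hχ, e1, sub_self]
  -- By `hk`, `p - P` annihilates derivatives of test functions. If it is a constant, that constant
  -- is its pairing with `η`, which has integral one.
  set c := ∫ t in Ioo 0 T, (p t - P t) * η t with hc
  have hkI : IntegrableOn (fun t => p t - P t) (Ioo 0 T) := hp.sub hPi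
  refine ⟨c, ?_⟩
  have key : ∀ᵐ t, t ∈ Ioo 0 T → p t - P t - c = 0 := by
    refine isOpen_Ioo.ae_eq_zero_of_integral_contDiff_smul_eq_zero ?_ ?_
    · exact (hkI.sub (integrableOn_const (by simp))).locallyIntegrableOn
    · intro χ h1 h2 h3
      have hχ : IsTestFunction (Ioo 0 T) χ := ⟨h1, h2, h3⟩
      set m := ∫ t in (0 : ℝ)..T, χ t with hm
      -- Removing the mean of `χ` with the help of `η` leaves a derivative of a test function.
      have hξ : IsTestFunction (Ioo 0 T) (χ + (-m) • η) := hχ.add (hη.const_smul _)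
      have hξ0 : ∫ t in (0 : ℝ)..T, (χ + (-m) • η) t = 0 := by
        simp only [Pi.add_apply, Pi.smul_apply, smul_eq_mul]
        rw [intervalIntegral.integral_add (h1.continuous.intervalIntegrable _ _)
          ((hη.1.continuous.const_mul _).intervalIntegrable _ _),
          intervalIntegral.integral_const_mul, hη1]
        simp [hm]
      obtain ⟨t1, t2⟩ := isTestFunction_primitive hT hξ hξ0
      have e := hk _ t1
      have t3 : deriv (fun t => ∫ s in (0 : ℝ)..t, (χ + (-m) • η) s) = χ + (-m) • η :=
        funext fun t => (t2 t).deriv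
      rw [t3] at e
      simp only [Pi.add_apply, Pi.smul_apply, smul_eq_mul, mul_add] at e
      have i1 := mulI hkI h1.continuous
      have i2 := mulI hkI hη.1.continuous
      have e2 : ∫ t in Ioo 0 T, (p t - P t) * χ t = m * c := by
        have : ∀ t, (p t - P t) * (-m * η t) = -m * ((p t - P t) * η t) := fun t => by ring
        simp only [this] at e
        rw [integral_add i1 (i2.const_mul _), integral_const_mul] at e
        linarith
      have : ∫ t, χ t • (p t - P t - c) = ∫ t in Ioo 0 T, χ t • (p t - P t - c) := by
        symm
        refine setIntegral_eq_integral_of_forall_compl_eq_zero fun t ht => ?_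
        rw [image_eq_zero_of_notMem_tsupport fun h => ht (h3 h), zero_smul]
      rw [this]
      have e3 : ∀ t, χ t • (p t - P t - c) = (p t - P t) * χ t - c * χ t := fun t => by
        simp only [smul_eq_mul]; ring
      simp only [e3]
      rw [integral_sub i1 ((h1.continuous.integrable_of_hasCompactSupport h2).const_mul c).integrableOn, e2,
        integral_const_mul, conv, ← hm]
      ring
  rw [ae_restrict_iff' measurableSet_Ioo]
  filter_upwards [key] with t ht ht'
  linarith [ht ht']

/-! ### Test functions on products -/

theorem IsTestFunction.prod {V W : Type*} [NormedAddCommGroup V] [NormedSpace ℝ V]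
    [NormedAddCommGroup W] [NormedSpace ℝ W] {A : Set V} {B : Set W} {ψ : V → ℝ} {χ : W → ℝ}
    (hψ : IsTestFunction A ψ) (hχ : IsTestFunction B χ) :
    IsTestFunction (A ×ˢ B) (fun p : V × W => ψ p.1 * χ p.2) := by
  have hs : tsupport (fun p : V × W => ψ p.1 * χ p.2) ⊆ tsupport ψ ×ˢ tsupport χ := by
    refine closure_minimal ?_ ((isClosed_tsupport _).prod (isClosed_tsupport _))
    intro p hp
    exact ⟨subset_tsupport _ (left_ne_zero_of_mul hp), subset_tsupport _ (right_ne_zero_of_mul hp)⟩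
  exact ⟨(hψ.1.comp contDiff_fst).mul (hχ.1.comp contDiff_snd),
    IsCompact.of_isClosed_subset (hψ.2.1.isCompact.prod hχ.2.1.isCompact) (isClosed_tsupport _) hs,
    hs.trans (prod_mono hψ.2.2 hχ.2.2)⟩

theorem fderiv_prod_mul_apply {V : Type*} [NormedAddCommGroup V] [NormedSpace ℝ V]
    {ψ : V → ℝ} {χ : ℝ → ℝ} (hψ : ContDiff ℝ ∞ ψ) (hχ : ContDiff ℝ ∞ χ) (p : V × ℝ) (e : V)
    (s : ℝ) :
    fderiv ℝ (fun p : V × ℝ => ψ p.1 * χ p.2) p (e, s)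
      = fderiv ℝ ψ p.1 e * χ p.2 + ψ p.1 * (s * deriv χ p.2) := by
  have h1 : HasFDerivAt (fun p : V × ℝ => ψ p.1)
      ((fderiv ℝ ψ p.1).comp (ContinuousLinearMap.fst ℝ V ℝ)) p :=
    ((hψ.differentiable (by simp)) p.1).hasFDerivAt.comp p hasFDerivAt_fst
  have h2 : HasFDerivAt (fun p : V × ℝ => χ p.2)
      ((fderiv ℝ χ p.2).comp (ContinuousLinearMap.snd ℝ V ℝ)) p :=
    ((hχ.differentiable (by simp)) p.2).hasFDerivAt.comp p hasFDerivAt_snd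
  rw [HasFDerivAt.fderiv (f := fun p : V × ℝ => ψ p.1 * χ p.2) (h1.mul h2)]
  have : fderiv ℝ χ p.2 s = s * deriv χ p.2 := by
    rw [fderiv_eq_smul_deriv]; simp
  simp [this]
  ring

/-! ### Square-integrable functions -/

theorem L2.real_inner_eq_integral_mul {α : Type*} {m : MeasurableSpace α} {μ : Measure α}
    (f g : Lp ℝ 2 μ) : inner ℝ f g = ∫ x, f x * g x ∂μ := by
  rw [L2.inner_def]
  refine integral_congr_ae (Eventually.of_forall fun x => ?_)
  simp [mul_comm]

theorem L2.real_inner_eq_integral_of_ae_eq {α : Type*} {m : MeasurableSpace α} {μ : Measure α}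
    {f g : Lp ℝ 2 μ} {f' g' : α → ℝ} (hf : f =ᵐ[μ] f') (hg : g =ᵐ[μ] g') :
    inner ℝ f g = ∫ x, f' x * g' x ∂μ := by
  rw [L2.real_inner_eq_integral_mul]
  refine integral_congr_ae ?_
  filter_upwards [hf, hg] with x h1 h2
  rw [h1, h2]

theorem HasCompactSupport.fderiv_apply_const {V : Type*} [NormedAddCommGroup V] [NormedSpace ℝ V]
    {φ : V → ℝ} (h : HasCompactSupport φ) (e : V) :
    HasCompactSupport (fun x => fderiv ℝ φ x e) :=
  (h.fderiv (𝕜 := ℝ)).comp_left (g := fun L : V →L[ℝ] ℝ => L e) rfl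

theorem IsTestFunction.fderiv_apply {V : Type*} [NormedAddCommGroup V] [NormedSpace ℝ V]
    {U : Set V} {φ : V → ℝ} (h : IsTestFunction U φ) (e : V) :
    IsTestFunction U (fun x => fderiv ℝ φ x e) := by
  refine ⟨(h.1.fderiv_right (by simp)).clm_apply contDiff_const, h.2.1.fderiv_apply_const e,
    (closure_minimal ?_ (isClosed_tsupport _)).trans h.2.2⟩
  intro x hx
  by_contra hcon
  exact hx (by simp [fderiv_of_notMem_tsupport ℝ hcon])

theorem IsTestFunction.memLp {V : Type*} [NormedAddCommGroup V] [NormedSpace ℝ V]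
    [MeasurableSpace V] [BorelSpace V] [SecondCountableTopology V] {μ : Measure V}
    [IsFiniteMeasureOnCompacts μ] {U : Set V} {φ : V → ℝ}
    (h : IsTestFunction U φ) (p : ℝ≥0∞) : MemLp φ p μ :=
  h.1.continuous.memLp_of_hasCompactSupport h.2.1

theorem IsTestFunction.exists_norm_le {V : Type*} [NormedAddCommGroup V] [NormedSpace ℝ V]
    {U : Set V} {φ : V → ℝ} (h : IsTestFunction U φ) : ∃ C, ∀ x, ‖φ x‖ ≤ C :=
  h.2.1.exists_bound_of_continuous h.1.continuous

/-- A function in `L²(Ω)` that is orthogonal to all test functions vanishes. -/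
theorem L2.eq_zero_of_forall_isTestFunction {d : ℕ} {Ω : Set (Eu d)} (hΩ : IsOpen Ω)
    (f : Lp ℝ 2 (volume.restrict Ω))
    (h : ∀ ψ, IsTestFunction Ω ψ → ∫ x in Ω, f x * ψ x = 0) : f = 0 := by
  have key : ∀ᵐ x, x ∈ Ω → f x = 0 := by
    refine hΩ.ae_eq_zero_of_integral_contDiff_smul_eq_zero ?_ fun ψ h1 h2 h3 => ?_
    · have h4 : LocallyIntegrable f (volume.restrict Ω) := (Lp.memLp f).locallyIntegrable (by simp)
      exact locallyIntegrableOn_of_locallyIntegrable_restrict h4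
    · rw [← h ψ ⟨h1, h2, h3⟩]
      symm
      rw [setIntegral_eq_integral_of_forall_compl_eq_zero fun x hx => ?_]
      · exact integral_congr_ae (Eventually.of_forall fun x => by simp [mul_comm])
      · rw [image_eq_zero_of_notMem_tsupport fun h => hx (h3 h), mul_zero]
  rw [Lp.eq_zero_iff_ae_eq_zero]
  exact (ae_restrict_iff' hΩ.measurableSet).2 key

/-- Countably many test functions suffice to test first-order weak identities in `L²`. -/
theorem exists_seq_isTestFunction {d : ℕ} (Ω : Set (Eu d)) :
    ∃ ψ : ℕ → Eu d → ℝ, (∀ n, IsTestFunction Ω (ψ n)) ∧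
      ∀ (F : Eu d → ℝ) (q : Fin d → Eu d → ℝ), MemLp F 2 (volume.restrict Ω) →
        (∀ i, MemLp (q i) 2 (volume.restrict Ω)) →
        (∀ n, ∫ x in Ω, (F x * ψ n x + ∑ i, q i x * fderiv ℝ (ψ n) x (basisVec i)) = 0) →
        ∀ φ, IsTestFunction Ω φ →
          ∫ x in Ω, (F x * φ x + ∑ i, q i x * fderiv ℝ φ x (basisVec i)) = 0 := by
  have : Fact ((2 : ℝ≥0∞) ≠ ⊤) := ⟨by simp⟩
  have : SecondCountableTopology (Lp ℝ 2 (volume.restrict Ω)) := inferInstance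
  let μ : Measure (Eu d) := volume.restrict Ω
  have : SecondCountableTopology (Lp ℝ 2 μ) := this
  -- The identity is a continuous linear condition on `(φ, ∇φ)` in `L²`. The range of `j` lies in a
  -- separable metric space, hence has a dense sequence. Countability matters because an identity
  -- that holds for almost every time, separately for each test function, then holds for all of them
  -- off one null set.
  let j : {φ : Eu d → ℝ // IsTestFunction Ω φ} → Lp ℝ 2 μ × (Fin d → Lp ℝ 2 μ) := fun φ =>
    ((φ.2.memLp 2).toLp, fun i => ((φ.2.fderiv_apply (basisVec i)).memLp 2).toLp)
  have : Nonempty (range j) := ⟨⟨_, ⟨0, isTestFunction_zero⟩, rfl⟩⟩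
  let s : ℕ → range j := TopologicalSpace.denseSeq (range j)
  choose ψ hψ using fun n => (s n).2
  refine ⟨fun n => ψ n, fun n => (ψ n).2, fun F q hF hq h φ hφ => ?_⟩
  let ℓ : Lp ℝ 2 μ × (Fin d → Lp ℝ 2 μ) → ℝ := fun y =>
    inner ℝ hF.toLp y.1 + ∑ i, inner ℝ (hq i).toLp (y.2 i)
  have hℓ : Continuous ℓ := by fun_prop
  have hj : ∀ φ, ℓ (j φ) =
      ∫ x in Ω, (F x * φ.1 x + ∑ i, q i x * fderiv ℝ φ.1 x (basisVec i)) := by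
    intro φ
    have e1 := (φ.2.memLp (μ := μ) 2)
    have e2 := fun i => ((φ.2.fderiv_apply (basisVec i)).memLp (μ := μ) 2)
    have i1 : Integrable (fun x => F x * φ.1 x) μ := hF.integrable_mul e1
    have i2 : ∀ i, Integrable (fun x => q i x * fderiv ℝ φ.1 x (basisVec i)) μ := fun i =>
      (hq i).integrable_mul (e2 i)
    rw [integral_add i1 (integrable_finsetSum _ fun i _ => i2 i),
      integral_finsetSum _ fun i _ => i2 i]
    simp only [ℓ, j]
    rw [L2.real_inner_eq_integral_of_ae_eq hF.coeFn_toLp e1.coeFn_toLp]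
    congr 1
    exact Finset.sum_congr rfl fun i _ =>
      L2.real_inner_eq_integral_of_ae_eq (hq i).coeFn_toLp (e2 i).coeFn_toLp
  have h0 : (fun y : range j => ℓ y) = fun _ => 0 :=
    (TopologicalSpace.denseRange_denseSeq (range j)).equalizer
      (hℓ.comp continuous_subtype_val) continuous_const (funext fun n => by
        have := hj (ψ n)
        rw [hψ n, h n] at this
        exact this)
  rw [← hj ⟨φ, hφ⟩]
  exact congrFun h0 ⟨_, ⟨φ, hφ⟩, rfl⟩

/-! ### The space-time cylinder -/

theorem volume_restrict_stCylinder {d : ℕ} (Ω : Set (Eu d)) (T : ℝ) :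
    volume.restrict (stCylinder Ω T)
      = (volume.restrict Ω).prod (volume.restrict (Ioo 0 T)) := by
  rw [Measure.prod_restrict, stCylinder, Measure.volume_eq_prod]

theorem ae_time_of_ae_stCylinder {d : ℕ} {Ω : Set (Eu d)} {T : ℝ} {P : Eu d × ℝ → Prop}
    (h : ∀ᵐ p ∂(volume.restrict (stCylinder Ω T)), P p) :
    ∀ᵐ t ∂(volume.restrict (Ioo 0 T)), ∀ᵐ x ∂(volume.restrict Ω), P (x, t) := by
  rw [volume_restrict_stCylinder] at h
  exact Measure.ae_ae_of_ae_prod (Measure.measurePreserving_swap.quasiMeasurePreserving.ae h)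

theorem MemL2Q.ae_memLp {d : ℕ} {Ω : Set (Eu d)} {T : ℝ} {f : Eu d × ℝ → ℝ} (h : MemL2Q Ω T f) :
    ∀ᵐ t ∂(volume.restrict (Ioo 0 T)), MemLp (fun x => f (x, t)) 2 (volume.restrict Ω) := by
  have h' := h
  rw [MemL2Q, volume_restrict_stCylinder] at h'
  filter_upwards [h'.1.prod_swap.prodMk_left, h'.integrable_sq.prod_left_ae] with t h1 h2
  exact (memLp_two_iff_integrable_sq h1).2 h2

theorem isFiniteMeasure_restrict_of_isBounded {d : ℕ} {Ω : Set (Eu d)}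
    (hΩ : Bornology.IsBounded Ω) : IsFiniteMeasure (volume.restrict Ω) :=
  isFiniteMeasure_restrict.2 hΩ.measure_lt_top.ne

/-- A first-order weak identity on `Ω × (0,T)` without time derivatives holds on almost every time
slice. -/
theorem ae_time_weak_identity {d : ℕ} {Ω : Set (Eu d)} (hΩb : Bornology.IsBounded Ω) {T : ℝ}
    {F : Eu d × ℝ → ℝ} {q : Fin d → Eu d × ℝ → ℝ} (hF : MemL2Q Ω T F) (hq : ∀ i, MemL2Q Ω T (q i))
    (h : ∀ φ, IsTestFunction (stCylinder Ω T) φ →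
      ∫ p in stCylinder Ω T, (F p * φ p + ∑ i, q i p * fderiv ℝ φ p (basisVec i, 0)) = 0) :
    ∀ᵐ t ∂(volume.restrict (Ioo 0 T)), ∀ ψ, IsTestFunction Ω ψ →
      ∫ x in Ω, (F (x, t) * ψ x + ∑ i, q i (x, t) * fderiv ℝ ψ x (basisVec i)) = 0 := by
  have := isFiniteMeasure_restrict_of_isBounded hΩb
  obtain ⟨ψ, hψ, hdet⟩ := exists_seq_isTestFunction Ω
  have hn : ∀ n, ∀ᵐ t ∂(volume.restrict (Ioo 0 T)),
      ∫ x in Ω, (F (x, t) * ψ n x + ∑ i, q i (x, t) * fderiv ℝ (ψ n) x (basisVec i)) = 0 := by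
    intro n
    set k : Eu d × ℝ → ℝ := fun p =>
      F p * ψ n p.1 + ∑ i, q i p * fderiv ℝ (ψ n) p.1 (basisVec i) with hk
    have mulI : ∀ {f : Eu d × ℝ → ℝ} {g : Eu d → ℝ}, MemL2Q Ω T f → IsTestFunction Ω g →
        Integrable (fun p => f p * g p.1)
          ((volume.restrict Ω).prod (volume.restrict (Ioo 0 T))) := by
      intro f g hf hg
      rw [MemL2Q, volume_restrict_stCylinder] at hf
      obtain ⟨C, hC⟩ := hg.exists_norm_le
      exact (hf.integrable (by norm_num)).mul_bdd (c := C)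
        (hg.1.continuous.comp continuous_fst).aestronglyMeasurable
        (Eventually.of_forall fun p => hC p.1)
    have hkI : Integrable k ((volume.restrict Ω).prod (volume.restrict (Ioo 0 T))) :=
      (mulI hF (hψ n)).add (integrable_finsetSum _ fun i _ =>
        mulI (hq i) ((hψ n).fderiv_apply (basisVec i)))
    -- Testing with the products `ψ n(x) χ(t)`, for arbitrary `χ`, localizes the identity in time.
    have hK : ∀ᵐ t, t ∈ Ioo 0 T → ∫ x in Ω, k (x, t) = 0 := by
      refine isOpen_Ioo.ae_eq_zero_of_integral_contDiff_smul_eq_zero ?_ fun χ h1 h2 h3 => ?_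
      · exact IntegrableOn.locallyIntegrableOn hkI.integral_prod_right
      · have hχ : IsTestFunction (Ioo 0 T) χ := ⟨h1, h2, h3⟩
        have e := h _ ((hψ n).prod hχ)
        have e2 : ∀ p : Eu d × ℝ, F p * (ψ n p.1 * χ p.2) + ∑ i, q i p *
            fderiv ℝ (fun p : Eu d × ℝ => ψ n p.1 * χ p.2) p (basisVec i, 0)
              = χ p.2 * k p := by
          intro p
          simp only [fderiv_prod_mul_apply (hψ n).1 h1, hk, mul_add, Finset.mul_sum]
          congr 1
          · ring
          · exact Finset.sum_congr rfl fun i _ => by ring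
        simp only [e2] at e
        obtain ⟨C, hC⟩ := hχ.exists_norm_le
        rw [volume_restrict_stCylinder, integral_prod_symm] at e
        · rw [← e]
          symm
          rw [setIntegral_eq_integral_of_forall_compl_eq_zero]
          · simp only [integral_const_mul, smul_eq_mul]
          · intro t ht
            simp [image_eq_zero_of_notMem_tsupport fun h => ht (h3 h)]
        · exact hkI.bdd_mul (c := C) (h1.continuous.comp continuous_snd).aestronglyMeasurable
            (Eventually.of_forall fun p => hC p.2)
    exact (ae_restrict_iff' measurableSet_Ioo).2 hK
  filter_upwards [ae_all_iff.2 hn, hF.ae_memLp, ae_all_iff.2 fun i => (hq i).ae_memLp]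
    with t h1 h2 h3
  exact hdet _ _ h2 h3 h1

/-! ### Weak time derivatives -/

/-- Testing with `ψ(x) χ(t)` shows that the scalar function `t ↦ ∫ f(·,t) ψ` has weak derivative `t
↦ ∫ g(·,t) ψ`, so the one-dimensional result applies. -/
theorem HasWeakTimeDeriv.exists_ae_eq {d : ℕ} {Ω : Set (Eu d)} (hΩb : Bornology.IsBounded Ω)
    {T : ℝ} (hT : 0 < T) {f g : Eu d × ℝ → ℝ} (hf : MemL2Q Ω T f) (hg : MemL2Q Ω T g)
    (h : HasWeakTimeDeriv Ω T f g) {ψ : Eu d → ℝ} (hψ : IsTestFunction Ω ψ) :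
    ∃ c : ℝ, ∀ᵐ t ∂(volume.restrict (Ioo 0 T)),
      ∫ x in Ω, f (x, t) * ψ x = c + ∫ s in (0 : ℝ)..t, ∫ x in Ω, g (x, s) * ψ x := by
  have := isFiniteMeasure_restrict_of_isBounded hΩb
  have mulI : ∀ {f : Eu d × ℝ → ℝ}, MemL2Q Ω T f → Integrable (fun p => f p * ψ p.1)
      ((volume.restrict Ω).prod (volume.restrict (Ioo 0 T))) := by
    intro f hf
    rw [MemL2Q, volume_restrict_stCylinder] at hf
    obtain ⟨C, hC⟩ := hψ.exists_norm_le
    exact (hf.integrable (by norm_num)).mul_bdd (c := C)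
      (hψ.1.continuous.comp continuous_fst).aestronglyMeasurable
      (Eventually.of_forall fun p => hC p.1)
  refine exists_ae_eq_const_add_integral hT (mulI hf).integral_prod_right
    (mulI hg).integral_prod_right fun χ hχ => ?_
  have e := h.2.2 _ (hψ.prod hχ)
  have key : ∀ {f : Eu d × ℝ → ℝ} {θ : ℝ → ℝ}, MemL2Q Ω T f → IsTestFunction (Ioo 0 T) θ →
      ∫ p in stCylinder Ω T, f p * (ψ p.1 * θ p.2)
        = ∫ t in Ioo 0 T, (∫ x in Ω, f (x, t) * ψ x) * θ t := by
    intro f θ hf hθ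
    obtain ⟨C, hC⟩ := hθ.exists_norm_le
    simp only [← mul_assoc]
    rw [volume_restrict_stCylinder, integral_prod_symm]
    · simp only [integral_mul_const]
    · exact (mulI hf).mul_bdd (c := C) (hθ.1.continuous.comp continuous_snd).aestronglyMeasurable
        (Eventually.of_forall fun p => hC p.2)
  have hχ' : IsTestFunction (Ioo 0 T) (deriv χ) := by
    have := hχ.fderiv_apply (1 : ℝ)
    simpa [fderiv_eq_smul_deriv] using this
  simp only [fderiv_prod_mul_apply hψ.1 hχ.1, map_zero, zero_mul, zero_add, one_mul] at e
  rw [key hf hχ', key hg hχ] at e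
  exact e

/-! ### Continuous representatives -/

theorem eqOn_Icc_of_ae_eq_slice {d : ℕ} {Ω : Set (Eu d)} {T : ℝ} (hT : 0 < T)
    {f : Eu d × ℝ → ℝ} {U V : ℝ → Lp ℝ 2 (volume.restrict Ω)} (hU : ContinuousOn U (Icc 0 T))
    (hV : ContinuousOn V (Icc 0 T))
    (h1 : ∀ᵐ t ∂(volume.restrict (Ioo 0 T)), U t =ᵐ[volume.restrict Ω] fun x => f (x, t))
    (h2 : ∀ᵐ t ∂(volume.restrict (Ioo 0 T)), V t =ᵐ[volume.restrict Ω] fun x => f (x, t)) :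
    EqOn U V (Icc 0 T) := by
  refine Measure.eqOn_Icc_of_ae_eq volume hT.ne ?_ hU hV
  rw [restrict_Ioo_eq_restrict_Icc.symm]
  filter_upwards [h1, h2] with t h3 h4
  exact Lp.ext (h3.trans h4.symm)

/-- The functional `ψ ↦ ∫_{Ω × S} g ψ` on `L²(Ω)` is bounded by a multiple of `√|S|`. -/
theorem MemL2Q.exists_timeIntegral {d : ℕ} {Ω : Set (Eu d)} {T : ℝ} {g : Eu d × ℝ → ℝ}
    (hg : MemL2Q Ω T g) : ∃ C : ℝ, ∀ S : Set ℝ, MeasurableSet S → S ⊆ Ioo 0 T →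
    ∃ w : Lp ℝ 2 (volume.restrict Ω), ‖w‖ ≤ C * √(volume.real S) ∧
      ∀ ψ : Lp ℝ 2 (volume.restrict Ω),
        inner ℝ w ψ = ∫ s in S, ∫ x in Ω, g (x, s) * ψ x := by
  set μ : Measure (Eu d) := volume.restrict Ω
  set τ : Measure ℝ := volume.restrict (Ioo 0 T)
  have hg' : MemLp g 2 (μ.prod τ) := by rwa [MemL2Q, volume_restrict_stCylinder] at hg
  refine ⟨‖hg'.toLp‖, fun S hS hST => ?_⟩
  have h1 : MemLp (S.indicator fun _ => (1 : ℝ)) 2 τ :=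
    memLp_indicator_const _ hS _ (Or.inr (measure_ne_top _ _))
  have hm : ∀ ψ : Lp ℝ 2 μ,
      MemLp (fun p : Eu d × ℝ => ψ p.1 * S.indicator (fun _ => (1 : ℝ)) p.2) 2 (μ.prod τ) := by
    intro ψ
    rw [memLp_two_iff_integrable_sq]
    · simp only [mul_pow]
      exact (Lp.memLp ψ).integrable_sq.mul_prod h1.integrable_sq
    · exact ((Lp.aestronglyMeasurable ψ).comp_quasiMeasurePreserving
        Measure.quasiMeasurePreserving_fst).mul
        (h1.1.comp_quasiMeasurePreserving Measure.quasiMeasurePreserving_snd)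
  -- `J ψ` is the product of `ψ` with the indicator of `S` in time, so its norm is `√|S| ‖ψ‖`. The
  -- vector `w` is the Riesz representative of `ψ ↦ ⟨g, J ψ⟩`; this avoids treating `s ↦ g(·,s)` as
  -- a measurable curve in `L²(Ω)`.
  let J : Lp ℝ 2 μ →ₗ[ℝ] Lp ℝ 2 (μ.prod τ) :=
    { toFun := fun ψ => (hm ψ).toLp
      map_add' := fun ψ φ => by
        rw [← MemLp.toLp_add]
        refine MemLp.toLp_congr _ _ ?_
        have := Measure.quasiMeasurePreserving_fst (μ := μ) (ν := τ) |>.ae (Lp.coeFn_add ψ φ)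
        filter_upwards [this] with p hp
        simp only [Pi.add_apply] at hp ⊢
        rw [hp]; ring
      map_smul' := fun c ψ => by
        simp only [RingHom.id_apply]
        rw [← MemLp.toLp_const_smul]
        refine MemLp.toLp_congr _ _ ?_
        have := Measure.quasiMeasurePreserving_fst (μ := μ) (ν := τ) |>.ae (Lp.coeFn_smul c ψ)
        filter_upwards [this] with p hp
        simp only [Pi.smul_apply, smul_eq_mul] at hp ⊢
        rw [hp]; ring }
  have hJ : ∀ ψ, J ψ = (hm ψ).toLp := fun ψ => rfl
  have hind : ∀ t, S.indicator (fun _ => (1 : ℝ)) t ^ 2 = S.indicator (fun _ => (1 : ℝ)) t := by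
    intro t
    by_cases h : t ∈ S <;> simp [h]
  have hJn : ∀ ψ, ‖J ψ‖ ≤ √(volume.real S) * ‖ψ‖ := by
    intro ψ
    refine le_of_eq ?_
    rw [← sq_eq_sq₀ (norm_nonneg _) (by positivity), mul_pow, Real.sq_sqrt measureReal_nonneg,
      ← real_inner_self_eq_norm_sq, ← real_inner_self_eq_norm_sq,
      L2.real_inner_eq_integral_mul ψ, hJ,
      L2.real_inner_eq_integral_of_ae_eq (hm ψ).coeFn_toLp (hm ψ).coeFn_toLp]
    have : ∀ p : Eu d × ℝ, (ψ p.1 * S.indicator (fun _ => (1 : ℝ)) p.2) *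
        (ψ p.1 * S.indicator (fun _ => (1 : ℝ)) p.2)
          = (ψ p.1 * ψ p.1) * S.indicator (fun _ => (1 : ℝ)) p.2 := fun p => by
      linear_combination (ψ p.1 ^ 2) * hind p.2
    simp only [this]
    rw [integral_prod_mul (fun x => ψ x * ψ x) (S.indicator fun _ => (1 : ℝ)), mul_comm]
    congr 1
    rw [integral_indicator hS, Measure.restrict_restrict hS, inter_eq_left.2 hST]
    simp
  let ℓ : Lp ℝ 2 μ →L[ℝ] ℝ := ((innerSL ℝ hg'.toLp).toLinearMap.comp J).mkContinuous
    (‖hg'.toLp‖ * √(volume.real S)) fun ψ => by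
      change ‖(inner ℝ hg'.toLp (J ψ) : ℝ)‖ ≤ _
      refine (norm_inner_le_norm _ _).trans ?_
      rw [mul_assoc]
      exact mul_le_mul_of_nonneg_left (hJn ψ) (norm_nonneg _)
  refine ⟨(InnerProductSpace.toDual ℝ _).symm ℓ, ?_, fun ψ => ?_⟩
  · rw [LinearIsometryEquiv.norm_map]
    exact LinearMap.mkContinuous_norm_le _ (by positivity) _
  · rw [InnerProductSpace.toDual_symm_apply]
    change inner ℝ hg'.toLp (J ψ) = _
    have i1 : Integrable (fun p : Eu d × ℝ => g p * (ψ p.1 * S.indicator (fun _ => (1 : ℝ)) p.2))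
      (μ.prod τ) := hg'.integrable_mul (hm ψ)
    rw [hJ, L2.real_inner_eq_integral_of_ae_eq hg'.coeFn_toLp (hm ψ).coeFn_toLp,
      integral_prod_symm _ i1, ← inter_eq_left.2 hST, ← Measure.restrict_restrict hS,
      ← integral_indicator hS]
    refine integral_congr_ae (Eventually.of_forall fun t => ?_)
    by_cases h : t ∈ S
    · simp [h, hST h]
    · simp [h]

/-- A square-integrable function with square-integrable weak time derivative belongs to
`C([0,T]; L²(Ω))`. -/
theorem HasWeakTimeDeriv.exists_continuousOn {d : ℕ} {Ω : Set (Eu d)} (hΩ : IsOpen Ω)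
    (hΩb : Bornology.IsBounded Ω) {T : ℝ} (hT : 0 < T) {f g : Eu d × ℝ → ℝ} (hf : MemL2Q Ω T f)
    (hg : MemL2Q Ω T g) (h : HasWeakTimeDeriv Ω T f g) :
    ∃ U : ℝ → Lp ℝ 2 (volume.restrict Ω), ContinuousOn U (Icc 0 T) ∧
      ∀ᵐ t ∂(volume.restrict (Ioo 0 T)), U t =ᵐ[volume.restrict Ω] fun x => f (x, t) := by
  have := isFiniteMeasure_restrict_of_isBounded hΩb
  set μ : Measure (Eu d) := volume.restrict Ω
  obtain ⟨C, hC⟩ := hg.exists_timeIntegral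
  have hsub : ∀ {s t : ℝ}, 0 ≤ s → t ≤ T → Ioo s t ⊆ Ioo 0 T := fun hs ht r hr =>
    ⟨hs.trans_lt hr.1, hr.2.trans_le ht⟩
  -- `W t` plays the role of the integral of `g` over `(0,t)`. The bound by `√(t - s)` on its
  -- increments makes it Hölder continuous.
  have hW : ∀ t : ℝ, ∃ w : Lp ℝ 2 μ, t ≤ T → ∀ ψ : Lp ℝ 2 μ,
      inner ℝ w ψ = ∫ s in Ioo 0 t, ∫ x in Ω, g (x, s) * ψ x := by
    intro t
    by_cases ht : t ≤ T
    · obtain ⟨w, -, hw⟩ := hC _ measurableSet_Ioo (hsub le_rfl ht)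
      exact ⟨w, fun _ => hw⟩
    · exact ⟨0, fun h => absurd h ht⟩
  choose W hW using hW
  have hgI : ∀ ψ : Lp ℝ 2 μ, IntegrableOn (fun s => ∫ x in Ω, g (x, s) * ψ x) (Ioo 0 T) := by
    intro ψ
    have hg' : MemLp g 2 (μ.prod (volume.restrict (Ioo 0 T))) := by
      rwa [MemL2Q, volume_restrict_stCylinder] at hg
    have hψ : MemLp (fun p : Eu d × ℝ => ψ p.1) 2 (μ.prod (volume.restrict (Ioo 0 T))) := by
      rw [memLp_two_iff_integrable_sq]
      · simpa using (Lp.memLp ψ).integrable_sq.mul_prod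
          (integrable_const (1 : ℝ) (μ := volume.restrict (Ioo 0 T)))
      · exact (Lp.aestronglyMeasurable ψ).comp_quasiMeasurePreserving
          Measure.quasiMeasurePreserving_fst
    exact Integrable.integral_prod_right (hg'.integrable_mul hψ)
  have hdiff : ∀ s t, 0 ≤ s → s ≤ t → t ≤ T → ‖W t - W s‖ ≤ C * √(t - s) := by
    intro s t hs hst ht
    obtain ⟨w, hw1, hw2⟩ := hC _ measurableSet_Ioo (hsub hs ht)
    have : W t - W s = w := by
      refine ext_inner_right ℝ fun ψ => ?_
      rw [inner_sub_left, hW t ht, hW s (hst.trans ht), hw2]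
      have i1 := (hgI ψ).mono_set (hsub le_rfl (hst.trans ht))
      have i2 := (hgI ψ).mono_set (hsub hs ht)
      simp only [← integral_Ioc_eq_integral_Ioo]
      rw [← Ioc_union_Ioc_eq_Ioc hs hst, setIntegral_union (Ioc_disjoint_Ioc_of_le le_rfl)
        measurableSet_Ioc ((integrableOn_Ioc_iff_integrableOn_Ioo).2 i1)
        ((integrableOn_Ioc_iff_integrableOn_Ioo).2 i2)]
      ring
    rw [this]
    simpa [hst] using hw1
  have hWc : ContinuousOn W (Icc 0 T) := by
    intro s hs
    rw [ContinuousWithinAt, tendsto_iff_norm_sub_tendsto_zero]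
    have hlim : Tendsto (fun t => C * √|t - s|) (𝓝[Icc 0 T] s) (𝓝 0) := by
      have : Continuous fun t => C * √|t - s| := by fun_prop
      simpa using (this.tendsto s).mono_left nhdsWithin_le_nhds
    refine squeeze_zero' (Eventually.of_forall fun _ => norm_nonneg _) ?_ hlim
    filter_upwards [self_mem_nhdsWithin] with t ht
    rcases le_total s t with h | h
    · rw [abs_of_nonneg (sub_nonneg.2 h)]
      exact hdiff s t hs.1 h ht.2
    · rw [norm_sub_rev, abs_sub_comm, abs_of_nonneg (sub_nonneg.2 h)]
      exact hdiff t s ht.1 h hs.2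
  obtain ⟨ψ, hψ, hdet⟩ := exists_seq_isTestFunction Ω
  choose c hc using fun n => h.exists_ae_eq hΩb hT hf hg (hψ n)
  have hgood : ∀ᵐ t ∂(volume.restrict (Ioo 0 T)), t ∈ Ioo 0 T ∧
      MemLp (fun x => f (x, t)) 2 μ ∧ ∀ n, ∫ x in Ω, (f (x, t) - W t x) * ψ n x = c n := by
    filter_upwards [ae_restrict_mem measurableSet_Ioo, hf.ae_memLp, ae_all_iff.2 hc]
      with t h1 h2 h3
    refine ⟨h1, h2, fun n => ?_⟩
    have m := (hψ n).memLp (μ := μ) 2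
    have e := hW t h1.2.le m.toLp
    rw [L2.real_inner_eq_integral_of_ae_eq EventuallyEq.rfl m.coeFn_toLp] at e
    have e' : ∀ s, ∫ x in Ω, g (x, s) * (m.toLp (ψ n)) x = ∫ x in Ω, g (x, s) * ψ n x := fun s => by
      refine integral_congr_ae ?_
      filter_upwards [m.coeFn_toLp] with x hx
      rw [hx]
    simp only [e'] at e
    have h4 := h3 n
    rw [intervalIntegral.integral_of_le h1.1.le, integral_Ioc_eq_integral_Ioo, ← e] at h4
    have i1 : Integrable (fun x => f (x, t) * ψ n x) μ := h2.integrable_mul m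
    have i2 : Integrable (fun x => W t x * ψ n x) μ := (Lp.memLp (W t)).integrable_mul m
    simp only [sub_mul]
    rw [integral_sub i1 i2, h4]
    ring
  have : NeZero (volume.restrict (Ioo 0 T)) := ⟨by simp [Measure.restrict_eq_zero, hT]⟩
  obtain ⟨t₀, -, hm₀, hc₀⟩ := hgood.exists
  -- Tested with each `ψ n`, the difference `f(·,t) - W t` is independent of the good time `t`. Its
  -- value at one good time `t₀` therefore serves as the constant of integration.
  refine ⟨fun t => W t + (hm₀.toLp - W t₀), hWc.add continuousOn_const, ?_⟩
  filter_upwards [hgood] with t ht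
  obtain ⟨-, hm, hct⟩ := ht
  have key : W t + (hm₀.toLp - W t₀) = hm.toLp := by
    rw [← sub_eq_zero]
    refine L2.eq_zero_of_forall_isTestFunction hΩ _ fun φ hφ => ?_
    have := hdet (W t + (hm₀.toLp - W t₀) - hm.toLp : Lp ℝ 2 μ) (fun _ _ => 0) (Lp.memLp _)
      (fun i => MemLp.zero) (fun n => ?_) φ hφ
    · simpa using this
    · have m := (hψ n).memLp (μ := μ) 2
      have i1 : Integrable (fun x => (f (x, t₀) - W t₀ x) * ψ n x) μ :=
        (hm₀.sub (Lp.memLp (W t₀))).integrable_mul m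
      have i2 : Integrable (fun x => (f (x, t) - W t x) * ψ n x) μ :=
        (hm.sub (Lp.memLp (W t))).integrable_mul m
      have e := integral_sub i1 i2
      rw [hc₀ n, hct n, sub_self] at e
      simp only [zero_mul, Finset.sum_const_zero, add_zero]
      rw [← e]
      refine integral_congr_ae ?_
      filter_upwards [Lp.coeFn_sub (W t + (hm₀.toLp - W t₀)) hm.toLp,
        Lp.coeFn_add (W t) (hm₀.toLp - W t₀), Lp.coeFn_sub hm₀.toLp (W t₀), hm₀.coeFn_toLp,
        hm.coeFn_toLp] with x e1 e2 e3 e4 e5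
      rw [e1, Pi.sub_apply, e2, Pi.add_apply, e3, Pi.sub_apply, e4, e5]
      ring
  simp only [key]
  exact hm.coeFn_toLp

/-- The continuous representative of a function is differentiable in time, if the weak time
derivative has a continuous representative too. -/
theorem HasWeakTimeDeriv.hasDerivAt {d : ℕ} {Ω : Set (Eu d)} (hΩ : IsOpen Ω)
    (hΩb : Bornology.IsBounded Ω) {T : ℝ} (hT : 0 < T) {f g : Eu d × ℝ → ℝ} (hf : MemL2Q Ω T f)
    (hg : MemL2Q Ω T g) (h : HasWeakTimeDeriv Ω T f g)
    {U V : ℝ → Lp ℝ 2 (volume.restrict Ω)} (hU : ContinuousOn U (Icc 0 T))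
    (hV : ContinuousOn V (Icc 0 T))
    (hUf : ∀ᵐ t ∂(volume.restrict (Ioo 0 T)), U t =ᵐ[volume.restrict Ω] fun x => f (x, t))
    (hVg : ∀ᵐ t ∂(volume.restrict (Ioo 0 T)), V t =ᵐ[volume.restrict Ω] fun x => g (x, t))
    {t : ℝ} (ht : t ∈ Ioo 0 T) : HasDerivAt U (V t) t := by
  have hVi : IntervalIntegrable V volume 0 T :=
    (hV.mono (by rw [uIcc_of_le hT.le])).intervalIntegrable
  have hVs : ∀ {s : ℝ}, s ∈ Icc 0 T → IntervalIntegrable V volume 0 s := fun hs =>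
    hVi.mono_set (by rw [uIcc_of_le hs.1, uIcc_of_le hT.le]; exact Icc_subset_Icc_right hs.2)
  have hPc : ContinuousOn (fun s => ∫ r in (0 : ℝ)..s, V r) (Icc 0 T) := by
    have := intervalIntegral.continuousOn_primitive_interval' hVi left_mem_uIcc
    rwa [uIcc_of_le hT.le] at this
  -- Paired with a test function this is the scalar formula for weak derivatives. It extends from
  -- almost every time to all times by continuity, and evaluation at `0` identifies the constant.
  -- Differentiability then follows from the fundamental theorem of calculus.
  have key : EqOn U (fun s => U 0 + ∫ r in (0 : ℝ)..s, V r) (Icc 0 T) := by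
    intro s hs
    rw [← sub_eq_zero]
    refine L2.eq_zero_of_forall_isTestFunction hΩ _ fun ψ hψ => ?_
    have m := hψ.memLp (μ := volume.restrict Ω) 2
    obtain ⟨c, hc⟩ := h.exists_ae_eq hΩb hT hf hg hψ
    have hin : ∀ v : Lp ℝ 2 (volume.restrict Ω), ∫ x in Ω, v x * ψ x = inner ℝ m.toLp v := fun v => by
      rw [real_inner_comm, L2.real_inner_eq_integral_of_ae_eq EventuallyEq.rfl m.coeFn_toLp]
    have hint : ∀ r ∈ Icc 0 T, ∫ r in (0 : ℝ)..r, ∫ x in Ω, g (x, r) * ψ x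
        = inner ℝ m.toLp (∫ r in (0 : ℝ)..r, V r) := by
      intro r hr
      have e := (innerSL ℝ m.toLp).intervalIntegral_comp_comm (hVs hr)
      simp only [innerSL_apply_apply] at e
      rw [← e]
      refine intervalIntegral.integral_congr_ae ?_
      have hVg' := (ae_restrict_iff' measurableSet_Ioo).1 hVg
      have hne : ∀ᵐ q : ℝ, q ≠ T := by simp [ae_iff]
      filter_upwards [hVg', hne] with q hq hqT hq'
      rw [uIoc_of_le hr.1] at hq'
      rw [← hin]
      refine integral_congr_ae ?_
      filter_upwards [hq ⟨hq'.1, lt_of_le_of_ne (hq'.2.trans hr.2) hqT⟩] with x hx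
      rw [hx]
    have hE : EqOn (fun r => inner ℝ m.toLp (U r))
        (fun r => c + inner ℝ m.toLp (∫ r in (0 : ℝ)..r, V r)) (Icc 0 T) := by
      refine Measure.eqOn_Icc_of_ae_eq volume hT.ne ?_ (continuousOn_const.inner hU)
        (continuousOn_const.add (continuousOn_const.inner hPc))
      rw [restrict_Ioo_eq_restrict_Icc.symm]
      filter_upwards [hc, hUf, ae_restrict_mem measurableSet_Ioo] with r h1 h2 h3
      rw [← hint r ⟨h3.1.le, h3.2.le⟩, ← h1, ← hin]
      refine integral_congr_ae ?_
      filter_upwards [h2] with x hx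
      rw [hx]
    have h0 := hE ⟨le_rfl, hT.le⟩
    have h1 := hE hs
    simp only [intervalIntegral.integral_same, inner_zero_right, add_zero] at h0 h1
    rw [hin, inner_sub_right, inner_add_right, h0, h1]
    ring
  have hd : HasDerivAt (fun s => U 0 + ∫ r in (0 : ℝ)..s, V r) (V t) t := by
    refine (intervalIntegral.integral_hasDerivAt_right (hVs ⟨ht.1.le, ht.2.le⟩) ?_ ?_).const_add _
    · exact (hV.mono Ioo_subset_Icc_self).stronglyMeasurableAtFilter isOpen_Ioo t ht
    · exact hV.continuousAt (Icc_mem_nhds ht.1 ht.2)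
  refine hd.congr_of_eventuallyEq ?_
  filter_upwards [Icc_mem_nhds ht.1 ht.2] with s hs using key hs

/-! ### Weak derivatives -/

theorem HasWeakDeriv.ae_eq {V : Type*} [NormedAddCommGroup V] [NormedSpace ℝ V]
    [FiniteDimensional ℝ V] [MeasureSpace V] [BorelSpace V] {U : Set V} (hU : IsOpen U) {e : V}
    {f g g' : V → ℝ} (h : HasWeakDeriv U e f g) (h' : HasWeakDeriv U e f g') :
    g =ᵐ[volume.restrict U] g' := by
  have key : ∀ᵐ x, x ∈ U → g x - g' x = 0 := by
    refine hU.ae_eq_zero_of_integral_contDiff_smul_eq_zero (h.2.1.sub h'.2.1) fun φ h1 h2 h3 => ?_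
    have hφ : IsTestFunction U φ := ⟨h1, h2, h3⟩
    have hI : ∀ {k : V → ℝ}, LocallyIntegrableOn k U → IntegrableOn (fun x => k x * φ x) U := by
      intro k hk
      obtain ⟨C, hC⟩ := hφ.exists_norm_le
      have i1 : IntegrableOn (fun x => k x * φ x) (tsupport φ) :=
        (hk.integrableOn_compact_subset h3 h2.isCompact).mul_bdd (c := C)
          h1.continuous.aestronglyMeasurable (Eventually.of_forall hC)
      refine IntegrableOn.mono_set (t := univ) ?_ (subset_univ _)
      rw [integrableOn_univ]
      refine (integrableOn_iff_integrable_of_support_subset ?_).1 i1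
      exact fun x hx => subset_tsupport _ (right_ne_zero_of_mul hx)
    have e1 := h.2.2 φ hφ
    have e2 := h'.2.2 φ hφ
    have e3 : ∫ x, φ x • (g x - g' x) = ∫ x in U, (g x * φ x - g' x * φ x) := by
      rw [setIntegral_eq_integral_of_forall_compl_eq_zero fun x hx => ?_]
      · exact integral_congr_ae (Eventually.of_forall fun x => by simp; ring)
      · rw [image_eq_zero_of_notMem_tsupport fun h => hx (h3 h)]; simp
    rw [e3, integral_sub (hI h.2.1) (hI h'.2.1)]
    linarith
  refine (ae_restrict_iff' hU.measurableSet).2 ?_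
  filter_upwards [key] with x hx hxU
  linarith [hx hxU]

theorem fderiv_fderiv_apply_comm {V : Type*} [NormedAddCommGroup V] [NormedSpace ℝ V]
    {φ : V → ℝ} (hφ : ContDiff ℝ ∞ φ) (e e' : V) (x : V) :
    fderiv ℝ (fun y => fderiv ℝ φ y e) x e' = fderiv ℝ (fun y => fderiv ℝ φ y e') x e := by
  have hd : DifferentiableAt ℝ (fderiv ℝ φ) x :=
    ((hφ.fderiv_right (m := ∞) (by simp)).differentiable (by simp)) x
  have h : ∀ e : V, fderiv ℝ (fun y => fderiv ℝ φ y e) x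
      = (ContinuousLinearMap.apply ℝ ℝ e).comp (fderiv ℝ (fderiv ℝ φ) x) := fun e =>
    ((ContinuousLinearMap.apply ℝ ℝ e).hasFDerivAt.comp x hd.hasFDerivAt).fderiv
  rw [h, h]
  exact (hφ.contDiffAt.isSymmSndFDerivAt (by
    simpa using (WithTop.coe_le_coe.2 le_top : ((2 : ℕ∞) : ℕ∞ω) ≤ (∞ : ℕ∞ω)))).eq _ _

/-- If `h = ∂_{e'} f`, `g = ∂_e f` and `k = ∂_e h` weakly, then `k = ∂_{e'} g` weakly. -/
theorem HasWeakDeriv.comm {V : Type*} [NormedAddCommGroup V] [NormedSpace ℝ V] [MeasureSpace V]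
    {U : Set V} {e e' : V} {f g h k : V → ℝ} (h1 : HasWeakDeriv U e' f h)
    (h2 : HasWeakDeriv U e f g) (h3 : HasWeakDeriv U e h k) : HasWeakDeriv U e' g k := by
  refine ⟨h2.2.1, h3.2.1, fun φ hφ => ?_⟩
  have e1 := h2.2.2 _ (hφ.fderiv_apply e')
  have e2 := h1.2.2 _ (hφ.fderiv_apply e)
  have e3 := h3.2.2 _ hφ
  simp only [fderiv_fderiv_apply_comm hφ.1 e' e] at e1
  linarith

/-! ### The frequency function -/

/-- The lower-order coefficients are merely bounded in time, so the equation is available for almost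
every time only. Inequalities from which `f` has been eliminated have continuous sides, and this
lemma makes them hold at every time. -/
theorem ContinuousOn.le_of_ae_le_Ioo {T : ℝ} {f g : ℝ → ℝ} (hf : ContinuousOn f (Ioo 0 T))
    (hg : ContinuousOn g (Ioo 0 T)) (h : ∀ᵐ t ∂(volume.restrict (Ioo 0 T)), f t ≤ g t) :
    ∀ t ∈ Ioo 0 T, f t ≤ g t := by
  have h1 : EqOn (fun t => max (f t) (g t)) g (Ioo 0 T) := by
    refine Measure.eqOn_open_of_ae_eq (μ := volume) ?_ isOpen_Ioo (hf.sup hg) hg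
    filter_upwards [h] with t ht using max_eq_right ht
  exact fun t ht => max_eq_right_iff.1 (h1 ht)

section Frequency

variable {H : Type*} [NormedAddCommGroup H] [InnerProductSpace ℝ H]

/-- With `w = y - f/2` the left side equals `(‖u‖²‖f‖² - ⟨f,u⟩²)/2 - 2(‖w‖²‖u‖² - ⟨w,u⟩²)`, and the
last bracket is nonnegative by Cauchy-Schwarz. In the application `f - y` stands for `A u`, and the
left side is the dangerous part of the numerator in the derivative of the Dirichlet quotient. -/
theorem two_mul_inner_sub_le (f y u : H) :
    2 * ‖u‖ ^ 2 * inner ℝ (f - y) y - 2 * inner ℝ (f - y) u * inner ℝ u y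
      ≤ ‖u‖ ^ 2 * ‖f‖ ^ 2 / 2 := by
  set w := y - (1 / 2 : ℝ) • f with hw
  have hy : y = w + (1 / 2 : ℝ) • f := by rw [hw]; abel
  have hfy : f - y = (1 / 2 : ℝ) • f - w := by
    rw [hw]; module
  have hcs : inner ℝ w u ^ 2 ≤ ‖w‖ ^ 2 * ‖u‖ ^ 2 := by
    rw [← mul_pow]
    exact sq_le_sq' (by linarith [neg_le_of_abs_le (abs_real_inner_le_norm w u)])
      (real_inner_le_norm w u)
  have e1 : inner ℝ (f - y) y = ‖f‖ ^ 2 / 4 - ‖w‖ ^ 2 := by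
    rw [hfy, hy, inner_sub_left, inner_add_right, inner_add_right]
    simp only [real_inner_smul_left, real_inner_smul_right, real_inner_self_eq_norm_sq,
      real_inner_comm f w, norm_smul, mul_pow, Real.norm_eq_abs, sq_abs]
    ring
  have e2 : inner ℝ (f - y) u = inner ℝ f u / 2 - inner ℝ w u := by
    rw [hfy, inner_sub_left, real_inner_smul_left]; ring
  have e3 : inner ℝ u y = inner ℝ w u + inner ℝ f u / 2 := by
    rw [real_inner_comm, hy, inner_add_left, real_inner_smul_left]; ring
  rw [e1, e2, e3]
  nlinarith [sq_nonneg (inner ℝ f u)]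

/-- Lower bound for `‖u‖²` from the differential inequalities of the frequency function, as long as
`u` does not vanish. -/
theorem log_lower_bound_of_pos {c c₂ T s t : ℝ} (hc : 0 ≤ c) (hc₂ : 0 ≤ c₂) (hst : s ≤ t)
    (hs0 : 0 < s) (htT : t < T) {n n' E E' : ℝ → ℝ}
    (hn : ∀ r ∈ Icc s t, HasDerivAt n (n' r) r) (hE : ∀ r ∈ Icc s t, HasDerivAt E (E' r) r)
    (hpos : ∀ r ∈ Icc s t, 0 < n r) (hEpos : ∀ r ∈ Icc s t, 0 ≤ E r)
    (h1 : ∀ r ∈ Icc s t, E' r * n r - E r * n' r ≤ c * E r * n r)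
    (h2 : ∀ r ∈ Icc s t, -n' r ≤ c₂ * E r) :
    n s * Real.exp (-(c₂ * Real.exp (c * T) * T * (E s / n s))) ≤ n t := by
  have hFd : ∀ r ∈ Icc s t, HasDerivAt (fun r => E r / n r * Real.exp (-(c * r)))
      ((E' r * n r - E r * n' r) / n r ^ 2 * Real.exp (-(c * r))
        + E r / n r * (Real.exp (-(c * r)) * (-c))) r := by
    intro r hr
    have h3 : HasDerivAt (fun r : ℝ => Real.exp (-(c * r))) (Real.exp (-(c * r)) * (-c)) r := by
      have := ((hasDerivAt_id r).const_mul c).neg.exp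
      simpa using this
    exact ((hE r hr).div (hn r hr) (hpos r hr).ne').mul h3
  -- `h1` says that the quotient `N = E / n` satisfies `N' ≤ c N`.
  have hF : AntitoneOn (fun r => E r / n r * Real.exp (-(c * r))) (Icc s t) := by
    refine antitoneOn_of_deriv_nonpos (convex_Icc _ _)
      (fun r hr => (hFd r hr).continuousAt.continuousWithinAt) ?_ ?_
    · rw [interior_Icc]
      exact fun r hr => (hFd r (Ioo_subset_Icc_self hr)).differentiableAt.differentiableWithinAt
    · rw [interior_Icc]
      intro r hr
      have hr' := Ioo_subset_Icc_self hr
      rw [(hFd r hr').deriv]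
      have hp := hpos r hr'
      have : (E' r * n r - E r * n' r) / n r ^ 2 ≤ c * (E r / n r) := by
        rw [div_le_iff₀ (by positivity)]
        have : c * (E r / n r) * n r ^ 2 = c * E r * n r := by field_simp
        rw [this]
        exact h1 r hr'
      nlinarith [Real.exp_pos (-(c * r))]
  set K := E s / n s with hK
  have hs : s ∈ Icc s t := ⟨le_rfl, hst⟩
  have hK0 : 0 ≤ K := div_nonneg (hEpos s hs) (hpos s hs).le
  have hN : ∀ r ∈ Icc s t, E r / n r ≤ K * Real.exp (c * T) := by
    intro r hr
    have h3 := hF hs hr hr.1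
    simp only at h3
    have h4 : E r / n r = E r / n r * Real.exp (-(c * r)) * Real.exp (c * r) := by
      rw [mul_assoc, ← Real.exp_add]; simp
    rw [h4]
    have h5 : Real.exp (-(c * s)) ≤ 1 := Real.exp_le_one_iff.2 (by nlinarith)
    have h6 : Real.exp (c * r) ≤ Real.exp (c * T) :=
      Real.exp_le_exp.2 (mul_le_mul_of_nonneg_left (hr.2.trans htT.le) hc)
    refine mul_le_mul (h3.trans ?_) h6 (Real.exp_pos _).le hK0
    exact mul_le_of_le_one_right hK0 h5
  set A := c₂ * (K * Real.exp (c * T)) with hA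
  have hA0 : 0 ≤ A := by positivity
  have hGd : ∀ r ∈ Icc s t, HasDerivAt (fun r => Real.log (n r) + A * r) (n' r / n r + A) r := by
    intro r hr
    have h3 := ((hasDerivAt_id r).const_mul A)
    simp only [mul_one, id] at h3
    exact ((hn r hr).log (hpos r hr).ne').add h3
  -- By `h2` the logarithmic decay rate of `n` is at most `c₂ E / n`, which `hN` bounds by `A`.
  have hG : MonotoneOn (fun r => Real.log (n r) + A * r) (Icc s t) := by
    refine monotoneOn_of_deriv_nonneg (convex_Icc _ _)
      (fun r hr => (hGd r hr).continuousAt.continuousWithinAt) ?_ ?_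
    · rw [interior_Icc]
      exact fun r hr => (hGd r (Ioo_subset_Icc_self hr)).differentiableAt.differentiableWithinAt
    · rw [interior_Icc]
      intro r hr
      have hr' := Ioo_subset_Icc_self hr
      rw [(hGd r hr').deriv]
      have hp := hpos r hr'
      have h4 : -n' r / n r ≤ c₂ * (E r / n r) := by
        rw [← mul_div_assoc]
        exact div_le_div_of_nonneg_right (h2 r hr') hp.le
      have h5 := mul_le_mul_of_nonneg_left (hN r hr') hc₂
      rw [neg_div] at h4
      linarith
  have ht : t ∈ Icc s t := ⟨hst, le_rfl⟩
  have h3 := hG hs ht hst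
  simp only at h3
  have h4 : Real.log (n s) - A * T ≤ Real.log (n t) := by nlinarith
  have h5 := Real.exp_le_exp.2 h4
  rw [Real.exp_log (hpos t ht), sub_eq_add_neg, Real.exp_add, Real.exp_log (hpos s hs)] at h5
  refine le_trans (le_of_eq ?_) h5
  rw [hA]
  congr 3
  ring

/-- Positivity is needed at the initial time only: up to the first time at which `n` falls to a
level strictly below the claimed bound `δ`, `n` is positive, and there the previous estimate already
gives `n ≥ δ`. -/
theorem log_lower_bound {c c₂ T s t : ℝ} (hc : 0 ≤ c) (hc₂ : 0 ≤ c₂) (hst : s ≤ t)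
    (hs0 : 0 < s) (htT : t < T) {n n' E E' : ℝ → ℝ}
    (hn : ∀ r ∈ Icc s t, HasDerivAt n (n' r) r) (hE : ∀ r ∈ Icc s t, HasDerivAt E (E' r) r)
    (hpos : 0 < n s) (hEpos : ∀ r ∈ Icc s t, 0 ≤ E r)
    (h1 : ∀ r ∈ Icc s t, E' r * n r - E r * n' r ≤ c * E r * n r)
    (h2 : ∀ r ∈ Icc s t, -n' r ≤ c₂ * E r) :
    n s * Real.exp (-(c₂ * Real.exp (c * T) * T * (E s / n s))) ≤ n t := by
  set δ := n s * Real.exp (-(c₂ * Real.exp (c * T) * T * (E s / n s))) with hδ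
  have hδ0 : 0 < δ := mul_pos hpos (Real.exp_pos _)
  have hs : s ∈ Icc s t := ⟨le_rfl, hst⟩
  have hδs : δ ≤ n s := by
    refine mul_le_of_le_one_right hpos.le (Real.exp_le_one_iff.2 ?_)
    have : 0 ≤ E s / n s := div_nonneg (hEpos s hs) hpos.le
    have hT : 0 ≤ T := by linarith
    have := Real.exp_pos (c * T)
    have : 0 ≤ c₂ * Real.exp (c * T) * T * (E s / n s) := by positivity
    linarith
  by_contra! hlt
  -- A level that `n` reaches by time `t`, strictly below `δ`; the entry `δ / 2` keeps it positive,
  -- since no sign of `n t` is known.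
  set γ := max (n t) (δ / 2) with hγ
  have hγ0 : 0 < γ := lt_max_of_lt_right (by linarith)
  have hγδ : γ < δ := max_lt hlt (by linarith)
  have hnc : ContinuousOn n (Icc s t) := fun r hr => (hn r hr).continuousAt.continuousWithinAt
  have hZ : IsCompact (Icc s t ∩ n ⁻¹' Iic γ) :=
    isCompact_Icc.of_isClosed_subset (hnc.preimage_isClosed_of_isClosed isClosed_Icc isClosed_Iic)
      inter_subset_left
  obtain ⟨q, ⟨hq, hqγ⟩, hqmin⟩ := hZ.exists_isLeast ⟨t, ⟨hst, le_rfl⟩, (le_max_left _ _ : n t ≤ γ)⟩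
  have hlow : ∀ r ∈ Icc s q, 0 < n r := by
    intro r hr
    have hr' : r ∈ Icc s t := ⟨hr.1, hr.2.trans hq.2⟩
    have hge : ∀ r ∈ Ico s q, γ ≤ n r := fun r hr => by
      by_contra! hcon
      exact absurd (hqmin ⟨⟨hr.1, hr.2.le.trans hq.2⟩, hcon.le⟩) (not_le.2 hr.2)
    rcases hr.2.lt_or_eq with h | h
    · exact hγ0.trans_le (hge r ⟨hr.1, h⟩)
    · have hsq : s < q := by
        rcases hq.1.lt_or_eq with h' | h'
        · exact h'
        · exfalso
          rw [← h'] at hqγ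
          have : n s ≤ γ := hqγ
          linarith
      rw [h]
      refine hγ0.trans_le (ge_of_tendsto (f := n) (x := 𝓝[<] q) ?_ ?_)
      · exact (hn q hq).continuousAt.mono_left nhdsWithin_le_nhds
      · filter_upwards [Ico_mem_nhdsLT hsq] with r hr using hge r hr
  have hsub : Icc s q ⊆ Icc s t := Icc_subset_Icc_right hq.2
  have := log_lower_bound_of_pos hc hc₂ hq.1 hs0 (hq.2.trans_lt htT) (fun r hr => hn r (hsub hr))
    (fun r hr => hE r (hsub hr)) hlow (fun r hr => hEpos r (hsub hr)) (fun r hr => h1 r (hsub hr))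
    (fun r hr => h2 r (hsub hr))
  have h3 : n q ≤ γ := hqγ
  linarith

/-- Backward uniqueness, quantitatively: a solution of `u' + A u = f` in a weak sense, where
`e = ⟨A u, u⟩` is almost decreasing and `f` is controlled by `e`, cannot decay faster than
exponentially at a rate that is determined by `‖u'(0)‖ / ‖u(0)‖`. -/
theorem norm_sq_lower_bound {lam B T : ℝ} (hlam : 0 ≤ lam) (hB : 0 ≤ B) (hT : 0 < T)
    {u y : ℝ → H} {e e' : ℝ → ℝ} (huc : ContinuousOn u (Icc 0 T)) (hyc : ContinuousOn y (Icc 0 T))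
    (hu : ∀ t ∈ Ioo 0 T, HasDerivAt u (y t) t) (he : ∀ t ∈ Ioo 0 T, HasDerivAt e (e' t) t)
    (hec : ContinuousOn e' (Ioo 0 T)) (he0 : ∀ t ∈ Ioo 0 T, 0 ≤ e t)
    (h : ∀ᵐ t ∂(volume.restrict (Ioo 0 T)), ∃ f : H, e t = inner ℝ (f - y t) (u t) ∧
      e' t ≤ lam * e t + 2 * inner ℝ (f - y t) (y t) ∧ ‖f‖ ^ 2 ≤ B * (e t + ‖u t‖ ^ 2))
    (hu0 : u 0 ≠ 0) :
    ‖u 0‖ ^ 2 * Real.exp (-((3 + B) * Real.exp ((lam + B / 2) * T) * T * (2 + B)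
      * (1 + ‖y 0‖ / ‖u 0‖))) ≤ ‖u T‖ ^ 2 := by
  have huc' : ContinuousOn u (Ioo 0 T) := huc.mono Ioo_subset_Icc_self
  have hyc' : ContinuousOn y (Ioo 0 T) := hyc.mono Ioo_subset_Icc_self
  have hec0 : ContinuousOn e (Ioo 0 T) := fun t ht => (he t ht).continuousAt.continuousWithinAt
  have hnc : ContinuousOn (fun t => ‖u t‖ ^ 2) (Ioo 0 T) := huc'.norm.pow 2
  have hic : ContinuousOn (fun t => (inner ℝ (u t) (y t) : ℝ)) (Ioo 0 T) := huc'.inner hyc'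
  have hfu : ∀ (t : ℝ) (f : H), 0 ≤ e t → ‖f‖ ^ 2 ≤ B * (e t + ‖u t‖ ^ 2) →
      |inner ℝ f (u t)| ≤ (e t + ‖u t‖ ^ 2) / 2 + B * ‖u t‖ ^ 2 / 2 := by
    intro t f h0 hf
    refine (abs_real_inner_le_norm _ _).trans ?_
    have h1 : 0 ≤ e t + ‖u t‖ ^ 2 := by positivity
    refine abs_le_of_sq_le_sq' ?_ (by positivity) |>.2
    calc (‖f‖ * ‖u t‖) ^ 2 = ‖f‖ ^ 2 * ‖u t‖ ^ 2 := by ring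
      _ ≤ B * (e t + ‖u t‖ ^ 2) * ‖u t‖ ^ 2 := mul_le_mul_of_nonneg_right hf (sq_nonneg _)
      _ ≤ ((e t + ‖u t‖ ^ 2) / 2 + B * ‖u t‖ ^ 2 / 2) ^ 2 := by
        nlinarith [sq_nonneg ((e t + ‖u t‖ ^ 2) - B * ‖u t‖ ^ 2)]
  -- The numerator of the derivative of `e / ‖u‖²`. Replacing `e` by `e + ‖u‖²` does not change this
  -- numerator.
  have k1 : ∀ t ∈ Ioo 0 T, e' t * ‖u t‖ ^ 2 - 2 * e t * inner ℝ (u t) (y t)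
      ≤ (lam + B / 2) * (e t + ‖u t‖ ^ 2) * ‖u t‖ ^ 2 := by
    refine ContinuousOn.le_of_ae_le_Ioo (by fun_prop) (by fun_prop) ?_
    filter_upwards [h, ae_restrict_mem measurableSet_Ioo] with t ⟨f, h1, h2, h3⟩ ht
    have h4 := two_mul_inner_sub_le f (y t) (u t)
    rw [← h1] at h4
    have h5 := mul_le_mul_of_nonneg_right h2 (sq_nonneg ‖u t‖)
    have h6 := mul_le_mul_of_nonneg_right h3 (sq_nonneg ‖u t‖)
    have h7 := mul_nonneg hlam (mul_nonneg (sq_nonneg ‖u t‖) (sq_nonneg ‖u t‖))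
    nlinarith
  -- From `e = ⟨f - y, u⟩`, with half of `e` absorbed. The quotient at the initial time is thus
  -- controlled by `‖y‖/‖u‖` alone, without the gradient.
  have k2 : ∀ t ∈ Ioo 0 T, e t ≤ (1 + B) * ‖u t‖ ^ 2 + 2 * (‖y t‖ * ‖u t‖) := by
    refine ContinuousOn.le_of_ae_le_Ioo hec0 (by fun_prop) ?_
    filter_upwards [h, ae_restrict_mem measurableSet_Ioo] with t ⟨f, h1, h2, h3⟩ ht
    rw [inner_sub_left] at h1
    have h4 := (le_abs_self _).trans (hfu t f (he0 t ht) h3)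
    have h5 := neg_le_of_abs_le (abs_real_inner_le_norm (y t) (u t))
    linarith
  have k3 : ∀ t ∈ Ioo 0 T, -(2 * inner ℝ (u t) (y t)) ≤ (3 + B) * (e t + ‖u t‖ ^ 2) := by
    refine ContinuousOn.le_of_ae_le_Ioo (by fun_prop) (by fun_prop) ?_
    filter_upwards [h, ae_restrict_mem measurableSet_Ioo] with t ⟨f, h1, h2, h3⟩ ht
    rw [inner_sub_left] at h1
    have h4 := neg_le_of_abs_le (hfu t f (he0 t ht) h3)
    rw [real_inner_comm (u t) (y t)] at *
    have := mul_nonneg hB (he0 t ht)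
    have := sq_nonneg ‖u t‖
    linarith
  set A := (3 + B) * Real.exp ((lam + B / 2) * T) * T with hA
  have hA0 : 0 ≤ A := by positivity
  have main : ∀ s t, 0 < s → s < t → t < T → u s ≠ 0 →
      ‖u s‖ ^ 2 * Real.exp (-(A * (2 + B) * (1 + ‖y s‖ / ‖u s‖))) ≤ ‖u t‖ ^ 2 := by
    intro s t hs hst ht hus
    have hsub : ∀ r ∈ Icc s t, r ∈ Ioo 0 T := fun r hr => ⟨hs.trans_le hr.1, hr.2.trans_lt ht⟩
    have hpos : 0 < ‖u s‖ := norm_pos_iff.2 hus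
    have hn : ∀ r ∈ Icc s t, HasDerivAt (fun r => ‖u r‖ ^ 2) (2 * inner ℝ (u r) (y r)) r :=
      fun r hr => (hu r (hsub r hr)).norm_sq
    -- Applied with `n = ‖u‖²` and `E = e + ‖u‖²`. The rates are those of `k1` and `k3`, and `k2`
    -- bounds the initial quotient by `(2 + B)(1 + ‖y s‖/‖u s‖)`.
    have hb := log_lower_bound (c := lam + B / 2) (c₂ := 3 + B) (by positivity) (by positivity)
      hst.le hs ht hn (fun r hr => (he r (hsub r hr)).add (hn r hr)) (by positivity)
      (fun r hr => add_nonneg (he0 r (hsub r hr)) (sq_nonneg _))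
      (fun r hr => by
        have := k1 r (hsub r hr)
        simp only [Pi.add_apply]
        nlinarith) (fun r hr => k3 r (hsub r hr))
    refine le_trans ?_ hb
    refine mul_le_mul_of_nonneg_left (Real.exp_le_exp.2 (neg_le_neg ?_)) (sq_nonneg _)
    rw [← hA, mul_assoc A]
    refine mul_le_mul_of_nonneg_left ?_ hA0
    simp only [Pi.add_apply]
    rw [div_le_iff₀ (by positivity)]
    have e1 : (2 + B) * (1 + ‖y s‖ / ‖u s‖) * ‖u s‖ ^ 2
        = (2 + B) * (‖u s‖ ^ 2 + ‖y s‖ * ‖u s‖) := by field_simp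
    rw [e1]
    have := k2 s (hsub s ⟨le_rfl, hst.le⟩)
    have h7 : 0 ≤ B * (‖y s‖ * ‖u s‖) := by positivity
    nlinarith
  have hpos0 : 0 < ‖u 0‖ := norm_pos_iff.2 hu0
  have hm0 : (0 : ℝ) ∈ Icc 0 T := ⟨le_rfl, hT.le⟩
  have l0 : Tendsto u (𝓝[>] 0) (𝓝 (u 0)) :=
    (huc 0 hm0).mono_left (nhdsWithin_le_of_mem
      (mem_of_superset (Ioo_mem_nhdsGT hT) Ioo_subset_Icc_self))
  have l0' : Tendsto y (𝓝[>] 0) (𝓝 (y 0)) :=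
    (hyc 0 hm0).mono_left (nhdsWithin_le_of_mem
      (mem_of_superset (Ioo_mem_nhdsGT hT) Ioo_subset_Icc_self))
  have lT : Tendsto u (𝓝[<] T) (𝓝 (u T)) :=
    (huc T ⟨hT.le, le_rfl⟩).mono_left (nhdsWithin_le_of_mem
      (mem_of_superset (Ioo_mem_nhdsLT hT) Ioo_subset_Icc_self))
  -- The energy is differentiable on the open interval only, so the endpoints are reached by letting
  -- `s → 0` and then `t → T`; `u` and `y` are continuous up to them.
  have step : ∀ t ∈ Ioo 0 T,
      ‖u 0‖ ^ 2 * Real.exp (-(A * (2 + B) * (1 + ‖y 0‖ / ‖u 0‖))) ≤ ‖u t‖ ^ 2 := by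
    intro t ht
    have hl : Tendsto (fun s => ‖u s‖ ^ 2 * Real.exp (-(A * (2 + B) * (1 + ‖y s‖ / ‖u s‖))))
        (𝓝[>] 0) (𝓝 (‖u 0‖ ^ 2 * Real.exp (-(A * (2 + B) * (1 + ‖y 0‖ / ‖u 0‖))))) :=
      (l0.norm.pow 2).mul ((Real.continuous_exp.tendsto _).comp
        (((l0'.norm.div l0.norm hpos0.ne').const_add 1).const_mul _).neg)
    refine le_of_tendsto hl ?_
    filter_upwards [Ioo_mem_nhdsGT ht.1, l0.eventually_ne hu0] with s hs hus
    exact main s t hs.1 hs.2 ht.2 hus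
  refine ge_of_tendsto (lT.norm.pow 2) ?_
  filter_upwards [Ioo_mem_nhdsLT hT] with t ht using step t ht

end Frequency

noncomputable section

/-! ### The trace inequality -/

/-- The projection `ℝ^(n+1) → ℝ^n` that forgets the `i`-th coordinate. -/
def dropCoord {n : ℕ} (i : Fin (n + 1)) (x : Eu (n + 1)) : Eu n :=
  WithLp.toLp 2 fun j => x (i.succAbove j)

/-- The point of `ℝ^(n+1)` with `i`-th coordinate `r` and remaining coordinates `z`. -/
def insertCoord {n : ℕ} (i : Fin (n + 1)) (r : ℝ) (z : Eu n) : Eu (n + 1) :=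
  WithLp.toLp 2 (i.insertNth r fun j => z j)

theorem measurable_dropCoord {n : ℕ} (i : Fin (n + 1)) : Measurable (dropCoord i) := by
  unfold dropCoord
  fun_prop

theorem measurable_insertCoord {n : ℕ} (i : Fin (n + 1)) :
    Measurable fun p : ℝ × Eu n => insertCoord i p.1 p.2 := by
  refine (WithLp.measurable_toLp 2 _).comp (measurable_pi_iff.2 (i.forall_iff_succAbove.2
    ⟨by simpa using measurable_fst, fun j => ?_⟩))
  simp only [Fin.insertNth_apply_succAbove]
  fun_prop

theorem insertCoord_sub {n : ℕ} (i : Fin (n + 1)) (x : Eu (n + 1)) (s : ℝ) :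
    insertCoord i (x i - s) (dropCoord i x) = x - s • basisVec i := by
  ext k
  revert k
  refine i.forall_iff_succAbove.2 ⟨?_, fun j => ?_⟩
  · simp [insertCoord, basisVec]
  · simp [insertCoord, dropCoord, basisVec]

theorem measurePreserving_dropCoord {n : ℕ} (i : Fin (n + 1)) :
    MeasurePreserving (fun x : Eu (n + 1) => (x i, dropCoord i x)) volume
      ((volume : Measure ℝ).prod volume) := by
  have h1 := PiLp.volume_preserving_ofLp (Fin (n + 1))
  have h2 := volume_preserving_piFinSuccAbove (fun _ : Fin (n + 1) => ℝ) i
  have h3 : MeasurePreserving (Prod.map id (WithLp.toLp 2) : ℝ × (Fin n → ℝ) → ℝ × Eu n)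
      ((volume : Measure ℝ).prod volume) ((volume : Measure ℝ).prod volume) :=
    (MeasurePreserving.id _).prod (PiLp.volume_preserving_toLp (Fin n))
  exact h3.comp (h2.comp h1)

theorem lintegral_eq_lintegral_insertCoord {n : ℕ} (i : Fin (n + 1)) {h : Eu (n + 1) → ℝ≥0∞}
    (hh : Measurable h) : ∫⁻ x, h x = ∫⁻ z : Eu n, ∫⁻ r : ℝ, h (insertCoord i r z) := by
  have hm : Measurable fun p : ℝ × Eu n => h (insertCoord i p.1 p.2) :=
    hh.comp (measurable_insertCoord i)
  rw [← lintegral_prod_symm _ hm.aemeasurable, ← (measurePreserving_dropCoord i).lintegral_comp hm]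
  refine lintegral_congr fun x => ?_
  have := insertCoord_sub i x 0
  simp only [sub_zero, zero_smul] at this
  rw [this]

/-- A set on which the projection along a coordinate axis is antilipschitz has `n`-dimensional
measure controlled by the measure of the projection. -/
theorem euclideanHausdorffMeasure_le_of_antilipschitz {n : ℕ} (i : Fin (n + 1))
    {S : Set (Eu (n + 1))} {L : NNReal}
    (hL : ∀ x ∈ S, ∀ y ∈ S, dist x y ≤ L * dist (dropCoord i x) (dropCoord i y))
    {A : Set (Eu n)} (hA : dropCoord i '' S ⊆ A) :
    Measure.euclideanHausdorffMeasure n S ≤ (L : ℝ≥0∞) ^ (n : ℝ) * volume A := by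
  have hinj : InjOn (dropCoord i) S := by
    intro x hx y hy hxy
    have := hL x hx y hy
    rw [hxy, dist_self, mul_zero] at this
    exact dist_le_zero.1 this
  have hlip : LipschitzOnWith L (Function.invFunOn (dropCoord i) S) (dropCoord i '' S) := by
    refine LipschitzOnWith.of_dist_le_mul ?_
    rintro _ ⟨x, hx, rfl⟩ _ ⟨y, hy, rfl⟩
    rw [hinj.leftInvOn_invFunOn hx, hinj.leftInvOn_invFunOn hy]
    exact hL x hx y hy
  have h1 := hlip.hausdorffMeasure_image_le (d := n) (by positivity)
  rw [hinj.invFunOn_image subset_rfl] at h1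
  have hv : volume A = Measure.euclideanHausdorffMeasure n A := by
    rw [EuclideanSpace.euclideanHausdorffMeasure_eq_volume]
  rw [hv, Measure.euclideanHausdorffMeasure_def, Measure.smul_apply, ENNReal.smul_def, smul_eq_mul]
  refine (mul_le_mul_right h1 _).trans ?_
  rw [Measure.euclideanHausdorffMeasure_def, Measure.smul_apply, ENNReal.smul_def, smul_eq_mul,
    mul_left_comm]
  gcongr

/-- Integration over the segments `x - τ s e_i`, `0 < τ < δ`, that start at a Lipschitz graph. -/
theorem lintegral_segments_le {n : ℕ} (i : Fin (n + 1)) {S V : Set (Eu (n + 1))}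
    (hV : MeasurableSet V) {L : NNReal} {s δ : ℝ} (hs : s = 1 ∨ s = -1)
    (hL : ∀ x ∈ S, ∀ y ∈ S, dist x y ≤ L * dist (dropCoord i x) (dropCoord i y))
    (hSV : ∀ x ∈ S, ∀ τ ∈ Ioo 0 δ, x - (s * τ) • basisVec i ∈ V)
    {h : Eu (n + 1) → ℝ≥0∞} (hh : Measurable h) :
    ∫⁻ x in S, ∫⁻ τ in Ioo 0 δ, h (x - (s * τ) • basisVec i)
        ∂volume ∂(Measure.euclideanHausdorffMeasure n)
      ≤ (L : ℝ≥0∞) ^ (n : ℝ) * ∫⁻ x in V, h x := by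
  have hVm : Measurable (V.indicator h) := hh.indicator hV
  set G : Eu n → ℝ≥0∞ := fun z => ∫⁻ r : ℝ, V.indicator h (insertCoord i r z) with hG
  have hGm : Measurable G := by
    have : Measurable fun p : Eu n × ℝ => V.indicator h (insertCoord i p.2 p.1) :=
      hVm.comp ((measurable_insertCoord i).comp measurable_swap)
    exact this.lintegral_prod_right'
  have h1 : ∀ x ∈ S, ∫⁻ τ in Ioo 0 δ, h (x - (s * τ) • basisVec i) ≤ G (dropCoord i x) := by
    intro x hx
    have e : ∫⁻ τ in Ioo 0 δ, h (x - (s * τ) • basisVec i)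
        = ∫⁻ τ in Ioo 0 δ, V.indicator h (insertCoord i (x i - s * τ) (dropCoord i x)) := by
      refine setLIntegral_congr_fun measurableSet_Ioo fun τ hτ => ?_
      simp only
      rw [insertCoord_sub, indicator_of_mem (hSV x hx τ hτ)]
    rw [e]
    refine (setLIntegral_le_lintegral _ _).trans (le_of_eq ?_)
    have hm : MeasurePreserving (fun τ : ℝ => x i - s * τ) := by
      rcases hs with rfl | rfl
      · simpa using Measure.measurePreserving_sub_left volume (x i)
      · simpa using measurePreserving_add_left volume (x i)
    rw [hG]
    exact hm.lintegral_comp (hVm.comp ((measurable_insertCoord i).comp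
      (measurable_id.prodMk measurable_const)))
  -- The integral over a segment is at most the integral `G` of `h` over the part of the whole line
  -- in `V`, a function of the projected point. The projected surface measure is at most `L^n` times
  -- Lebesgue measure, and Tonelli's theorem finishes the proof.
  have h2 : Measure.map (dropCoord i) ((Measure.euclideanHausdorffMeasure n).restrict S)
      ≤ ((L : ℝ≥0∞) ^ (n : ℝ)) • volume := by
    refine Measure.le_iff.2 fun A hA => ?_
    rw [Measure.map_apply (measurable_dropCoord i) hA,
      Measure.restrict_apply (measurable_dropCoord i hA), Measure.smul_apply, smul_eq_mul]
    refine euclideanHausdorffMeasure_le_of_antilipschitz i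
      (fun x hx y hy => hL x hx.2 y hy.2) ?_
    rintro _ ⟨x, hx, rfl⟩
    exact hx.1
  calc ∫⁻ x in S, ∫⁻ τ in Ioo 0 δ, h (x - (s * τ) • basisVec i)
          ∂volume ∂(Measure.euclideanHausdorffMeasure n)
      ≤ ∫⁻ x in S, G (dropCoord i x) ∂(Measure.euclideanHausdorffMeasure n) :=
        setLIntegral_mono (hGm.comp (measurable_dropCoord i)) h1
    _ = ∫⁻ z, G z ∂(Measure.map (dropCoord i)
          ((Measure.euclideanHausdorffMeasure n).restrict S)) :=
        (lintegral_map hGm (measurable_dropCoord i)).symm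
    _ ≤ ∫⁻ z, G z ∂(((L : ℝ≥0∞) ^ (n : ℝ)) • volume) := lintegral_mono' h2 le_rfl
    _ = (L : ℝ≥0∞) ^ (n : ℝ) * ∫⁻ x in V, h x := by
        rw [lintegral_smul_measure, smul_eq_mul, ← lintegral_indicator hV,
          lintegral_eq_lintegral_insertCoord i hVm]

/-- The one-dimensional trace inequality along a segment. -/
theorem ofReal_sq_le_lintegral_segment {d : ℕ} {φ : Eu d → ℝ} (hφ : ContDiff ℝ ∞ φ) (i : Fin d)
    {s δ η : ℝ} (hs : s = 1 ∨ s = -1) (hδ : 0 < δ) (hη : 0 < η) (x : Eu d) :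
    ENNReal.ofReal (φ x ^ 2) ≤ ∫⁻ τ in Ioo 0 δ, ENNReal.ofReal
      ((1 / δ + 1 / η) * φ (x - (s * τ) • basisVec i) ^ 2
        + η * fderiv ℝ φ (x - (s * τ) • basisVec i) (basisVec i) ^ 2) := by
  set γ : ℝ → Eu d := fun τ => x - (s * τ) • basisVec i with hγ
  have hγd : ∀ τ, HasDerivAt γ (-(s • basisVec i)) τ := by
    intro τ
    have h1 : HasDerivAt (fun τ : ℝ => s * τ) s τ := by
      simpa using (hasDerivAt_id τ).const_mul s
    exact (h1.smul_const (basisVec i)).const_sub x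
  have hγc : Continuous γ := continuous_iff_continuousAt.2 fun τ => (hγd τ).continuousAt
  set k : ℝ → ℝ := fun τ => (1 / δ + 1 / η) * φ (γ τ) ^ 2
    + η * fderiv ℝ φ (γ τ) (basisVec i) ^ 2 with hk
  have hDc : Continuous fun τ => fderiv ℝ φ (γ τ) (basisVec i) :=
    ((hφ.continuous_fderiv (by simp)).comp hγc).clm_apply continuous_const
  have hφc : Continuous fun τ => φ (γ τ) := hφ.continuous.comp hγc
  have hkc : Continuous k := by fun_prop
  -- The derivative of `(1 - τ/δ) φ²` along the segment. The linear cutoff gives this function the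
  -- value `φ(x)²` at `τ = 0` and `0` at `τ = δ`.
  set q' : ℝ → ℝ := fun τ => -(1 / δ) * φ (γ τ) ^ 2
    + (1 - τ / δ) * (2 * φ (γ τ) * -(s * fderiv ℝ φ (γ τ) (basisVec i))) with hq'
  have hq'c : Continuous q' := by fun_prop
  have hq : ∀ τ, HasDerivAt (fun τ => (1 - τ / δ) * φ (γ τ) ^ 2) (q' τ) τ := by
    intro τ
    have h1 : HasDerivAt (fun τ : ℝ => 1 - τ / δ) (-(1 / δ)) τ :=
      ((hasDerivAt_id τ).div_const δ).const_sub 1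
    have h2 : HasDerivAt (fun τ => φ (γ τ)) (-(s * fderiv ℝ φ (γ τ) (basisVec i))) τ := by
      have := ((hφ.differentiable (by simp)) (γ τ)).hasFDerivAt.comp_hasDerivAt τ (hγd τ)
      exact this.congr_deriv (by simp)
    convert! h1.mul (h2.pow 2) using 1
    simp only [hq', Pi.pow_apply]
    ring
  have hftc := intervalIntegral.integral_eq_sub_of_hasDerivAt (a := 0) (b := δ)
    (fun τ _ => hq τ) (hq'c.intervalIntegrable _ _)
  have hγ0 : γ 0 = x := by simp [hγ]
  rw [hγ0, div_self hδ.ne'] at hftc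
  have hle : φ x ^ 2 ≤ ∫ τ in (0 : ℝ)..δ, k τ := by
    have : φ x ^ 2 = ∫ τ in (0 : ℝ)..δ, -q' τ := by
      rw [intervalIntegral.integral_neg, hftc]; simp
    rw [this]
    refine intervalIntegral.integral_mono_on hδ.le (hq'c.neg.intervalIntegrable _ _)
      (hkc.intervalIntegrable _ _) fun τ hτ => ?_
    have h1 : 0 ≤ 1 - τ / δ := sub_nonneg.2 ((div_le_one hδ).2 hτ.2)
    have h2 : 1 - τ / δ ≤ 1 := by linarith [div_nonneg hτ.1 hδ.le]
    set a := φ (γ τ)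
    set b := fderiv ℝ φ (γ τ) (basisVec i)
    have h3 : 2 * |a| * |b| ≤ 1 / η * a ^ 2 + η * b ^ 2 := by
      have h4 : (1 / η * a ^ 2 + η * b ^ 2) - 2 * |a| * |b| = (|a| - η * |b|) ^ 2 / η := by
        rw [← sq_abs a, ← sq_abs b]
        field_simp
        ring
      have : 0 ≤ (|a| - η * |b|) ^ 2 / η := by positivity
      linarith
    have h5 : (1 - τ / δ) * (2 * a * (s * b)) ≤ 2 * |a| * |b| := by
      have hs1 : |s| = 1 := by rcases hs with rfl | rfl <;> simp
      calc (1 - τ / δ) * (2 * a * (s * b)) ≤ |(1 - τ / δ) * (2 * a * (s * b))| := le_abs_self _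
        _ = (1 - τ / δ) * (2 * |a| * |b|) := by
          rw [abs_mul, abs_mul, abs_mul, abs_mul, hs1, abs_of_nonneg h1]
          simp
        _ ≤ 2 * |a| * |b| := mul_le_of_le_one_left (by positivity) h2
    simp only [hq', hk]
    linarith
  have hk0 : ∀ τ, 0 ≤ k τ := fun τ => by positivity
  rw [intervalIntegral.integral_of_le hδ.le, integral_Ioc_eq_integral_Ioo] at hle
  refine (ENNReal.ofReal_le_ofReal hle).trans (le_of_eq ?_)
  exact ofReal_integral_eq_lintegral_ofReal
    ((hkc.integrableOn_Icc (a := 0) (b := δ)).mono_set Ioo_subset_Icc_self)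
    (Eventually.of_forall hk0)

end

noncomputable section

/-! ### Boundary charts and integration over the boundary -/

theorem HasSmoothBoundary.defining_eq_zero {d : ℕ} {Ω U : Set (Eu d)} (hΩ : IsOpen Ω)
    (hU : IsOpen U) {ρ : Eu d → ℝ} (hρ : ContinuousOn ρ U) (h : Ω ∩ U = {y ∈ U | ρ y < 0})
    {x : Eu d} (hx : x ∈ frontier Ω) (hxU : x ∈ U) : ρ x = 0 := by
  have hc : ContinuousAt ρ x := hρ.continuousAt (hU.mem_nhds hxU)
  refine le_antisymm ?_ ?_
  · by_contra! hpos
    have h1 : ∀ᶠ y in 𝓝 x, y ∈ U ∧ 0 < ρ y :=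
      (hU.eventually_mem hxU).and (hc.eventually (lt_mem_nhds hpos))
    obtain ⟨y, hy, hyΩ⟩ := mem_closure_iff_nhds.1 hx.1 _ h1
    have : y ∈ {y ∈ U | ρ y < 0} := h ▸ ⟨hyΩ, hy.1⟩
    linarith [this.2, hy.2]
  · by_contra! hneg
    have : x ∈ Ω ∩ U := h ▸ ⟨hxU, hneg⟩
    exact hx.2 (hΩ.interior_eq.symm ▸ this.1)

theorem dist_le_abs_add_dist_dropCoord {n : ℕ} (i : Fin (n + 1)) (x y : Eu (n + 1)) :
    dist x y ^ 2 = |x i - y i| ^ 2 + dist (dropCoord i x) (dropCoord i y) ^ 2 := by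
  rw [EuclideanSpace.dist_sq_eq, EuclideanSpace.dist_sq_eq, Fin.sum_univ_succAbove _ i]
  simp [dropCoord, Real.dist_eq]

theorem norm_basisVec {d : ℕ} (i : Fin d) : ‖(basisVec i : Eu d)‖ = 1 := by
  simp [basisVec]

/-- Local structure of a smooth boundary: near a boundary point, some coordinate direction points
into the domain and the projection along it is bi-Lipschitz on the boundary. -/
theorem HasSmoothBoundary.exists_chart {n : ℕ} {Ω : Set (Eu (n + 1))} (hΩ : IsOpen Ω)
    (h : HasSmoothBoundary Ω) {x₀ : Eu (n + 1)} (hx₀ : x₀ ∈ frontier Ω) {N : Set (Eu (n + 1))}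
    (hN : N ∈ 𝓝 x₀) :
    ∃ W V : Set (Eu (n + 1)), IsOpen W ∧ x₀ ∈ W ∧ IsOpen V ∧ V ⊆ Ω ∩ N ∧
      ∃ (i : Fin (n + 1)) (s δ : ℝ) (L : NNReal), (s = 1 ∨ s = -1) ∧ 0 < δ ∧
        (∀ x ∈ frontier Ω ∩ W, ∀ y ∈ frontier Ω ∩ W,
          dist x y ≤ L * dist (dropCoord i x) (dropCoord i y)) ∧
        ∀ x ∈ frontier Ω ∩ W, ∀ τ ∈ Ioo 0 δ, x - (s * τ) • basisVec i ∈ V := by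
  obtain ⟨U, hU, hxU, ρ, hρ, hgrad, hΩU⟩ := h x₀ hx₀
  have hdc : ContinuousOn (fderiv ℝ ρ) U := hρ.continuousOn_fderiv_of_isOpen hU (by simp)
  have hex : ∃ i, fderiv ℝ ρ x₀ (basisVec i) ≠ 0 := by
    by_contra! hcon
    refine hgrad x₀ hxU ?_
    ext v
    have hv : v = ∑ i, v i • (basisVec i : Eu (n + 1)) := by
      ext j
      simp [basisVec, Finset.sum_apply, Pi.single_apply]
    rw [hv, map_sum]
    simp [hcon]
  obtain ⟨i, hi⟩ := hex
  obtain ⟨s, hs, hspos⟩ : ∃ s : ℝ, (s = 1 ∨ s = -1) ∧ 0 < s * fderiv ℝ ρ x₀ (basisVec i) := by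
    rcases lt_or_gt_of_ne hi with h | h
    · exact ⟨-1, Or.inr rfl, by linarith⟩
    · exact ⟨1, Or.inl rfl, by linarith⟩
  set m := s * fderiv ℝ ρ x₀ (basisVec i) / 2 with hm
  have hm0 : 0 < m := by positivity
  set M := ‖fderiv ℝ ρ x₀‖ + 1 with hM
  have hM0 : 0 < M := by positivity
  have hca : ContinuousAt (fderiv ℝ ρ) x₀ := hdc.continuousAt (hU.mem_nhds hxU)
  have hev : ∀ᶠ y in 𝓝 x₀, y ∈ U ∧ y ∈ N ∧ m < s * fderiv ℝ ρ y (basisVec i) ∧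
      ‖fderiv ℝ ρ y‖ < M := by
    refine (hU.eventually_mem hxU).and (Filter.Eventually.and hN (Filter.Eventually.and ?_ ?_))
    · exact ((hca.clm_apply continuousAt_const).const_mul s).eventually
        (lt_mem_nhds (by rw [hm]; linarith))
    · exact hca.norm.eventually (gt_mem_nhds (by rw [hM]; linarith))
  obtain ⟨R, hR, hball⟩ := Metric.eventually_nhds_iff_ball.1 hev
  have hder : ∀ y ∈ Metric.ball x₀ R, HasFDerivWithinAt ρ (fderiv ℝ ρ y) (Metric.ball x₀ R) y :=
    fun y hy => (((hρ.contDiffAt (hU.mem_nhds (hball y hy).1)).differentiableAt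
      (by simp)).hasFDerivAt).hasFDerivWithinAt
  have hzero : ∀ x ∈ frontier Ω, x ∈ Metric.ball x₀ R → ρ x = 0 := fun x hx hxb =>
    HasSmoothBoundary.defining_eq_zero hΩ hU hρ.continuousOn hΩU hx (hball x hxb).1
  have hhalf : Metric.ball x₀ (R / 2) ⊆ Metric.ball x₀ R := Metric.ball_subset_ball (by linarith)
  refine ⟨Metric.ball x₀ (R / 2), Ω ∩ Metric.ball x₀ R, Metric.isOpen_ball,
    Metric.mem_ball_self (by positivity), hΩ.inter Metric.isOpen_ball,
    fun y hy => ⟨hy.1, (hball y hy.2).2.1⟩, i, s, R / 2, ⟨M / m + 1, by positivity⟩, hs,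
    by positivity, ?_, ?_⟩
  · rintro x ⟨hx, hxb⟩ y ⟨hy, hyb⟩
    -- Since `ρ` vanishes at both boundary points, the mean value theorem gives `0 = Dρ(ξ) w + (x i
    -- - y i) ∂_i ρ(ξ)`, where `w` is the part of `x - y` orthogonal to the axis. As `|∂_i ρ| > m`
    -- and `‖Dρ‖ < M`, this bounds `|x i - y i|` by `(M/m) ‖w‖` without the implicit function
    -- theorem.
    obtain ⟨ξ, hξ, hmvt⟩ := domain_mvt hder (convex_ball _ _) (hhalf hyb) (hhalf hxb)
    have hξb : ξ ∈ Metric.ball x₀ R :=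
      (convex_ball x₀ R).segment_subset (hhalf hyb) (hhalf hxb) hξ
    obtain ⟨-, -, hb1, hb2⟩ := hball ξ hξb
    rw [hzero x hx (hhalf hxb), hzero y hy (hhalf hyb), sub_self] at hmvt
    set w : Eu (n + 1) := x - y - (x i - y i) • basisVec i with hw
    have hwn : ‖w‖ = dist (dropCoord i x) (dropCoord i y) := by
      have e1 := dist_le_abs_add_dist_dropCoord i w 0
      have e2 : w i = 0 := by simp [hw, basisVec]
      have e3 : dist (dropCoord i w) (dropCoord i 0) = dist (dropCoord i x) (dropCoord i y) := by
        rw [dist_eq_norm, dist_eq_norm]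
        congr 1
        ext j
        simp [dropCoord, hw, basisVec]
      rw [e2, e3] at e1
      simp only [dist_zero_right] at e1
      have : ‖w‖ ^ 2 = dist (dropCoord i x) (dropCoord i y) ^ 2 := by simpa using e1
      exact (sq_eq_sq₀ (norm_nonneg _) dist_nonneg).1 this
    have hxy : x - y = w + (x i - y i) • basisVec i := by rw [hw]; abel
    have e4 : fderiv ℝ ρ ξ w + (x i - y i) * fderiv ℝ ρ ξ (basisVec i) = 0 := by
      rw [hxy, map_add, map_smul, smul_eq_mul] at hmvt
      exact hmvt.symm
    set p := dist (dropCoord i x) (dropCoord i y) with hp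
    have e5 : |x i - y i| * m ≤ M * p := by
      have h1 : |fderiv ℝ ρ ξ w| ≤ M * p := by
        rw [← hwn]
        exact ((fderiv ℝ ρ ξ).le_opNorm w).trans
          (mul_le_mul_of_nonneg_right hb2.le (norm_nonneg _))
      have h2 : |x i - y i| * |fderiv ℝ ρ ξ (basisVec i)| = |fderiv ℝ ρ ξ w| := by
        rw [← abs_mul, ← abs_neg (fderiv ℝ ρ ξ w)]
        congr 1
        linarith
      have h3 : m ≤ |fderiv ℝ ρ ξ (basisVec i)| := by
        rcases hs with rfl | rfl
        · exact hb1.le.trans (by rw [one_mul]; exact le_abs_self _)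
        · exact hb1.le.trans (by rw [neg_one_mul]; exact neg_le_abs _)
      calc |x i - y i| * m ≤ |x i - y i| * |fderiv ℝ ρ ξ (basisVec i)| :=
            mul_le_mul_of_nonneg_left h3 (abs_nonneg _)
        _ ≤ M * p := h2.le.trans h1
    have e6 : |x i - y i| ≤ M / m * p := by
      rw [div_mul_eq_mul_div, le_div_iff₀ hm0]
      exact e5
    have hp0 : 0 ≤ p := dist_nonneg
    rw [dist_eq_norm, hxy]
    refine (norm_add_le _ _).trans ?_
    rw [norm_smul, norm_basisVec, mul_one, hwn, Real.norm_eq_abs]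
    change p + |x i - y i| ≤ (M / m + 1) * p
    linarith
  · rintro x ⟨hx, hxb⟩ τ ⟨hτ0, hτ⟩
    have hsa : |s| = 1 := by rcases hs with rfl | rfl <;> simp
    have hzb : x - (s * τ) • basisVec i ∈ Metric.ball x₀ R := by
      rw [mem_ball_iff_norm] at hxb ⊢
      have : x - (s * τ) • basisVec i - x₀ = (x - x₀) - (s * τ) • basisVec i := by abel
      rw [this]
      refine (norm_sub_le _ _).trans_lt ?_
      rw [norm_smul, norm_basisVec, mul_one, Real.norm_eq_abs, abs_mul, hsa, one_mul,
        abs_of_pos hτ0]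
      linarith
    refine ⟨?_, hzb⟩
    -- Here `ρ` starts at `0` and decreases along `-s e_i`, because `s ∂_i ρ > m > 0` in the ball;
    -- so the segment lies in `Ω`.
    obtain ⟨ξ, hξ, hmvt⟩ := domain_mvt hder (convex_ball _ _) (hhalf hxb) hzb
    have hξb : ξ ∈ Metric.ball x₀ R :=
      (convex_ball x₀ R).segment_subset (hhalf hxb) hzb hξ
    obtain ⟨-, -, hb1, -⟩ := hball ξ hξb
    rw [hzero x hx (hhalf hxb), sub_zero, sub_sub_cancel_left, map_neg, map_smul,
      smul_eq_mul] at hmvt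
    have hneg : ρ (x - (s * τ) • basisVec i) < 0 := by
      rw [hmvt]
      nlinarith
    have : x - (s * τ) • basisVec i ∈ Ω ∩ U := hΩU ▸ ⟨(hball _ hzb).1, hneg⟩
    exact this.1

/-- The one-dimensional trace inequality on each segment is integrated over the boundary piece. The
segments fill a region where `σ` exceeds half its value at `x₀`, so the plain derivative is
dominated by the weighted gradient. The neighbourhood `W` is chosen before `ε`, as the covering
argument requires. -/
theorem HasSmoothBoundary.local_trace {n : ℕ} {Ω : Set (Eu (n + 1))} (hΩ : IsOpen Ω)
    (h : HasSmoothBoundary Ω) {σ : Eu (n + 1) → ℝ} (hσ : ContinuousOn σ (closure Ω))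
    {x₀ : Eu (n + 1)} (hx₀ : x₀ ∈ frontier Ω) (hσ₀ : 0 < σ x₀) :
    ∃ W : Set (Eu (n + 1)), IsOpen W ∧ x₀ ∈ W ∧ ∀ ε : ℝ, 0 < ε → ∃ C : ℝ, 0 ≤ C ∧
      ∀ φ : Eu (n + 1) → ℝ, ContDiff ℝ ∞ φ →
        ∫⁻ x in frontier Ω ∩ W, ENNReal.ofReal (φ x ^ 2) ∂(Measure.euclideanHausdorffMeasure n)
          ≤ ENNReal.ofReal ε * (∫⁻ x in Ω, ENNReal.ofReal
              (σ x * ∑ k, fderiv ℝ φ x (basisVec k) ^ 2))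
            + ENNReal.ofReal C * ∫⁻ x in Ω, ENNReal.ofReal (φ x ^ 2) := by
  obtain ⟨N, hN, hNσ⟩ := mem_nhdsWithin_iff_exists_mem_nhds_inter.1
    ((hσ x₀ hx₀.1).eventually (lt_mem_nhds (half_lt_self hσ₀)))
  set m := σ x₀ / 2 with hm
  have hm0 : 0 < m := by positivity
  obtain ⟨W, V, hW, hxW, hV, hVΩ, i, s, δ, L, hs, hδ, hL, hWV⟩ := h.exists_chart hΩ hx₀ hN
  refine ⟨W, hW, hxW, fun ε hε => ?_⟩
  set l : ℝ := (L : ℝ) ^ (n : ℝ) with hl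
  have hl0 : 0 ≤ l := by positivity
  have hlE : (L : ℝ≥0∞) ^ (n : ℝ) = ENNReal.ofReal l := by
    rw [hl, ← NNReal.coe_rpow, ENNReal.ofReal_coe_nnreal, ENNReal.coe_rpow_of_nonneg _ (by positivity)]
  -- The gradient term ends up with the factor `l η / m = ε l / (l + 1) ≤ ε`; the `1` covers `l =
  -- 0`.
  set η := ε * m / (l + 1) with hη
  have hη0 : 0 < η := by positivity
  refine ⟨l * (1 / δ + 1 / η), by positivity, fun φ hφ => ?_⟩
  have hDc : Continuous fun y => fderiv ℝ φ y (basisVec i) :=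
    (hφ.continuous_fderiv (by simp)).clm_apply continuous_const
  have hφc := hφ.continuous
  have hhm : Measurable fun y => ENNReal.ofReal ((1 / δ + 1 / η) * φ y ^ 2
      + η * fderiv ℝ φ y (basisVec i) ^ 2) := by
    refine ENNReal.measurable_ofReal.comp (Continuous.measurable ?_)
    fun_prop
  have h1 := lintegral_segments_le i hV.measurableSet hs hL hWV hhm
  have h2 : ∫⁻ x in V, ENNReal.ofReal ((1 / δ + 1 / η) * φ x ^ 2
      + η * fderiv ℝ φ x (basisVec i) ^ 2)
      ≤ ENNReal.ofReal (1 / δ + 1 / η) * (∫⁻ x in Ω, ENNReal.ofReal (φ x ^ 2))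
        + ENNReal.ofReal (η / m) * ∫⁻ x in Ω, ENNReal.ofReal
              (σ x * ∑ k, fderiv ℝ φ x (basisVec k) ^ 2) := by
    rw [← lintegral_const_mul' _ _ ENNReal.ofReal_ne_top,
      ← lintegral_const_mul' _ _ ENNReal.ofReal_ne_top, ← lintegral_add_left (by fun_prop)]
    refine (lintegral_mono_ae ?_).trans
      (lintegral_mono_set (hVΩ.trans inter_subset_left))
    filter_upwards [ae_restrict_mem hV.measurableSet] with x hx
    have hσm : m < σ x := hNσ ⟨(hVΩ hx).2, subset_closure (hVΩ hx).1⟩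
    rw [← ENNReal.ofReal_mul (by positivity), ← ENNReal.ofReal_mul (by positivity),
      ← ENNReal.ofReal_add (by positivity)]
    · refine ENNReal.ofReal_le_ofReal (add_le_add_right ?_ _)
      have h3 : fderiv ℝ φ x (basisVec i) ^ 2 ≤ ∑ k, fderiv ℝ φ x (basisVec k) ^ 2 :=
        Finset.single_le_sum (f := fun k => fderiv ℝ φ x (basisVec k) ^ 2)
          (fun k _ => sq_nonneg _) (Finset.mem_univ i)
      have h4 : m * fderiv ℝ φ x (basisVec i) ^ 2
          ≤ σ x * ∑ k, fderiv ℝ φ x (basisVec k) ^ 2 :=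
        mul_le_mul hσm.le h3 (sq_nonneg _) (hm0.le.trans hσm.le)
      calc η * fderiv ℝ φ x (basisVec i) ^ 2
          = η / m * (m * fderiv ℝ φ x (basisVec i) ^ 2) := by field_simp
        _ ≤ _ := mul_le_mul_of_nonneg_left h4 (by positivity)
    · have : 0 ≤ σ x := hm0.le.trans hσm.le
      have : 0 ≤ ∑ k, fderiv ℝ φ x (basisVec k) ^ 2 := Finset.sum_nonneg fun k _ => sq_nonneg _
      positivity
  calc ∫⁻ x in frontier Ω ∩ W, ENNReal.ofReal (φ x ^ 2) ∂(Measure.euclideanHausdorffMeasure n)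
      ≤ _ := lintegral_mono fun x => ofReal_sq_le_lintegral_segment hφ i hs hδ hη0 x
    _ ≤ _ := h1
    _ ≤ _ := mul_le_mul_right h2 _
    _ ≤ _ := by
      rw [hlE, mul_add, ← mul_assoc, ← mul_assoc, ← ENNReal.ofReal_mul hl0,
        ← ENNReal.ofReal_mul hl0, add_comm]
      refine add_le_add_left (mul_le_mul_left (ENNReal.ofReal_le_ofReal ?_) _) _
      rw [hη]
      have : l * (ε * m / (l + 1) / m) = ε * (l / (l + 1)) := by field_simp
      rw [this]
      exact mul_le_of_le_one_right hε.le ((div_le_one (by positivity)).2 (by linarith))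

/-- The trace inequality with a small constant in front of the gradient, whose weight is positive
on the boundary. -/
theorem HasSmoothBoundary.trace_inequality {d : ℕ} (hd : 0 < d) {Ω : Set (Eu d)} (hΩ : IsOpen Ω)
    (hΩb : Bornology.IsBounded Ω) (h : HasSmoothBoundary Ω) {σ : Eu d → ℝ}
    (hσ : ContinuousOn σ (closure Ω)) (hσ₀ : ∀ x ∈ frontier Ω, 0 < σ x) {ε : ℝ} (hε : 0 < ε) :
    ∃ C : ℝ, 0 ≤ C ∧ ∀ φ : Eu d → ℝ, ContDiff ℝ ∞ φ →
      ∫⁻ x, ENNReal.ofReal (φ x ^ 2) ∂(surfaceMeasure Ω)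
        ≤ ENNReal.ofReal ε * (∫⁻ x in Ω, ENNReal.ofReal (σ x * ∑ k, fderiv ℝ φ x (basisVec k) ^ 2))
          + ENNReal.ofReal C * ∫⁻ x in Ω, ENNReal.ofReal (φ x ^ 2) := by
  obtain ⟨n, rfl⟩ : ∃ n, d = n + 1 := ⟨d - 1, by omega⟩
  have hK : IsCompact (frontier Ω) :=
    Metric.isCompact_of_isClosed_isBounded isClosed_frontier
      (hΩb.closure.subset frontier_subset_closure)
  -- Keeping all `ε` in the property makes it stable under unions: each of the two pieces is used
  -- with `ε / 2`.
  have key := hK.induction_on (p := fun S => ∀ ε : ℝ, 0 < ε → ∃ C : ℝ, 0 ≤ C ∧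
      ∀ φ : Eu (n + 1) → ℝ, ContDiff ℝ ∞ φ →
        ∫⁻ x in S, ENNReal.ofReal (φ x ^ 2) ∂(Measure.euclideanHausdorffMeasure n)
          ≤ ENNReal.ofReal ε * (∫⁻ x in Ω, ENNReal.ofReal
              (σ x * ∑ k, fderiv ℝ φ x (basisVec k) ^ 2))
            + ENNReal.ofReal C * ∫⁻ x in Ω, ENNReal.ofReal (φ x ^ 2))
    (fun ε _ => ⟨0, le_rfl, fun φ _ => by simp⟩)
    (fun S S' hS hS' ε hε => by
      obtain ⟨C, hC0, hC⟩ := hS' ε hε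
      exact ⟨C, hC0, fun φ hφ => (lintegral_mono_set hS).trans (hC φ hφ)⟩)
    (fun S S' hS hS' ε hε => by
      obtain ⟨C, hC0, hC⟩ := hS (ε / 2) (by positivity)
      obtain ⟨C', hC0', hC'⟩ := hS' (ε / 2) (by positivity)
      refine ⟨C + C', by positivity, fun φ hφ => ?_⟩
      refine (lintegral_union_le _ _ _).trans ((add_le_add (hC φ hφ) (hC' φ hφ)).trans
        (le_of_eq ?_))
      rw [ENNReal.ofReal_add hC0 hC0', add_mul, add_add_add_comm, ← add_mul,
        ← ENNReal.ofReal_add (by positivity) (by positivity), add_halves])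
    (fun x hx => by
      obtain ⟨W, hW, hxW, hWp⟩ := h.local_trace hΩ hσ hx (hσ₀ x hx)
      exact ⟨frontier Ω ∩ W, inter_mem_nhdsWithin _ (hW.mem_nhds hxW), hWp⟩)
  exact key ε hε

end

noncomputable section

/-! ### Multiplication by bounded functions -/

/-- Multiplication `L^∞ × L² → L²`. -/
def mulLp {α : Type*} {m : MeasurableSpace α} (μ : Measure α) :
    Lp ℝ ∞ μ →L[ℝ] Lp ℝ 2 μ →L[ℝ] Lp ℝ 2 μ :=
  (ContinuousLinearMap.mul ℝ ℝ).holderL μ ∞ 2 2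

theorem coeFn_mulLp {α : Type*} {m : MeasurableSpace α} {μ : Measure α} (a : Lp ℝ ∞ μ)
    (f : Lp ℝ 2 μ) : mulLp μ a f =ᵐ[μ] fun x => a x * f x :=
  (ContinuousLinearMap.mul ℝ ℝ).coeFn_holder a f

theorem inner_mulLp {α : Type*} {m : MeasurableSpace α} {μ : Measure α} (a : Lp ℝ ∞ μ)
    (f g : Lp ℝ 2 μ) : inner ℝ (mulLp μ a f) g = ∫ x, a x * f x * g x ∂μ :=
  L2.real_inner_eq_integral_of_ae_eq (coeFn_mulLp a f) EventuallyEq.rfl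

theorem inner_mulLp_comm {α : Type*} {m : MeasurableSpace α} {μ : Measure α} (a : Lp ℝ ∞ μ)
    (f g : Lp ℝ 2 μ) : (inner ℝ (mulLp μ a f) g : ℝ) = inner ℝ (mulLp μ a g) f := by
  rw [inner_mulLp, inner_mulLp]
  exact integral_congr_ae (Eventually.of_forall fun x => by ring)

/-! ### Lifting differentiable curves -/

/-- A subspace of a product on which the second component is bounded by the first one. -/
theorem Submodule.isClosed_map_fst {Y Z : Type*} [NormedAddCommGroup Y] [NormedSpace ℝ Y]
    [NormedAddCommGroup Z] [NormedSpace ℝ Z] [CompleteSpace Y] [CompleteSpace Z]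
    {K : Submodule ℝ (Y × Z)} (hK : IsClosed (K : Set (Y × Z))) {C : ℝ}
    (hC : ∀ p ∈ K, ‖p.2‖ ≤ C * ‖p.1‖) :
    IsClosed (K.map (LinearMap.fst ℝ Y Z) : Set Y) := by
  have : CompleteSpace K := hK.completeSpace_coe
  let P : K →L[ℝ] Y := (ContinuousLinearMap.fst ℝ Y Z).comp K.subtypeL
  -- On `K` the norm of a pair is comparable to that of its first component, so the projection of
  -- the complete space `K` has closed range.
  have hP : AntilipschitzWith (Real.toNNReal (max C 1)) P := by
    refine P.antilipschitz_of_bound fun p => ?_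
    rw [Real.coe_toNNReal _ (by positivity)]
    change max ‖p.1.1‖ ‖p.1.2‖ ≤ max C 1 * ‖p.1.1‖
    refine max_le ?_ ((hC p.1 p.2).trans ?_)
    · exact le_mul_of_one_le_left (norm_nonneg _) (le_max_right _ _)
    · exact mul_le_mul_of_nonneg_right (le_max_left _ _) (norm_nonneg _)
  have h := hP.isClosed_range P.uniformContinuous
  convert h using 1
  ext y
  constructor
  · rintro ⟨p, hp, rfl⟩
    exact ⟨⟨p, hp⟩, rfl⟩
  · rintro ⟨p, rfl⟩
    exact ⟨p.1, p.2, rfl⟩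

/-- `K` is the graph of a bounded operator on a closed subspace, and bounded operators map
differentiable curves to differentiable curves. In the application the operator is the trace. The
lemma turns a boundary condition known for almost every time into one at every time, for the curve
and for its derivative. -/
theorem exists_lift_hasDerivAt {Y Z : Type*} [NormedAddCommGroup Y] [NormedSpace ℝ Y]
    [NormedAddCommGroup Z] [NormedSpace ℝ Z] [CompleteSpace Y] [CompleteSpace Z]
    {K : Submodule ℝ (Y × Z)} (hK : IsClosed (K : Set (Y × Z))) {C : ℝ}
    (hC : ∀ p ∈ K, ‖p.2‖ ≤ C * ‖p.1‖) {T : ℝ} {w w' : ℝ → Y}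
    (hw : ∀ t ∈ Ioo 0 T, HasDerivAt w (w' t) t) (hw' : ContinuousOn w' (Ioo 0 T))
    (h : ∀ᵐ t ∂(volume.restrict (Ioo 0 T)), ∃ z, (w t, z) ∈ K) :
    ∃ z z' : ℝ → Z, (∀ t ∈ Ioo 0 T, HasDerivAt z (z' t) t) ∧ ContinuousOn z' (Ioo 0 T) ∧
      (∀ t ∈ Ioo 0 T, (w t, z t) ∈ K) ∧ (∀ t ∈ Ioo 0 T, (w' t, z' t) ∈ K) ∧
      ∀ t ∈ Ioo 0 T, ∀ g, (w t, g) ∈ K → g = z t := by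
  set R := K.map (LinearMap.fst ℝ Y Z) with hR
  have hRc : IsClosed (R : Set Y) := Submodule.isClosed_map_fst hK hC
  have hmem : ∀ {y : Y}, y ∈ R ↔ ∃ z, (y, z) ∈ K := by
    intro y
    constructor
    · rintro ⟨p, hp, rfl⟩
      exact ⟨p.2, hp⟩
    · rintro ⟨z, hz⟩
      exact ⟨_, hz, rfl⟩
  have hwc : ContinuousOn w (Ioo 0 T) := fun t ht => (hw t ht).continuousAt.continuousWithinAt
  have hwR : ∀ t ∈ Ioo 0 T, w t ∈ R := by
    -- The distance to `R` is continuous in `t` and zero almost everywhere, hence zero; closedness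
    -- of `R` then gives membership.
    have h0 : ∀ t ∈ Ioo 0 T, Metric.infDist (w t) R ≤ 0 := by
      refine ContinuousOn.le_of_ae_le_Ioo ((Metric.continuous_infDist_pt _).comp_continuousOn hwc)
        continuousOn_const ?_
      filter_upwards [h] with t ht
      exact (Metric.infDist_zero_of_mem (hmem.2 ht)).le
    intro t ht
    exact (hRc.mem_iff_infDist_zero ⟨0, R.zero_mem⟩).2 (le_antisymm (h0 t ht) Metric.infDist_nonneg)
  have hwR' : ∀ t ∈ Ioo 0 T, w' t ∈ R := by
    intro t ht
    refine hRc.mem_of_tendsto (hasDerivAt_iff_tendsto_slope.1 (hw t ht)) ?_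
    filter_upwards [mem_nhdsWithin_of_mem_nhds (Ioo_mem_nhds ht.1 ht.2)] with s hs
    exact R.smul_mem _ (R.sub_mem (hwR s hs) (hwR t ht))
  have hz : ∀ t, ∃ z, t ∈ Ioo 0 T → (w t, z) ∈ K := by
    intro t
    by_cases ht : t ∈ Ioo 0 T
    · obtain ⟨z, hz⟩ := hmem.1 (hwR t ht)
      exact ⟨z, fun _ => hz⟩
    · exact ⟨0, fun h => absurd h ht⟩
  have hz' : ∀ t, ∃ z, t ∈ Ioo 0 T → (w' t, z) ∈ K := by
    intro t
    by_cases ht : t ∈ Ioo 0 T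
    · obtain ⟨z, hz⟩ := hmem.1 (hwR' t ht)
      exact ⟨z, fun _ => hz⟩
    · exact ⟨0, fun h => absurd h ht⟩
  choose z hz using hz
  choose z' hz' using hz'
  refine ⟨z, z', fun t ht => ?_, fun t ht => ?_, hz, hz', fun t ht g hg => ?_⟩
  -- The remainders of `w` and `z` form a pair in `K`, so the remainder of `z` is at most `C` times
  -- that of `w`.
  · rw [hasDerivAt_iff_isLittleO]
    refine Asymptotics.IsBigO.trans_isLittleO ?_ (hasDerivAt_iff_isLittleO.1 (hw t ht))
    refine Asymptotics.IsBigO.of_bound C ?_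
    filter_upwards [Ioo_mem_nhds ht.1 ht.2] with s hs
    exact hC _ (K.sub_mem (K.sub_mem (hz s hs) (hz t ht)) (K.smul_mem (s - t) (hz' t ht)))
  · have hcw := hw' t ht
    rw [ContinuousWithinAt, tendsto_iff_norm_sub_tendsto_zero] at hcw ⊢
    have hcw' := hcw.const_mul C
    rw [mul_zero] at hcw'
    refine squeeze_zero' (Eventually.of_forall fun _ => norm_nonneg _) ?_ hcw'
    filter_upwards [self_mem_nhdsWithin] with s hs
    exact hC _ (K.sub_mem (hz' s hs) (hz' t ht))
  · have := hC _ (K.sub_mem hg (hz t ht))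
    simp only [Prod.mk_sub_mk, sub_self, norm_zero, mul_zero] at this
    exact sub_eq_zero.1 (norm_le_zero_iff.1 this)

/-! ### The energy method for degenerate parabolic equations -/

section Energy

variable {α β ι : Type*} [Fintype ι] {mα : MeasurableSpace α} {mβ : MeasurableSpace β}
  {μ : Measure α} {ν : Measure β}

/-- The quadratic form `∫ ∑ a_ij G_j G'_i`. -/
def quadForm (μ : Measure α) (A : ι → ι → Lp ℝ ∞ μ) (G G' : ι → Lp ℝ 2 μ) : ℝ :=
  ∑ i, ∑ j, inner ℝ (mulLp μ (A i j) (G j)) (G' i)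

theorem quadForm_symm {A : ι → ι → Lp ℝ ∞ μ} (hA : ∀ i j, A i j = A j i) (G G' : ι → Lp ℝ 2 μ) :
    quadForm μ A G G' = quadForm μ A G' G := by
  unfold quadForm
  rw [Finset.sum_comm]
  refine Finset.sum_congr rfl fun i _ => Finset.sum_congr rfl fun j _ => ?_
  rw [inner_mulLp_comm, hA]

theorem continuous_quadForm_right (A : ι → ι → Lp ℝ ∞ μ) (G : ι → Lp ℝ 2 μ) :
    Continuous fun G' => quadForm μ A G G' := by
  unfold quadForm
  fun_prop

theorem hasDerivAt_quadForm {A A' : ι → ι → ℝ → Lp ℝ ∞ μ} {G G' : ℝ → ι → Lp ℝ 2 μ} {t : ℝ}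
    (hA : ∀ i j, HasDerivAt (A i j) (A' i j t) t) (hG : HasDerivAt G (G' t) t) :
    HasDerivAt (fun t => quadForm μ (fun i j => A i j t) (G t) (G t))
      (quadForm μ (fun i j => A' i j t) (G t) (G t) + quadForm μ (fun i j => A i j t) (G' t) (G t)
        + quadForm μ (fun i j => A i j t) (G t) (G' t)) t := by
  have hGi : ∀ i, HasDerivAt (fun t => G t i) (G' t i) t := fun i => hasDerivAt_pi.1 hG i
  have h : ∀ i j, HasDerivAt (fun t => inner ℝ (mulLp μ (A i j t) (G t j)) (G t i))
      (inner ℝ (mulLp μ (A i j t) (G t j)) (G' t i)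
        + inner ℝ (mulLp μ (A' i j t) (G t j) + mulLp μ (A i j t) (G' t j)) (G t i)) t := by
    intro i j
    have h1 : HasDerivAt (fun t => mulLp μ (A i j t)) (mulLp μ (A' i j t)) t :=
      (mulLp μ).hasFDerivAt.comp_hasDerivAt t (hA i j)
    exact (h1.clm_apply (hGi j)).inner ℝ (hGi i)
  have := HasDerivAt.fun_sum (u := Finset.univ) fun i _ =>
    HasDerivAt.fun_sum (u := Finset.univ) fun j _ => h i j
  refine HasDerivAt.congr_deriv this ?_
  simp only [quadForm, ← Finset.sum_add_distrib, inner_add_left]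
  refine Finset.sum_congr rfl fun i _ => Finset.sum_congr rfl fun j _ => ?_
  ring

theorem continuousOn_quadForm {A : ι → ι → ℝ → Lp ℝ ∞ μ} {G G' : ℝ → ι → Lp ℝ 2 μ} {s : Set ℝ}
    (hA : ∀ i j, ContinuousOn (A i j) s) (hG : ContinuousOn G s) (hG' : ContinuousOn G' s) :
    ContinuousOn (fun t => quadForm μ (fun i j => A i j t) (G t) (G' t)) s := by
  unfold quadForm
  have h1 : ∀ i, ContinuousOn (fun t => G t i) s := fun i => continuousOn_pi.1 hG i
  have h2 : ∀ i, ContinuousOn (fun t => G' t i) s := fun i => continuousOn_pi.1 hG' i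
  refine continuousOn_finsetSum _ fun i _ => continuousOn_finsetSum _ fun j _ => ?_
  exact (((mulLp μ).continuous.comp_continuousOn (hA i j)).clm_apply (h1 j)).inner (h2 i)

/-- Quantitative backward uniqueness for weak solutions of a degenerate parabolic problem. The
subspace `S` consists of the admissible triples `(v, ∇v, v|_∂Ω)`. -/
theorem energy_lower_bound {T lam B κ C : ℝ} (hT : 0 < T) (hlam : 0 ≤ lam)
    (hB : 0 ≤ B) (hκ : 0 ≤ κ) {A A' : ι → ι → ℝ → Lp ℝ ∞ μ} {r : Lp ℝ ∞ ν} {s : Lp ℝ ∞ μ}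
    (hA : ∀ t ∈ Ioo 0 T, ∀ i j, HasDerivAt (A i j) (A' i j t) t)
    (hA' : ∀ i j, ContinuousOn (A' i j) (Ioo 0 T))
    (hsymm : ∀ t ∈ Ioo 0 T, ∀ i j, A i j t = A j i t)
    (hs : ∀ G : ι → Lp ℝ 2 μ, 0 ≤ ∑ i, inner ℝ (mulLp μ s (G i)) (G i))
    (hell : ∀ t ∈ Ioo 0 T, ∀ G : ι → Lp ℝ 2 μ,
      ∑ i, inner ℝ (mulLp μ s (G i)) (G i) ≤ quadForm μ (fun i j => A i j t) G G)
    (hdeg : ∀ t ∈ Ioo 0 T, ∀ G : ι → Lp ℝ 2 μ,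
      quadForm μ (fun i j => A' i j t) G G ≤ lam * quadForm μ (fun i j => A i j t) G G)
    {S : Submodule ℝ ((Lp ℝ 2 μ × (ι → Lp ℝ 2 μ)) × Lp ℝ 2 ν)}
    (hSC : ∀ p ∈ S, ‖p.2‖ ≤ C * ‖p.1‖)
    (hSκ : ∀ p ∈ S, |inner ℝ (mulLp ν r p.2) p.2|
      ≤ (∑ i, inner ℝ (mulLp μ s (p.1.2 i)) (p.1.2 i)) / 2 + κ * ‖p.1.1‖ ^ 2)
    {u y : ℝ → Lp ℝ 2 μ} {G G' : ℝ → ι → Lp ℝ 2 μ} (huc : ContinuousOn u (Icc 0 T))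
    (hyc : ContinuousOn y (Icc 0 T)) (hu : ∀ t ∈ Ioo 0 T, HasDerivAt u (y t) t)
    (hG : ∀ t ∈ Ioo 0 T, HasDerivAt G (G' t) t) (hGc : ContinuousOn G' (Ioo 0 T))
    (h : ∀ᵐ t ∂(volume.restrict (Ioo 0 T)), ∃ (f : Lp ℝ 2 μ) (g : Lp ℝ 2 ν),
      ((u t, G t), g) ∈ S.topologicalClosure ∧
      ‖f‖ ^ 2 ≤ B * ((∑ i, inner ℝ (mulLp μ s (G t i)) (G t i)) + ‖u t‖ ^ 2) ∧
      ∀ p ∈ S, quadForm μ (fun i j => A i j t) (G t) p.1.2 + inner ℝ (mulLp ν r g) p.2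
        = inner ℝ (f - y t) p.1.1)
    (hu0 : u 0 ≠ 0) :
    ‖u 0‖ ^ 2 * Real.exp (-((3 + (4 * B + 8 * κ ^ 2))
      * Real.exp ((2 * lam + (4 * B + 8 * κ ^ 2) / 2) * T) * T * (2 + (4 * B + 8 * κ ^ 2))
      * (1 + ‖y 0‖ / ‖u 0‖))) ≤ ‖u T‖ ^ 2 := by
  set K := S.topologicalClosure with hKdef
  have hKcl : IsClosed (K : Set ((Lp ℝ 2 μ × (ι → Lp ℝ 2 μ)) × Lp ℝ 2 ν)) := S.isClosed_topologicalClosure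
  have closure_ind : ∀ {P : (Lp ℝ 2 μ × (ι → Lp ℝ 2 μ)) × Lp ℝ 2 ν → Prop},
      IsClosed {p | P p} → (∀ p ∈ S, P p) → ∀ p ∈ K, P p := by
    intro P hP hSP p hp
    exact closure_minimal (fun p hp => hSP p hp) hP hp
  have hKC : ∀ p ∈ K, ‖p.2‖ ≤ C * ‖p.1‖ := by
    refine closure_ind (isClosed_le ?_ ?_) hSC
    · fun_prop
    · fun_prop
  have hKκ : ∀ p ∈ K, |inner ℝ (mulLp ν r p.2) p.2|
      ≤ (∑ i, inner ℝ (mulLp μ s (p.1.2 i)) (p.1.2 i)) / 2 + κ * ‖p.1.1‖ ^ 2 := by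
    refine closure_ind (isClosed_le ?_ ?_) hSκ
    · fun_prop
    · fun_prop
  have hwd : ∀ t ∈ Ioo 0 T, HasDerivAt (fun t => (u t, G t)) (y t, G' t) t :=
    fun t ht => (hu t ht).prodMk (hG t ht)
  have hwc : ContinuousOn (fun t => (y t, G' t)) (Ioo 0 T) :=
    (hyc.mono Ioo_subset_Icc_self).prodMk hGc
  -- `z` is the trace of `u`. The membership `hzK'` makes the time derivative `y`, with gradient
  -- `G'` and trace `z'`, admissible in the weak formulation.
  obtain ⟨z, z', hz, hzc, hzK, hzK', huniq⟩ := exists_lift_hasDerivAt hKcl hKC hwd hwc (by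
    filter_upwards [h] with t ⟨f, g, h1, _⟩ using ⟨g, h1⟩)
  have hzc0 : ContinuousOn z (Ioo 0 T) := fun t ht => (hz t ht).continuousAt.continuousWithinAt
  have hGc0 : ContinuousOn G (Ioo 0 T) := fun t ht => (hG t ht).continuousAt.continuousWithinAt
  have hAc : ∀ i j, ContinuousOn (A i j) (Ioo 0 T) := fun i j t ht =>
    (hA t ht i j).continuousAt.continuousWithinAt
  have huc' : ContinuousOn u (Ioo 0 T) := huc.mono Ioo_subset_Icc_self
  have hyc' : ContinuousOn y (Ioo 0 T) := hyc.mono Ioo_subset_Icc_self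
  -- By `hKκ` the boundary term is at least minus half the weighted energy minus `κ ‖u‖²`. The shift
  -- `2 κ ‖u‖²` therefore keeps `e` above half of the quadratic form.
  set e : ℝ → ℝ := fun t => quadForm μ (fun i j => A i j t) (G t) (G t)
    + inner ℝ (mulLp ν r (z t)) (z t) + 2 * κ * ‖u t‖ ^ 2 with he
  set e' : ℝ → ℝ := fun t => (quadForm μ (fun i j => A' i j t) (G t) (G t)
        + quadForm μ (fun i j => A i j t) (G' t) (G t)
        + quadForm μ (fun i j => A i j t) (G t) (G' t))
    + (inner ℝ (mulLp ν r (z t)) (z' t) + inner ℝ (mulLp ν r (z' t)) (z t))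
    + 2 * κ * (2 * inner ℝ (u t) (y t)) with he'
  have hed : ∀ t ∈ Ioo 0 T, HasDerivAt e (e' t) t := by
    intro t ht
    refine ((hasDerivAt_quadForm (hA t ht) (hG t ht)).add ?_).add ?_
    · exact HasDerivAt.inner ℝ ((mulLp ν r).hasFDerivAt.comp_hasDerivAt t (hz t ht)) (hz t ht)
    · exact (hu t ht).norm_sq.const_mul _
  have hec : ContinuousOn e' (Ioo 0 T) := by
    have i1 := continuousOn_quadForm hA' hGc0 hGc0
    have i2 := continuousOn_quadForm hAc hGc hGc0
    have i3 := continuousOn_quadForm hAc hGc0 hGc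
    have i4 : ContinuousOn (fun t => (inner ℝ (mulLp ν r (z t)) (z' t) : ℝ)) (Ioo 0 T) :=
      ((mulLp ν r).continuous.comp_continuousOn hzc0).inner hzc
    have i5 : ContinuousOn (fun t => (inner ℝ (mulLp ν r (z' t)) (z t) : ℝ)) (Ioo 0 T) :=
      ((mulLp ν r).continuous.comp_continuousOn hzc).inner hzc0
    have i6 : ContinuousOn (fun t => (inner ℝ (u t) (y t) : ℝ)) (Ioo 0 T) := huc'.inner hyc'
    exact (((i1.add i2).add i3).add (i4.add i5)).add
      (continuousOn_const.mul (continuousOn_const.mul i6))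
  have hlow : ∀ t ∈ Ioo 0 T, quadForm μ (fun i j => A i j t) (G t) (G t) / 2 ≤ e t := by
    intro t ht
    have h1 := neg_le_of_abs_le (hKκ _ (hzK t ht))
    have h2 := hell t ht (G t)
    have h3 : 0 ≤ κ * ‖u t‖ ^ 2 := by positivity
    simp only at h1
    simp only [he]
    linarith
  have he0 : ∀ t ∈ Ioo 0 T, 0 ≤ e t := fun t ht => by
    linarith [hlow t ht, hell t ht (G t), hs (G t)]
  refine norm_sq_lower_bound (lam := 2 * lam) (B := 4 * B + 8 * κ ^ 2) (by positivity)
    (by positivity) hT huc hyc hu hed hec he0 ?_ hu0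
  filter_upwards [h, ae_restrict_mem measurableSet_Ioo] with t ⟨f, g, h1, h2, h3⟩ ht
  have hg : g = z t := huniq t ht g h1
  rw [hg] at h3
  have h3' : ∀ p ∈ K, quadForm μ (fun i j => A i j t) (G t) p.1.2 + inner ℝ (mulLp ν r (z t)) p.2
      = inner ℝ (f - y t) p.1.1 := by
    refine closure_ind (isClosed_eq ?_ ?_) h3
    · refine Continuous.add ((continuous_quadForm_right _ _).comp (by fun_prop)) (by fun_prop)
    · fun_prop
  have eu := h3' _ (hzK t ht)
  have ey := h3' _ (hzK' t ht)
  simp only at eu ey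
  -- Shifting the operator by `2 κ` adds `2 κ u` to the right-hand side. The form is at most `2 e`,
  -- which turns `lam` into `2 * lam`; together with `‖f + 2κu‖² ≤ 2‖f‖² + 8κ²‖u‖²` this gives the
  -- constant `4 * B + 8 * κ ^ 2`.
  refine ⟨f + (2 * κ) • u t, ?_, ?_, ?_⟩
  · rw [add_sub_right_comm, inner_add_left, ← eu, real_inner_smul_left,
      real_inner_self_eq_norm_sq]
  · rw [add_sub_right_comm, inner_add_left, ← ey, real_inner_smul_left]
    have q1 := quadForm_symm (hsymm t ht) (G' t) (G t)
    have q2 := hdeg t ht (G t)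
    have q3 := inner_mulLp_comm r (z' t) (z t)
    have q4 := mul_le_mul_of_nonneg_left (hlow t ht) hlam
    simp only [he']
    rw [q1, q3]
    linarith
  · have n1 : ‖f + (2 * κ) • u t‖ ^ 2 ≤ 2 * ‖f‖ ^ 2 + 8 * κ ^ 2 * ‖u t‖ ^ 2 := by
      have p1 : ‖f + (2 * κ) • u t‖ ≤ ‖f‖ + 2 * κ * ‖u t‖ := by
        refine (norm_add_le _ _).trans ?_
        rw [norm_smul, Real.norm_eq_abs, abs_of_nonneg (by positivity)]
      have p2 := mul_self_le_mul_self (norm_nonneg _) p1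
      nlinarith [sq_nonneg (‖f‖ - 2 * κ * ‖u t‖)]
    have n2 := hell t ht (G t)
    have n3 := hlow t ht
    have n4 : B * ((∑ i, inner ℝ (mulLp μ s (G t i)) (G t i)) + ‖u t‖ ^ 2)
        ≤ B * (2 * e t + ‖u t‖ ^ 2) := mul_le_mul_of_nonneg_left (by linarith) hB
    have n5 := he0 t ht
    have n6 : 0 ≤ B * ‖u t‖ ^ 2 := by positivity
    have n7 : 0 ≤ κ ^ 2 * e t := by positivity
    nlinarith

end Energy

end

noncomputable section

/-! ### Coefficients -/

section QuadForm

variable {α ι : Type*} [Fintype ι] {mα : MeasurableSpace α} {μ : Measure α}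

theorem integrable_mulLp_mul {a : α → ℝ} {A : Lp ℝ ∞ μ} (hA : A =ᵐ[μ] a) (f g : Lp ℝ 2 μ) :
    Integrable (fun x => a x * f x * g x) μ := by
  refine ((Lp.memLp (mulLp μ A f)).integrable_mul (Lp.memLp g)).congr ?_
  filter_upwards [hA, coeFn_mulLp A f] with x h1 h2
  rw [Pi.mul_apply, h2, h1]

theorem inner_mulLp_of_ae_eq {a : α → ℝ} {A : Lp ℝ ∞ μ} (hA : A =ᵐ[μ] a) (f g : Lp ℝ 2 μ) :
    inner ℝ (mulLp μ A f) g = ∫ x, a x * f x * g x ∂μ := by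
  rw [inner_mulLp]
  refine integral_congr_ae ?_
  filter_upwards [hA] with x h1
  rw [h1]

theorem integrable_quadForm {a : ι → ι → α → ℝ} {A : ι → ι → Lp ℝ ∞ μ}
    (hA : ∀ i j, A i j =ᵐ[μ] a i j) (G G' : ι → Lp ℝ 2 μ) :
    Integrable (fun x => ∑ i, ∑ j, a i j x * G j x * G' i x) μ :=
  integrable_finsetSum _ fun i _ => integrable_finsetSum _ fun j _ =>
    integrable_mulLp_mul (hA i j) _ _

theorem quadForm_eq_integral {a : ι → ι → α → ℝ} {A : ι → ι → Lp ℝ ∞ μ}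
    (hA : ∀ i j, A i j =ᵐ[μ] a i j) (G G' : ι → Lp ℝ 2 μ) :
    quadForm μ A G G' = ∫ x, ∑ i, ∑ j, a i j x * G j x * G' i x ∂μ := by
  rw [integral_finsetSum _ fun i _ => integrable_finsetSum _ fun j _ =>
    integrable_mulLp_mul (hA i j) _ _]
  refine Finset.sum_congr rfl fun i _ => ?_
  rw [integral_finsetSum _ fun j _ => integrable_mulLp_mul (hA i j) _ _]
  exact Finset.sum_congr rfl fun j _ => inner_mulLp_of_ae_eq (hA i j) _ _

theorem integrable_sum_mulLp {s : α → ℝ} {S : Lp ℝ ∞ μ} (hS : S =ᵐ[μ] s) (G : ι → Lp ℝ 2 μ) :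
    Integrable (fun x => s x * ∑ i, G i x ^ 2) μ := by
  simp only [Finset.mul_sum, pow_two, ← mul_assoc]
  exact integrable_finsetSum _ fun i _ => integrable_mulLp_mul hS _ _

theorem sum_inner_mulLp_eq_integral {s : α → ℝ} {S : Lp ℝ ∞ μ} (hS : S =ᵐ[μ] s)
    (G : ι → Lp ℝ 2 μ) :
    ∑ i, inner ℝ (mulLp μ S (G i)) (G i) = ∫ x, s x * ∑ i, G i x ^ 2 ∂μ := by
  simp only [Finset.mul_sum, pow_two, ← mul_assoc]
  rw [integral_finsetSum _ fun i _ => integrable_mulLp_mul hS _ _]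
  exact Finset.sum_congr rfl fun i _ => inner_mulLp_of_ae_eq hS _ _

theorem sum_inner_mulLp_nonneg {s : α → ℝ} {S : Lp ℝ ∞ μ} (hS : S =ᵐ[μ] s)
    (h : ∀ᵐ x ∂μ, 0 ≤ s x) (G : ι → Lp ℝ 2 μ) :
    0 ≤ ∑ i, inner ℝ (mulLp μ S (G i)) (G i) := by
  rw [sum_inner_mulLp_eq_integral hS]
  refine integral_nonneg_of_ae ?_
  filter_upwards [h] with x hx
  exact mul_nonneg hx (Finset.sum_nonneg fun i _ => sq_nonneg _)

theorem sum_inner_mulLp_le_quadForm {s : α → ℝ} {S : Lp ℝ ∞ μ} (hS : S =ᵐ[μ] s)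
    {a : ι → ι → α → ℝ} {A : ι → ι → Lp ℝ ∞ μ} (hA : ∀ i j, A i j =ᵐ[μ] a i j)
    (h : ∀ᵐ x ∂μ, ∀ ξ : ι → ℝ, s x * ∑ k, ξ k ^ 2 ≤ ∑ i, ∑ j, a i j x * ξ i * ξ j)
    (G : ι → Lp ℝ 2 μ) :
    ∑ i, inner ℝ (mulLp μ S (G i)) (G i) ≤ quadForm μ A G G := by
  rw [sum_inner_mulLp_eq_integral hS, quadForm_eq_integral hA]
  refine integral_mono_ae (integrable_sum_mulLp hS G) (integrable_quadForm hA G G) ?_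
  filter_upwards [h] with x hx
  refine (hx fun i => G i x).trans (le_of_eq ?_)
  exact Finset.sum_congr rfl fun i _ => Finset.sum_congr rfl fun j _ => by ring

theorem quadForm_le_mul_quadForm {a a' : ι → ι → α → ℝ} {A A' : ι → ι → Lp ℝ ∞ μ}
    (hA : ∀ i j, A i j =ᵐ[μ] a i j) (hA' : ∀ i j, A' i j =ᵐ[μ] a' i j) {lam : ℝ}
    (h : ∀ᵐ x ∂μ, ∀ ξ : ι → ℝ, 0 ≤ ∑ i, ∑ j, (lam * a i j x - a' i j x) * ξ i * ξ j)
    (G : ι → Lp ℝ 2 μ) : quadForm μ A' G G ≤ lam * quadForm μ A G G := by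
  rw [quadForm_eq_integral hA, quadForm_eq_integral hA', ← integral_const_mul]
  refine integral_mono_ae (integrable_quadForm hA' G G) ((integrable_quadForm hA G G).const_mul _)
    ?_
  filter_upwards [h] with x hx
  have := hx fun i => G i x
  have e : ∑ i, ∑ j, (lam * a i j x - a' i j x) * G i x * G j x
      = lam * (∑ i, ∑ j, a i j x * G j x * G i x) - ∑ i, ∑ j, a' i j x * G j x * G i x := by
    simp only [Finset.mul_sum, ← Finset.sum_sub_distrib]
    exact Finset.sum_congr rfl fun i _ => Finset.sum_congr rfl fun j _ => by ring
  linarith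

end QuadForm

/-- A continuous curve on a compact interval is bounded in `L^∞(Ω)`, which bounds the coefficient on
each slice; Fubini's theorem for null sets carries the bound over to the cylinder. -/
theorem IsC1Linfty.exists_ae_norm_le {d : ℕ} {Ω : Set (Eu d)} {T : ℝ} {a a' : Eu d × ℝ → ℝ}
    (h : IsC1Linfty Ω T a a') :
    ∃ C, ∀ᵐ p ∂(volume.restrict (stCylinder Ω T)), ‖a p‖ ≤ C := by
  obtain ⟨hm, -, A, hA, hAa⟩ := h
  obtain ⟨C, hC⟩ := isCompact_Icc.exists_bound_of_continuousOn hA.continuousOn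
  refine ⟨C, ?_⟩
  have h1 : ∀ᵐ t ∂(volume.restrict (Ioo 0 T)), ∀ᵐ x ∂(volume.restrict Ω), ‖a (x, t)‖ ≤ C := by
    filter_upwards [ae_restrict_mem measurableSet_Ioo] with t ht
    have ht' : t ∈ Icc 0 T := Ioo_subset_Icc_self ht
    have h2 : ∀ᵐ x ∂(volume.restrict Ω), ‖A t x‖ ≤ ‖A t‖ := by
      rw [Lp.norm_def, toReal_eLpNorm (Lp.aestronglyMeasurable _)]
      exact ae_le_lpNorm_exponent_top (Lp.memLp (A t))
    filter_upwards [h2, (hAa t ht').1] with x h3 h4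
    rw [← h4]
    exact h3.trans (hC t ht')
  -- Passing from slices to the product needs a measurable set, hence the measurable representative.
  obtain ⟨a₀, ha₀, hae⟩ := hm
  have h5 : ∀ᵐ t ∂(volume.restrict (Ioo 0 T)), ∀ᵐ x ∂(volume.restrict Ω), ‖a₀ (x, t)‖ ≤ C := by
    filter_upwards [h1, ae_time_of_ae_stCylinder hae] with t h6 h7
    filter_upwards [h6, h7] with x h8 h9
    rwa [← h9]
  have hms : MeasurableSet {p : Eu d × ℝ | ‖a₀ p‖ ≤ C} :=
    measurableSet_le ha₀.norm.measurable measurable_const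
  have h6 : ∀ᵐ p ∂(volume.restrict (stCylinder Ω T)), ‖a₀ p‖ ≤ C := by
    rw [volume_restrict_stCylinder]
    refine (Measure.ae_prod_mem_iff_ae_ae_mem hms).2 ?_
    exact (Measure.ae_ae_comm (p := fun x t => ‖a₀ (x, t)‖ ≤ C) hms).2 h5
  filter_upwards [h6, hae] with p h7 h8
  rwa [h8]

/-- The curve in `L^∞(Ω)` given by a coefficient. -/
theorem IsC1Linfty.exists_curve {d : ℕ} {Ω : Set (Eu d)} {T : ℝ} (hT : 0 < T)
    {a a' : Eu d × ℝ → ℝ} (h : IsC1Linfty Ω T a a') :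
    ∃ A A' : ℝ → Lp ℝ ∞ (volume.restrict Ω), (∀ t ∈ Ioo 0 T, HasDerivAt A (A' t) t) ∧
      ContinuousOn A' (Ioo 0 T) ∧
      (∀ t ∈ Icc 0 T, A t =ᵐ[volume.restrict Ω] fun x => a (x, t)) ∧
      ∀ t ∈ Icc 0 T, A' t =ᵐ[volume.restrict Ω] fun x => a' (x, t) := by
  obtain ⟨-, -, A, hA, hAa⟩ := h
  refine ⟨A, derivWithin A (Icc 0 T), fun t ht => ?_, ?_, fun t ht => (hAa t ht).1,
    fun t ht => (hAa t ht).2⟩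
  · have h1 := hA.differentiableOn (by simp) t (Ioo_subset_Icc_self ht)
    exact h1.hasDerivWithinAt.hasDerivAt (Icc_mem_nhds ht.1 ht.2)
  · exact (hA.continuousOn_derivWithin (uniqueDiffOn_Icc hT) (by simp)).mono Ioo_subset_Icc_self

end

/-! ### Regular solutions as curves in `L²(Ω)` -/

theorem HasWeakSpaceDeriv.memL2Q {d : ℕ} {Ω : Set (Eu d)} (hΩ : IsOpen Ω) {T : ℝ} {i : Fin d}
    {f g : Eu d × ℝ → ℝ} (hf : MemH21 Ω T f) (h : HasWeakSpaceDeriv Ω T i f g) :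
    MemL2Q Ω T g := by
  obtain ⟨g', hg', hfg', -⟩ := hf.2.2 i
  exact hg'.ae_eq (HasWeakDeriv.ae_eq (hΩ.prod isOpen_Ioo) hfg' h)

theorem IsRegularSolution.memL2Q_grad {d : ℕ} {Ω : Set (Eu d)} (hΩ : IsOpen Ω) {T : ℝ}
    {a : Fin d → Fin d → Eu d × ℝ → ℝ} {b : Fin d → Eu d × ℝ → ℝ} {c : Eu d × ℝ → ℝ}
    {u : Fin 3 → Eu d × ℝ → ℝ} {Du : Fin d → Eu d × ℝ → ℝ} {v w : Fin 3 → Eu d → ℝ}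
    (h : IsRegularSolution Ω T a b c u Du v w) (i : Fin d) : MemL2Q Ω T (Du i) :=
  (h.grad i).memL2Q hΩ (h.memH21 0)

/-- A regular solution and its gradient are differentiable curves in `L²(Ω)`. -/
theorem IsRegularSolution.exists_curves {d : ℕ} {Ω : Set (Eu d)} (hΩ : IsOpen Ω)
    (hΩb : Bornology.IsBounded Ω) {T : ℝ} (hT : 0 < T)
    {a : Fin d → Fin d → Eu d × ℝ → ℝ} {b : Fin d → Eu d × ℝ → ℝ} {c : Eu d × ℝ → ℝ}
    {u : Fin 3 → Eu d × ℝ → ℝ} {Du : Fin d → Eu d × ℝ → ℝ} {v w : Fin 3 → Eu d → ℝ}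
    (h : IsRegularSolution Ω T a b c u Du v w) :
    ∃ (U Y : ℝ → Lp ℝ 2 (volume.restrict Ω)) (Γ Γ' : ℝ → Fin d → Lp ℝ 2 (volume.restrict Ω)),
      ContinuousOn U (Icc 0 T) ∧ ContinuousOn Y (Icc 0 T) ∧
      (∀ t ∈ Ioo 0 T, HasDerivAt U (Y t) t) ∧ (∀ t ∈ Ioo 0 T, HasDerivAt Γ (Γ' t) t) ∧
      ContinuousOn Γ' (Ioo 0 T) ∧ U 0 =ᵐ[volume.restrict Ω] v 0 ∧
      Y 0 =ᵐ[volume.restrict Ω] v 1 ∧ U T =ᵐ[volume.restrict Ω] w 0 ∧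
      ∀ᵐ t ∂(volume.restrict (Ioo 0 T)), (U t =ᵐ[volume.restrict Ω] fun x => u 0 (x, t)) ∧
        (Y t =ᵐ[volume.restrict Ω] fun x => u 1 (x, t)) ∧
        ∀ i, Γ t i =ᵐ[volume.restrict Ω] fun x => Du i (x, t) := by
  obtain ⟨U, hU, hUu, hU0⟩ := h.initial 0
  obtain ⟨V, hV, hVu, hVT⟩ := h.final 0
  obtain ⟨Y, hY, hYu, hY0⟩ := h.initial 1
  have hL : ∀ k, MemL2Q Ω T (u k) := fun k => (h.memH21 k).1
  have key : ∀ i, ∃ Γ Γ' : ℝ → Lp ℝ 2 (volume.restrict Ω),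
      (∀ t ∈ Ioo 0 T, HasDerivAt Γ (Γ' t) t) ∧ ContinuousOn Γ' (Ioo 0 T) ∧
      ∀ᵐ t ∂(volume.restrict (Ioo 0 T)), Γ t =ᵐ[volume.restrict Ω] fun x => Du i (x, t) := by
    intro i
    obtain ⟨G₁, hG₁, hu₁, -⟩ := (h.memH21 1).2.2 i
    obtain ⟨G₂, hG₂, hu₂, -⟩ := (h.memH21 2).2.2 i
    -- `∂_t ∂_i u = ∂_i ∂_t u`, and once more for `∂_t u` in the next line. The second identity is
    -- what makes `Γ'` continuous, and it is where `∂_t² u` enters.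
    have h₀ : HasWeakTimeDeriv Ω T (Du i) G₁ := HasWeakDeriv.comm h.deriv_one (h.grad i) hu₁
    have h₁ : HasWeakTimeDeriv Ω T G₁ G₂ := HasWeakDeriv.comm h.deriv_two hu₁ hu₂
    obtain ⟨Γ, hΓ, hΓu⟩ := h₀.exists_continuousOn hΩ hΩb hT (h.memL2Q_grad hΩ i) hG₁
    obtain ⟨Γ', hΓ', hΓu'⟩ := h₁.exists_continuousOn hΩ hΩb hT hG₁ hG₂
    exact ⟨Γ, Γ', fun t ht => h₀.hasDerivAt hΩ hΩb hT (h.memL2Q_grad hΩ i) hG₁ hΓ hΓ' hΓu hΓu' ht,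
      hΓ'.mono Ioo_subset_Icc_self, hΓu⟩
  choose Γ Γ' hΓ hΓ' hΓu using key
  refine ⟨U, Y, fun t i => Γ i t, fun t i => Γ' i t, hU, hY,
    fun t ht => h.deriv_one.hasDerivAt hΩ hΩb hT (hL 0) (hL 1) hU hY hUu hYu ht,
    fun t ht => hasDerivAt_pi.2 fun i => hΓ i t ht, continuousOn_pi.2 hΓ', hU0, hY0, ?_, ?_⟩
  · rw [eqOn_Icc_of_ae_eq_slice hT hU hV hUu hVu (right_mem_Icc.2 hT.le)]
    exact hVT
  · filter_upwards [hUu, hYu, ae_all_iff.2 hΓu] with t h1 h2 h3 using ⟨h1, h2, h3⟩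

theorem HasWeakSpaceDeriv.ae_hasWeakPartial {d : ℕ} {Ω : Set (Eu d)}
    (hΩb : Bornology.IsBounded Ω) {T : ℝ} {i : Fin d} {f g : Eu d × ℝ → ℝ} (hf : MemL2Q Ω T f)
    (hg : MemL2Q Ω T g) (h : HasWeakSpaceDeriv Ω T i f g) :
    ∀ᵐ t ∂(volume.restrict (Ioo 0 T)),
      HasWeakPartial Ω i (fun x => f (x, t)) (fun x => g (x, t)) := by
  have := isFiniteMeasure_restrict_of_isBounded hΩb
  -- The definition of a weak derivative is a first-order identity whose only flux component is `f`
  -- in direction `i`.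
  have key := ae_time_weak_identity hΩb hg (q := fun j => if j = i then f else 0)
    (fun j => by
      by_cases hj : j = i
      · simpa [hj] using hf
      · simp only [hj, if_false]
        exact MemLp.zero)
    (fun φ hφ => by
      have hfi := (hφ.fderiv_apply (basisVec i, (0 : ℝ))).memLp (μ := volume.restrict (stCylinder Ω T)) 2
      have hφ2 := hφ.memLp (μ := volume.restrict (stCylinder Ω T)) 2
      have e := h.2.2 φ hφ
      simp only [ite_apply, Pi.zero_apply, ite_mul, zero_mul, Finset.sum_ite_eq', Finset.mem_univ, if_true]
      have i1 : Integrable (fun p => g p * φ p) (volume.restrict (stCylinder Ω T)) :=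
        MemLp.integrable_mul hg hφ2
      have i2 : Integrable (fun p => f p * fderiv ℝ φ p (basisVec i, (0 : ℝ)))
        (volume.restrict (stCylinder Ω T)) := MemLp.integrable_mul hf hfi
      rw [integral_add i1 i2, e]
      ring)
  filter_upwards [key, hf.ae_memLp, hg.ae_memLp] with t ht hft hgt
  refine ⟨IntegrableOn.locallyIntegrableOn (hft.integrable (by norm_num)),
    IntegrableOn.locallyIntegrableOn (hgt.integrable (by norm_num)), fun φ hφ => ?_⟩
  have hfi := (hφ.fderiv_apply (basisVec i)).memLp (μ := volume.restrict Ω) 2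
  have hφ2 := hφ.memLp (μ := volume.restrict Ω) 2
  have e := ht φ hφ
  simp only [ite_apply, Pi.zero_apply, ite_mul, zero_mul, Finset.sum_ite_eq', Finset.mem_univ, if_true] at e
  have i1 : Integrable (fun x => g (x, t) * φ x) (volume.restrict Ω) := hgt.integrable_mul hφ2
  have i2 : Integrable (fun x => f (x, t) * fderiv ℝ φ x (basisVec i)) (volume.restrict Ω) :=
    hft.integrable_mul hfi
  rw [integral_add i1 i2] at e
  linarith

theorem MemL2Q.mul_of_ae_norm_le {d : ℕ} {Ω : Set (Eu d)} {T C : ℝ} {f g : Eu d × ℝ → ℝ}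
    (hg : MemL2Q Ω T g) (hf : AEStronglyMeasurable f (volume.restrict (stCylinder Ω T)))
    (h : ∀ᵐ p ∂(volume.restrict (stCylinder Ω T)), ‖f p‖ ≤ C) :
    MemL2Q Ω T (fun p => f p * g p) :=
  MemLp.mul' (r := 2) hg (memLp_top_of_bound hf C h)

/-- The equation holds weakly in `Ω` for almost every time. -/
theorem IsRegularSolution.ae_slice_equation {d : ℕ} {Ω : Set (Eu d)} (hΩ : IsOpen Ω)
    (hΩb : Bornology.IsBounded Ω) {T : ℝ}
    {a a' : Fin d → Fin d → Eu d × ℝ → ℝ} {b : Fin d → Eu d × ℝ → ℝ} {c : Eu d × ℝ → ℝ}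
    (ha : ∀ i j, IsC1Linfty Ω T (a i j) (a' i j))
    (hb : ∀ k, MemLp (b k) ∞ (volume.restrict (stCylinder Ω T)))
    (hc : MemLp c ∞ (volume.restrict (stCylinder Ω T)))
    {u : Fin 3 → Eu d × ℝ → ℝ} {Du : Fin d → Eu d × ℝ → ℝ} {v w : Fin 3 → Eu d → ℝ}
    (h : IsRegularSolution Ω T a b c u Du v w) :
    ∀ᵐ t ∂(volume.restrict (Ioo 0 T)),
      MemLp (fun x => ∑ k, b k (x, t) * Du k (x, t) + c (x, t) * u 0 (x, t)) 2
        (volume.restrict Ω) ∧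
      (∀ i, MemLp (fun x => ∑ j, a i j (x, t) * Du j (x, t)) 2 (volume.restrict Ω)) ∧
      ∀ ψ, IsTestFunction Ω ψ →
      ∫ x in Ω, ((u 1 (x, t) - (∑ k, b k (x, t) * Du k (x, t) + c (x, t) * u 0 (x, t))) * ψ x
        + ∑ i, (∑ j, a i j (x, t) * Du j (x, t)) * fderiv ℝ ψ x (basisVec i)) = 0 := by
  have hD := h.memL2Q_grad hΩ
  have hq : ∀ i, MemL2Q Ω T (fun p => ∑ j, a i j p * Du j p) := fun i =>
    memLp_finsetSum _ fun j _ => by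
      obtain ⟨C, hC⟩ := (ha i j).exists_ae_norm_le
      exact (hD j).mul_of_ae_norm_le (ha i j).1 hC
  have hF : MemL2Q Ω T (fun p => ∑ k, b k p * Du k p + c p * u 0 p) :=
    MemLp.add (memLp_finsetSum _ fun k _ => MemLp.mul' (r := 2) (hD k) (hb k))
      (MemLp.mul' (r := 2) (h.memH21 0).1 hc)
  have hF' : MemL2Q Ω T (fun p => u 1 p - (∑ k, b k p * Du k p + c p * u 0 p)) :=
    MemLp.sub (h.memH21 1).1 hF
  have key := ae_time_weak_identity hΩb hF' hq fun φ hφ => by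
    have e := h.equation φ hφ
    simp only [zero_mul, integral_zero] at e
    refine Eq.trans ?_ e
    congr 1 with p
    simp only [Finset.sum_mul]
    rw [← Finset.sum_mul]
    ring
  filter_upwards [key, hF.ae_memLp, ae_all_iff.2 fun i => (hq i).ae_memLp] with t h1 h2 h3
  exact ⟨h2, h3, h1⟩

theorem sq_sum_mul_le_of_sqrt_le {ι : Type*} [Fintype ι] {b ξ : ι → ℝ} {K s : ℝ} (hs : 0 ≤ s)
    (h : √(∑ k, b k ^ 2) ≤ K * √s) : (∑ k, b k * ξ k) ^ 2 ≤ K ^ 2 * (s * ∑ k, ξ k ^ 2) := by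
  have h0 : 0 ≤ ∑ k, b k ^ 2 := Finset.sum_nonneg fun k _ => sq_nonneg _
  have h1 : ∑ k, b k ^ 2 ≤ K ^ 2 * s := by
    calc ∑ k, b k ^ 2 = √(∑ k, b k ^ 2) ^ 2 := (Real.sq_sqrt h0).symm
      _ ≤ (K * √s) ^ 2 := by gcongr
      _ = K ^ 2 * s := by rw [mul_pow, Real.sq_sqrt hs]
  calc (∑ k, b k * ξ k) ^ 2 ≤ (∑ k, b k ^ 2) * ∑ k, ξ k ^ 2 :=
        Finset.sum_mul_sq_le_sq_mul_sq _ _ _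
    _ ≤ (K ^ 2 * s) * ∑ k, ξ k ^ 2 := by
        gcongr
    _ = K ^ 2 * (s * ∑ k, ξ k ^ 2) := by ring

theorem L2.norm_sq_eq_integral {α : Type*} {m : MeasurableSpace α} {μ : Measure α}
    {f : Lp ℝ 2 μ} {f' : α → ℝ} (hf : f =ᵐ[μ] f') : ‖f‖ ^ 2 = ∫ x, f' x ^ 2 ∂μ := by
  rw [← real_inner_self_eq_norm_sq, L2.real_inner_eq_integral_of_ae_eq hf hf]
  simp only [sq]

/-- The bound on `b` is exactly what makes `|b · ∇u|² ≤ K² σ |∇u|²`, so the drift is controlled by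
the degenerate energy. -/
theorem norm_sq_lowerOrder_le {ι α : Type*} [Fintype ι] {m : MeasurableSpace α} {μ : Measure α}
    {b : ι → α → ℝ} {c s : α → ℝ} {K Cc : ℝ} {S : Lp ℝ ∞ μ} (hS : S =ᵐ[μ] s)
    (hs : ∀ᵐ x ∂μ, 0 ≤ s x) (hb : ∀ᵐ x ∂μ, √(∑ k, b k x ^ 2) ≤ K * √(s x))
    (hc : ∀ᵐ x ∂μ, ‖c x‖ ≤ Cc) {f u : Lp ℝ 2 μ} {G : ι → Lp ℝ 2 μ}
    (hf : f =ᵐ[μ] fun x => ∑ k, b k x * G k x + c x * u x) :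
    ‖f‖ ^ 2 ≤ (2 * K ^ 2 + 2 * Cc ^ 2)
      * ((∑ i, inner ℝ (mulLp μ S (G i)) (G i)) + ‖u‖ ^ 2) := by
  have hi : Integrable (fun x => s x * ∑ i, G i x ^ 2) μ := integrable_sum_mulLp hS G
  have hu : Integrable (fun x => u x ^ 2) μ := (Lp.memLp u).integrable_sq
  have hσ0 := sum_inner_mulLp_nonneg hS hs G
  have hle : ‖f‖ ^ 2 ≤ 2 * K ^ 2 * (∑ i, inner ℝ (mulLp μ S (G i)) (G i))
      + 2 * Cc ^ 2 * ‖u‖ ^ 2 := by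
    rw [L2.norm_sq_eq_integral hf, L2.norm_sq_eq_integral (Filter.EventuallyEq.refl _ u),
      sum_inner_mulLp_eq_integral hS, ← integral_const_mul, ← integral_const_mul,
      ← integral_add (hi.const_mul _) (hu.const_mul _)]
    refine integral_mono_of_nonneg (Eventually.of_forall fun x => sq_nonneg _)
      ((hi.const_mul _).add (hu.const_mul _)) ?_
    filter_upwards [hs, hb, hc] with x h1 h2 h3
    have h4 := sq_sum_mul_le_of_sqrt_le (ξ := fun k => G k x) h1 h2
    have h5 : (c x) ^ 2 ≤ Cc ^ 2 := by
      rw [← sq_abs]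
      exact pow_le_pow_left₀ (abs_nonneg _) h3 2
    have h6 : (c x * u x) ^ 2 ≤ Cc ^ 2 * u x ^ 2 := by
      rw [mul_pow]
      gcongr
    nlinarith [sq_nonneg (∑ k, b k x * G k x - c x * u x)]
  have : 0 ≤ K ^ 2 * ‖u‖ ^ 2 := by positivity
  have : 0 ≤ Cc ^ 2 * (∑ i, inner ℝ (mulLp μ S (G i)) (G i)) := mul_nonneg (sq_nonneg _) hσ0
  nlinarith

/-! ### Boundary conditions -/

/-- The triples `(φ|_Ω, ∇φ|_Ω, φ|_∂Ω)` for the smooth functions `φ` in `P`. -/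
def traceSubmodule {d : ℕ} (Ω : Set (Eu d)) (P : Submodule ℝ (Eu d → ℝ)) :
    Submodule ℝ ((Lp ℝ 2 (volume.restrict Ω) × (Fin d → Lp ℝ 2 (volume.restrict Ω)))
      × Lp ℝ 2 (surfaceMeasure Ω)) where
  carrier := {p | ∃ φ ∈ P, ContDiff ℝ ∞ φ ∧ p.1.1 =ᵐ[volume.restrict Ω] φ ∧
    (∀ i, p.1.2 i =ᵐ[volume.restrict Ω] fun x => fderiv ℝ φ x (basisVec i)) ∧
    p.2 =ᵐ[surfaceMeasure Ω] φ}
  zero_mem' := by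
    refine ⟨0, P.zero_mem, contDiff_const, Lp.coeFn_zero _ _ _, fun i => ?_, Lp.coeFn_zero _ _ _⟩
    refine (Lp.coeFn_zero _ _ _).trans (Eventually.of_forall fun x => ?_)
    simp
  add_mem' := by
    rintro p q ⟨φ, hφP, hφ, h1, h2, h3⟩ ⟨ψ, hψP, hψ, k1, k2, k3⟩
    refine ⟨φ + ψ, P.add_mem hφP hψP, hφ.add hψ, (Lp.coeFn_add _ _).trans (h1.add k1),
      fun i => ((Lp.coeFn_add _ _).trans ((h2 i).add (k2 i))).trans (Eventually.of_forall fun x => ?_),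
      (Lp.coeFn_add _ _).trans (h3.add k3)⟩
    simp [fderiv_add (hφ.differentiable (by simp) x) (hψ.differentiable (by simp) x)]
  smul_mem' := by
    rintro c p ⟨φ, hφP, hφ, h1, h2, h3⟩
    refine ⟨c • φ, P.smul_mem c hφP, contDiff_const.smul hφ,
      (Lp.coeFn_smul _ _).trans (h1.const_smul c), fun i => ((Lp.coeFn_smul _ _).trans
        ((h2 i).const_smul c)).trans (Eventually.of_forall fun x => ?_),
      (Lp.coeFn_smul _ _).trans (h3.const_smul c)⟩
    simp [fderiv_const_smul (hφ.differentiable (by simp) x)]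

/-- The test functions on `Ω`, as a space of functions. -/
def testSubmodule {d : ℕ} (Ω : Set (Eu d)) : Submodule ℝ (Eu d → ℝ) where
  carrier := {φ | IsTestFunction Ω φ}
  zero_mem' := isTestFunction_zero
  add_mem' := fun h h' => h.add h'
  smul_mem' := fun c _ h => h.const_smul c

theorem IsTestFunction.eq_zero_of_mem_frontier {d : ℕ} {Ω : Set (Eu d)} (hΩ : IsOpen Ω)
    {φ : Eu d → ℝ} (h : IsTestFunction Ω φ) {x : Eu d} (hx : x ∈ frontier Ω) : φ x = 0 := by
  by_contra hne
  have : x ∈ Ω := h.2.2 (subset_tsupport _ hne)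
  rw [hΩ.frontier_eq] at hx
  exact hx.2 this

theorem IsTestFunction.ae_surfaceMeasure_eq_zero {d : ℕ} {Ω : Set (Eu d)} (hΩ : IsOpen Ω)
    {φ : Eu d → ℝ} (h : IsTestFunction Ω φ) : φ =ᵐ[surfaceMeasure Ω] 0 :=
  ae_restrict_of_forall_mem isClosed_frontier.measurableSet
    fun _ hx => h.eq_zero_of_mem_frontier hΩ hx

theorem memLp_restrict_of_continuous {d : ℕ} {Ω : Set (Eu d)} (hΩ : IsOpen Ω)
    (hΩb : Bornology.IsBounded Ω) {φ : Eu d → ℝ} (h : ContinuousOn φ (closure Ω)) (p : ℝ≥0∞) :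
    MemLp φ p (volume.restrict Ω) := by
  have := isFiniteMeasure_restrict_of_isBounded hΩb
  obtain ⟨C, hC⟩ := hΩb.isCompact_closure.exists_bound_of_continuousOn h
  exact MemLp.of_bound ((h.mono subset_closure).aestronglyMeasurable hΩ.measurableSet) C
    (ae_restrict_of_forall_mem hΩ.measurableSet fun x hx => hC x (subset_closure hx))

theorem memLp_surfaceMeasure_of_continuousOn {d : ℕ} {Ω : Set (Eu d)}
    (hΩb : Bornology.IsBounded Ω) [IsFiniteMeasure (surfaceMeasure Ω)] {φ : Eu d → ℝ}
    (h : ContinuousOn φ (frontier Ω)) (p : ℝ≥0∞) : MemLp φ p (surfaceMeasure Ω) := by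
  have hK : IsCompact (frontier Ω) :=
    hΩb.isCompact_closure.of_isClosed_subset isClosed_frontier frontier_subset_closure
  obtain ⟨C, hC⟩ := hK.exists_bound_of_continuousOn h
  exact MemLp.of_bound (h.aestronglyMeasurable isClosed_frontier.measurableSet) C
    (ae_restrict_of_forall_mem isClosed_frontier.measurableSet hC)

theorem memLp_fderiv_apply {d : ℕ} {Ω : Set (Eu d)} (hΩ : IsOpen Ω)
    (hΩb : Bornology.IsBounded Ω) {φ : Eu d → ℝ} (h : ContDiff ℝ ∞ φ) (e : Eu d) (p : ℝ≥0∞) :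
    MemLp (fun x => fderiv ℝ φ x e) p (volume.restrict Ω) :=
  memLp_restrict_of_continuous hΩ hΩb
    ((h.continuous_fderiv (by simp)).clm_apply continuous_const).continuousOn p

/-- The triples of the approximating functions converge in all three components; uniqueness of weak
derivatives identifies the limit of the gradients with `Γ`. -/
theorem TendstoH1.mem_topologicalClosure {d : ℕ} {Ω : Set (Eu d)} (hΩ : IsOpen Ω)
    (hΩb : Bornology.IsBounded Ω) {P : Submodule ℝ (Eu d → ℝ)} {φ : ℕ → Eu d → ℝ} {v g : Eu d → ℝ}
    (hφ : ∀ n, ContDiff ℝ ∞ (φ n)) (hP : ∀ n, φ n ∈ P)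
    (hν : ∀ n, MemLp (φ n) 2 (surfaceMeasure Ω)) (hv : TendstoH1 Ω φ v)
    (hg : MemLp g 2 (surfaceMeasure Ω))
    (hφg : Tendsto (fun n => eLpNorm (fun x => φ n x - g x) 2 (surfaceMeasure Ω)) atTop (𝓝 0))
    {U : Lp ℝ 2 (volume.restrict Ω)} {Γ : Fin d → Lp ℝ 2 (volume.restrict Ω)}
    {Dv : Fin d → Eu d → ℝ} (hU : U =ᵐ[volume.restrict Ω] v)
    (hΓ : ∀ i, Γ i =ᵐ[volume.restrict Ω] Dv i) (hDv : ∀ i, HasWeakPartial Ω i v (Dv i)) :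
    ((U, Γ), hg.toLp g) ∈ (traceSubmodule Ω P).topologicalClosure := by
  obtain ⟨hvL, hvt, G, hG⟩ := hv
  have hΓG : ∀ i, Γ i = (hG i).1.toLp (G i) := fun i => Lp.ext <|
    ((hΓ i).trans (HasWeakDeriv.ae_eq hΩ (hDv i) (hG i).2.1)).trans (MemLp.coeFn_toLp _).symm
  have hUv : U = hvL.toLp v := Lp.ext (hU.trans (MemLp.coeFn_toLp _).symm)
  have m1 : ∀ n, MemLp (φ n) 2 (volume.restrict Ω) := fun n =>
    memLp_restrict_of_continuous hΩ hΩb (hφ n).continuous.continuousOn 2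
  have m2 : ∀ n i, MemLp (fun x => fderiv ℝ (φ n) x (basisVec i)) 2 (volume.restrict Ω) :=
    fun n i => memLp_fderiv_apply hΩ hΩb (hφ n) _ 2
  refine mem_closure_of_tendsto (b := atTop)
    (f := fun n => (((m1 n).toLp _, fun i => (m2 n i).toLp _), (hν n).toLp _)) ?_
    (Eventually.of_forall fun n => ⟨φ n, hP n, hφ n, MemLp.coeFn_toLp (m1 n),
      fun i => MemLp.coeFn_toLp (m2 n i), MemLp.coeFn_toLp (hν n)⟩)
  refine Tendsto.prodMk_nhds (Tendsto.prodMk_nhds ?_ (tendsto_pi_nhds.2 fun i => ?_)) ?_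
  · rw [hUv]
    exact (Lp.tendsto_Lp_iff_tendsto_eLpNorm'' _ m1 _ hvL).2 hvt
  · rw [hΓG]
    exact (Lp.tendsto_Lp_iff_tendsto_eLpNorm'' _ (fun n => m2 n i) _ (hG i).1).2 (hG i).2.2
  · exact (Lp.tendsto_Lp_iff_tendsto_eLpNorm'' _ hν _ hg).2 hφg

theorem MemH10.mem_topologicalClosure {d : ℕ} {Ω : Set (Eu d)} (hΩ : IsOpen Ω)
    (hΩb : Bornology.IsBounded Ω) {v : Eu d → ℝ} (hv : MemH10 Ω v)
    {U : Lp ℝ 2 (volume.restrict Ω)} {Γ : Fin d → Lp ℝ 2 (volume.restrict Ω)}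
    {Dv : Fin d → Eu d → ℝ} (hU : U =ᵐ[volume.restrict Ω] v)
    (hΓ : ∀ i, Γ i =ᵐ[volume.restrict Ω] Dv i) (hDv : ∀ i, HasWeakPartial Ω i v (Dv i)) :
    ((U, Γ), (0 : Lp ℝ 2 (surfaceMeasure Ω)))
      ∈ (traceSubmodule Ω (testSubmodule Ω)).topologicalClosure := by
  obtain ⟨φ, hφ, hφv⟩ := hv
  have h0 : ∀ n, φ n =ᵐ[surfaceMeasure Ω] 0 := fun n => (hφ n).ae_surfaceMeasure_eq_zero hΩ
  have h := hφv.mem_topologicalClosure hΩ hΩb (P := testSubmodule Ω) (g := 0)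
    (fun n => (hφ n).1) hφ (fun n => (MemLp.zero).ae_eq (h0 n).symm) MemLp.zero
    (by
      refine tendsto_const_nhds.congr fun n => ?_
      rw [eLpNorm_congr_ae (g := 0), eLpNorm_zero]
      filter_upwards [h0 n] with x hx
      simp [hx]) hU hΓ hDv
  rwa [MemLp.toLp_zero] at h

theorem eq_zero_of_mem_traceSubmodule_testSubmodule {d : ℕ} {Ω : Set (Eu d)} (hΩ : IsOpen Ω)
    {p : (Lp ℝ 2 (volume.restrict Ω) × (Fin d → Lp ℝ 2 (volume.restrict Ω)))
      × Lp ℝ 2 (surfaceMeasure Ω)} (hp : p ∈ traceSubmodule Ω (testSubmodule Ω)) : p.2 = 0 := by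
  obtain ⟨φ, hφ, -, -, -, h⟩ := hp
  refine Lp.ext ((h.trans (IsTestFunction.ae_surfaceMeasure_eq_zero hΩ hφ)).trans ?_)
  exact (Lp.coeFn_zero _ _ _).symm

/-- The trace inequality for the constant function `1` bounds the area of the boundary by a multiple
of the volume. -/
theorem HasSmoothBoundary.isFiniteMeasure_surfaceMeasure {d : ℕ} (hd : 0 < d) {Ω : Set (Eu d)}
    (hΩ : IsOpen Ω) (hΩb : Bornology.IsBounded Ω) (h : HasSmoothBoundary Ω) :
    IsFiniteMeasure (surfaceMeasure Ω) := by
  have := isFiniteMeasure_restrict_of_isBounded hΩb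
  obtain ⟨C, -, hC⟩ := h.trace_inequality hd hΩ hΩb (σ := fun _ => 1) continuousOn_const
    (fun _ _ => one_pos) one_pos
  refine ⟨?_⟩
  have := hC (fun _ => 1) contDiff_const
  simp at this
  refine this.trans_lt ?_
  exact ENNReal.mul_lt_top ENNReal.ofReal_lt_top (by simpa using measure_lt_top (volume.restrict Ω) univ)

theorem L2.lintegral_sq_eq {α : Type*} {m : MeasurableSpace α} {μ : Measure α}
    {f : Lp ℝ 2 μ} {f' : α → ℝ} (hf : f =ᵐ[μ] f') :
    ∫⁻ x, ENNReal.ofReal (f' x ^ 2) ∂μ = ENNReal.ofReal (‖f‖ ^ 2) := by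
  rw [L2.norm_sq_eq_integral hf, ofReal_integral_eq_lintegral_ofReal _
    (Eventually.of_forall fun x => sq_nonneg _)]
  exact ((memLp_congr_ae hf).1 (Lp.memLp f)).integrable_sq

theorem HasSmoothBoundary.norm_trace_sq_le {d : ℕ} (hd : 0 < d) {Ω : Set (Eu d)}
    (hΩ : IsOpen Ω) (hΩb : Bornology.IsBounded Ω) (h : HasSmoothBoundary Ω) {σ : Eu d → ℝ}
    (hσ : ContinuousOn σ (closure Ω)) (hσ0 : ∀ x ∈ closure Ω, 0 ≤ σ x)
    (hσ₀ : ∀ x ∈ frontier Ω, 0 < σ x) {s : Lp ℝ ∞ (volume.restrict Ω)}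
    (hs : s =ᵐ[volume.restrict Ω] σ) {ε : ℝ} (hε : 0 < ε) :
    ∃ C : ℝ, 0 ≤ C ∧ ∀ p ∈ traceSubmodule Ω ⊤, ‖p.2‖ ^ 2
      ≤ ε * (∑ i, inner ℝ (mulLp (volume.restrict Ω) s (p.1.2 i)) (p.1.2 i))
        + C * ‖p.1.1‖ ^ 2 := by
  obtain ⟨C, hC0, hC⟩ := h.trace_inequality hd hΩ hΩb hσ hσ₀ hε
  have hσΩ : ∀ᵐ x ∂(volume.restrict Ω), 0 ≤ σ x :=
    ae_restrict_of_forall_mem hΩ.measurableSet fun x hx => hσ0 x (subset_closure hx)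
  refine ⟨C, hC0, fun p hp => ?_⟩
  obtain ⟨φ, -, hφ, h1, h2, h3⟩ := hp
  have key := hC φ hφ
  have hG := sum_inner_mulLp_nonneg hs hσΩ p.1.2
  have e : ∫⁻ x in Ω, ENNReal.ofReal (σ x * ∑ k, fderiv ℝ φ x (basisVec k) ^ 2)
      = ENNReal.ofReal (∑ i, inner ℝ (mulLp (volume.restrict Ω) s (p.1.2 i)) (p.1.2 i)) := by
    rw [sum_inner_mulLp_eq_integral hs, ofReal_integral_eq_lintegral_ofReal
      (integrable_sum_mulLp hs p.1.2)]
    · refine lintegral_congr_ae ?_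
      filter_upwards [ae_all_iff.2 h2] with x hx
      simp only [hx]
    · filter_upwards [hσΩ] with x hx
      exact mul_nonneg hx (Finset.sum_nonneg fun i _ => sq_nonneg _)
  rw [e, L2.lintegral_sq_eq h3, L2.lintegral_sq_eq h1, ← ENNReal.ofReal_mul hε.le,
    ← ENNReal.ofReal_mul hC0, ← ENNReal.ofReal_add (by positivity) (by positivity)] at key
  exact (ENNReal.ofReal_le_ofReal_iff (by positivity)).1 key

/-! ### Weak formulation and Gauss' formula -/

theorem quadForm_sub_inner_eq_integral {ι α : Type*} [Fintype ι] {m : MeasurableSpace α}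
    {μ : Measure α} {a : ι → ι → α → ℝ} {A : ι → ι → Lp ℝ ∞ μ} (hA : ∀ i j, A i j =ᵐ[μ] a i j)
    {Γ G : ι → Lp ℝ 2 μ} {f y w : Lp ℝ 2 μ} {Du g : ι → α → ℝ} {F y' φ : α → ℝ}
    (hΓ : ∀ i, Γ i =ᵐ[μ] Du i) (hf : f =ᵐ[μ] F) (hy : y =ᵐ[μ] y') (hw : w =ᵐ[μ] φ)
    (hG : ∀ i, G i =ᵐ[μ] g i) :
    quadForm μ A Γ G - inner ℝ (f - y) w
      = ∫ x, ((y' x - F x) * φ x + ∑ i, (∑ j, a i j x * Du j x) * g i x) ∂μ := by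
  have hfy : ((f - y : Lp ℝ 2 μ) : α → ℝ) =ᵐ[μ] fun x => F x - y' x :=
    (Lp.coeFn_sub f y).trans (hf.sub hy)
  have hi : Integrable (fun x => (F x - y' x) * φ x) μ := by
    refine ((Lp.memLp (f - y)).integrable_mul (Lp.memLp w)).congr ?_
    filter_upwards [hfy, hw] with x h1 h2
    rw [Pi.mul_apply, h1, h2]
  rw [quadForm_eq_integral hA, L2.real_inner_eq_integral_of_ae_eq hfy hw,
    ← integral_sub (integrable_quadForm hA Γ G) hi]
  refine integral_congr_ae ?_
  filter_upwards [ae_all_iff.2 hΓ, ae_all_iff.2 hG] with x h1 h2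
  simp only [h1, h2, Finset.sum_mul]
  ring

theorem exists_isTestFunction_eventuallyEq {d : ℕ} {K : Set (Eu d)} (hK : Bornology.IsBounded K)
    {φ : Eu d → ℝ} (hφ : ContDiff ℝ ∞ φ) :
    ∃ ψ, IsTestFunction univ ψ ∧ ∀ x ∈ K, ψ =ᶠ[𝓝 x] φ := by
  obtain ⟨R, hR0, hR⟩ := hK.subset_ball_lt 0 0
  let χ : ContDiffBump (0 : Eu d) := ⟨R, R + 1, hR0, by linarith⟩
  refine ⟨fun x => χ x * φ x, ⟨χ.contDiff.mul hφ, χ.hasCompactSupport.mul_right,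
    subset_univ _⟩, fun x hx => ?_⟩
  filter_upwards [Metric.isOpen_ball.mem_nhds (hR hx)] with y hy
  rw [χ.one_of_mem_closedBall (Metric.ball_subset_closedBall hy), one_mul]

/-- Gauss' formula for a field whose weak divergence is given by an equation in `Ω`. -/
theorem HasNormalTrace.integral_eq {d : ℕ} {Ω : Set (Eu d)} (hΩ : IsOpen Ω)
    (hΩb : Bornology.IsBounded Ω) {q : Fin d → Eu d → ℝ} {h F : Eu d → ℝ}
    (hq : HasNormalTrace Ω q h) (hF : MemLp F 2 (volume.restrict Ω))
    (hFq : ∀ ψ, IsTestFunction Ω ψ →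
      ∫ x in Ω, (F x * ψ x + ∑ i, q i x * fderiv ℝ ψ x (basisVec i)) = 0)
    {φ : Eu d → ℝ} (hφ : ContDiff ℝ ∞ φ) :
    ∫ x in Ω, (F x * φ x + ∑ i, q i x * fderiv ℝ φ x (basisVec i))
      = ∫ x, h x * φ x ∂(surfaceMeasure Ω) := by
  obtain ⟨hqL, -, δ, hδ, hG⟩ := hq
  -- Test functions in `Ω` do not see the boundary term, so both functions are the weak divergence
  -- of `q`.
  have hFδ : F =ᵐ[volume.restrict Ω] δ := by
    have h0 : (hF.sub hδ).toLp (F - δ) = 0 := by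
      refine L2.eq_zero_of_forall_isTestFunction hΩ _ fun ψ hψ => ?_
      have h1 := hFq ψ hψ
      have h2 := hG ψ ⟨hψ.1, hψ.2.1, subset_univ _⟩
      have h3 : ∫ x, h x * ψ x ∂(surfaceMeasure Ω) = 0 := by
        refine integral_eq_zero_of_ae ?_
        filter_upwards [hψ.ae_surfaceMeasure_eq_zero hΩ] with x hx
        simp [hx]
      have hψ2 := hψ.memLp (μ := volume.restrict Ω) 2
      have i0 : Integrable (fun x => ∑ i, q i x * fderiv ℝ ψ x (basisVec i))
          (volume.restrict Ω) := integrable_finsetSum _ fun i _ =>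
        (hqL i).integrable_mul ((hψ.fderiv_apply (basisVec i)).memLp 2)
      have i1 : Integrable (fun x => F x * ψ x) (volume.restrict Ω) := hF.integrable_mul hψ2
      have i2 : Integrable (fun x => δ x * ψ x) (volume.restrict Ω) := hδ.integrable_mul hψ2
      rw [integral_add i1 i0] at h1
      rw [integral_add i0 i2, h3] at h2
      have e : ∫ x in Ω, (hF.sub hδ).toLp (F - δ) x * ψ x = ∫ x in Ω, (F x * ψ x - δ x * ψ x) := by
        refine integral_congr_ae ?_
        filter_upwards [MemLp.coeFn_toLp (hF.sub hδ)] with x hx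
        rw [hx, Pi.sub_apply]
        ring
      rw [e, integral_sub i1 i2]
      linarith
    have h1 := MemLp.coeFn_toLp (hF.sub hδ)
    rw [h0] at h1
    filter_upwards [h1, Lp.coeFn_zero ℝ 2 (volume.restrict Ω)] with x h2 h3
    rw [h3] at h2
    have : F x - δ x = 0 := h2.symm
    linarith
  -- A cutoff equal to one near the closure of `Ω` supplies compact support without changing either
  -- integral.
  obtain ⟨ψ, hψ, hψφ⟩ := exists_isTestFunction_eventuallyEq hΩb.closure hφ
  have key := hG ψ hψ
  have e1 : ∫ x, h x * ψ x ∂(surfaceMeasure Ω) = ∫ x, h x * φ x ∂(surfaceMeasure Ω) := by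
    refine integral_congr_ae (ae_restrict_of_forall_mem isClosed_frontier.measurableSet
      fun x hx => ?_)
    simp only
    rw [(hψφ x (frontier_subset_closure hx)).self_of_nhds]
  rw [← e1, ← key]
  refine integral_congr_ae ?_
  filter_upwards [hFδ, ae_restrict_mem hΩ.measurableSet] with x h1 h2
  have h3 := hψφ x (subset_closure h2)
  rw [h1, h3.self_of_nhds, h3.fderiv_eq]
  ring

/-! ### Logarithmic stability -/

/-- Take logarithms and multiply by `x`: the singular quotient `y / x` becomes the bounded `y`, and
`-x log x ≤ 1`. The result is `x log(1/D) ≤ 1 + A M`. -/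
theorem le_mul_log_rpow_of_exp_le {x y z M A α D : ℝ} (hx : 0 < x) (hxM : x ≤ M) (hyM : y ≤ M)
    (hz0 : 0 ≤ z) (hzD : z ≤ D) (hD : D < 1) (hA : 0 ≤ A) (hα0 : 0 < α) (hα : α < 1)
    (h : x ^ 2 * Real.exp (-(A * (1 + y / x))) ≤ z ^ 2) :
    x ≤ (1 + A * M + M) * Real.log (1 / D) ^ (-α) := by
  have hM : 0 < M := hx.trans_le hxM
  have hz : 0 < z := by
    refine hz0.lt_of_ne fun h0 => ?_
    rw [← h0] at h
    have : 0 < x ^ 2 * Real.exp (-(A * (1 + y / x))) := by positivity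
    norm_num at h
    linarith
  have hD0 : 0 < D := hz.trans_le hzD
  set L := Real.log (1 / D) with hL
  have hLpos : 0 < L := Real.log_pos (one_lt_one_div hD0 hD)
  have h1 : 2 * Real.log x - A * (1 + y / x) ≤ -(2 * L) := by
    have h2 := Real.log_le_log (by positivity) (h.trans (pow_le_pow_left₀ hz0 hzD 2))
    rw [Real.log_mul (by positivity) (by positivity), Real.log_exp, Real.log_pow,
      Real.log_pow] at h2
    rw [hL, one_div, Real.log_inv]
    push_cast at h2
    linarith
  have h3 : x * L ≤ 1 + A * M := by
    have h4 : -(x * Real.log x) ≤ 1 := by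
      have := Real.log_le_sub_one_of_pos (inv_pos.2 hx)
      rw [Real.log_inv] at this
      have h5 := mul_le_mul_of_nonneg_left this hx.le
      rw [mul_sub, mul_inv_cancel₀ hx.ne'] at h5
      linarith
    have h6 : x * (A * (1 + y / x)) = A * (x + y) := by field_simp
    have h7 := mul_le_mul_of_nonneg_left h1 hx.le
    have h8 : A * (x + y) ≤ A * (2 * M) := by gcongr; linarith
    nlinarith
  have hAM : 0 ≤ A * M := mul_nonneg hA hM.le
  have hLα : 0 < L ^ (-α) := Real.rpow_pos_of_pos hLpos _
  -- For `L ≥ 1` the power `-1` is stronger than `-α`. For `L ≤ 1` the right-hand side is at least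
  -- `M`, which is why `M` is added to the constant.
  rcases le_total 1 L with h1L | h1L
  · have h9 : x ≤ (1 + A * M) * L ^ (-1 : ℝ) := by
      rw [Real.rpow_neg_one, ← div_eq_mul_inv, le_div_iff₀ hLpos]
      exact h3
    have h10 : L ^ (-1 : ℝ) ≤ L ^ (-α) := Real.rpow_le_rpow_of_exponent_le h1L (by linarith)
    calc x ≤ (1 + A * M) * L ^ (-1 : ℝ) := h9
      _ ≤ (1 + A * M + M) * L ^ (-α) := by
        gcongr ?_ * ?_
        linarith
  · have h11 : 1 ≤ L ^ (-α) :=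
      Real.one_le_rpow_of_pos_of_le_one_of_nonpos hLpos h1L (by linarith)
    nlinarith

theorem eLpNorm_le_h1Norm {d : ℕ} (Ω : Set (Eu d)) (v : Eu d → ℝ) :
    eLpNorm v 2 (volume.restrict Ω) ≤ h1Norm Ω v := by
  refine le_iInf₂ fun G _ => ?_
  calc eLpNorm v 2 (volume.restrict Ω)
      = (eLpNorm v 2 (volume.restrict Ω) ^ 2) ^ (1 / 2 : ℝ) := by
        rw [← ENNReal.rpow_natCast, ← ENNReal.rpow_mul]
        norm_num
    _ ≤ _ := by
        gcongr
        exact le_self_add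

theorem norm_le_toReal_of_eLpNorm_le {α : Type*} {m : MeasurableSpace α} {μ : Measure α}
    {f : Lp ℝ 2 μ} {f' : α → ℝ} (hf : f =ᵐ[μ] f') {D : ℝ≥0∞} (hD : D ≠ ⊤)
    (h : eLpNorm f' 2 μ ≤ D) : ‖f‖ ≤ D.toReal := by
  rw [Lp.norm_def, eLpNorm_congr_ae hf]
  exact ENNReal.toReal_mono hD h

theorem logBound_of_curve {d : ℕ} {Ω : Set (Eu d)} {M A α : ℝ} (hM : 0 < M) (hA : 0 ≤ A)
    (hα : α ∈ Ioo (0 : ℝ) 1) {v w : Fin 3 → Eu d → ℝ} {u₀ y₀ uT : Lp ℝ 2 (volume.restrict Ω)}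
    (hu₀ : u₀ =ᵐ[volume.restrict Ω] v 0) (hy₀ : y₀ =ᵐ[volume.restrict Ω] v 1)
    (huT : uT =ᵐ[volume.restrict Ω] w 0) (hv : ∑ k, h1Norm Ω (v k) ≤ ENNReal.ofReal M)
    (h : u₀ ≠ 0 → ‖u₀‖ ^ 2 * Real.exp (-(A * (1 + ‖y₀‖ / ‖u₀‖))) ≤ ‖uT‖ ^ 2) :
    LogBound Ω (1 + A * M + M) α (∑ k, h1Norm Ω (w k)) (v 0) := by
  have hle : ∀ (f : Fin 3 → Eu d → ℝ) k,
      eLpNorm (f k) 2 (volume.restrict Ω) ≤ ∑ k, h1Norm Ω (f k) := fun f k =>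
    (eLpNorm_le_h1Norm Ω (f k)).trans
      (Finset.single_le_sum (f := fun k => h1Norm Ω (f k)) (fun _ _ => zero_le) (Finset.mem_univ k))
  have hM' : (ENNReal.ofReal M).toReal = M := ENNReal.toReal_ofReal hM.le
  have hxM : ‖u₀‖ ≤ M := hM' ▸ norm_le_toReal_of_eLpNorm_le hu₀ ENNReal.ofReal_ne_top
    ((hle v 0).trans hv)
  have hyM : ‖y₀‖ ≤ M := hM' ▸ norm_le_toReal_of_eLpNorm_le hy₀ ENNReal.ofReal_ne_top
    ((hle v 1).trans hv)
  have hz : (∑ k, h1Norm Ω (w k)) ≠ ⊤ → ‖uT‖ ≤ (∑ k, h1Norm Ω (w k)).toReal := fun hD =>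
    norm_le_toReal_of_eLpNorm_le huT hD (hle w 0)
  have he : eLpNorm (v 0) 2 (volume.restrict Ω) = ENNReal.ofReal ‖u₀‖ := by
    rw [← eLpNorm_congr_ae hu₀, ofReal_norm, Lp.enorm_def]
  rw [LogBound, he]
  refine ⟨fun hD => ?_, fun _ hD1 => ?_⟩
  -- If `D = 0`, then `u(T) = 0`, and the lower bound leaves no room for `u(0) ≠ 0`.
  · by_contra hne
    have hu : u₀ ≠ 0 := fun h0 => hne (by simp [h0])
    have h1 := h hu
    have h2 := hz (by simp [hD])
    rw [hD, ENNReal.toReal_zero] at h2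
    have h3 : ‖uT‖ = 0 := le_antisymm h2 (norm_nonneg _)
    have h4 : 0 < ‖u₀‖ := norm_pos_iff.2 hu
    have : 0 < ‖u₀‖ ^ 2 * Real.exp (-(A * (1 + ‖y₀‖ / ‖u₀‖))) := by positivity
    rw [h3] at h1
    norm_num at h1
    linarith
  · refine ENNReal.ofReal_le_ofReal ?_
    have hDr : (∑ k, h1Norm Ω (w k)).toReal < 1 := by
      simpa using (ENNReal.toReal_lt_toReal hD1.ne_top ENNReal.one_ne_top).2 hD1
    by_cases hu : u₀ = 0
    · rw [hu, norm_zero]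
      have hL : 0 ≤ Real.log (1 / (∑ k, h1Norm Ω (w k)).toReal) := by
        rw [one_div, Real.log_inv]
        have := Real.log_nonpos ENNReal.toReal_nonneg hDr.le
        linarith
      have := mul_nonneg hA hM.le
      exact mul_nonneg (by linarith) (Real.rpow_nonneg hL _)
    · exact le_mul_log_rpow_of_exp_le (norm_pos_iff.2 hu) hxM hyM (norm_nonneg _)
        (hz hD1.ne_top) hDr hA hα.1 hα.2 (h hu)

/-- Translates the integral identity on one time slice into the Hilbert space form used by the
energy method. The same `f` serves all test functions and carries the lower-order bound. -/
theorem exists_weak_identity_of_slice {ι α β : Type*} [Fintype ι] {m : MeasurableSpace α}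
    {m' : MeasurableSpace β} {μ : Measure α} {ν : Measure β} {a : ι → ι → α → ℝ}
    {A : ι → ι → Lp ℝ ∞ μ} (hA : ∀ i j, A i j =ᵐ[μ] a i j) {σ : α → ℝ} {s : Lp ℝ ∞ μ}
    (hs : s =ᵐ[μ] σ) (hσ : ∀ᵐ x ∂μ, 0 ≤ σ x) {b : ι → α → ℝ} {c u y : α → ℝ} {K Cc : ℝ}
    (hb : ∀ᵐ x ∂μ, √(∑ k, b k x ^ 2) ≤ K * √(σ x)) (hc : ∀ᵐ x ∂μ, ‖c x‖ ≤ Cc)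
    {U Y : Lp ℝ 2 μ} {Γ : ι → Lp ℝ 2 μ} {Du : ι → α → ℝ} (hU : U =ᵐ[μ] u) (hY : Y =ᵐ[μ] y)
    (hΓ : ∀ i, Γ i =ᵐ[μ] Du i) (hf : MemLp (fun x => ∑ k, b k x * Du k x + c x * u x) 2 μ)
    (r : Lp ℝ ∞ ν) (g : Lp ℝ 2 ν) :
    ∃ f : Lp ℝ 2 μ, ‖f‖ ^ 2 ≤ (2 * K ^ 2 + 2 * Cc ^ 2)
        * ((∑ i, inner ℝ (mulLp μ s (Γ i)) (Γ i)) + ‖U‖ ^ 2) ∧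
      ∀ (w : Lp ℝ 2 μ) (G : ι → Lp ℝ 2 μ) (z : Lp ℝ 2 ν) (φ : α → ℝ) (dφ : ι → α → ℝ)
        (ψ : β → ℝ), w =ᵐ[μ] φ → (∀ i, G i =ᵐ[μ] dφ i) → z =ᵐ[ν] ψ →
        ∫ x, ((y x - (∑ k, b k x * Du k x + c x * u x)) * φ x
            + ∑ i, (∑ j, a i j x * Du j x) * dφ i x) ∂μ = -∫ x, r x * g x * ψ x ∂ν →
        quadForm μ A Γ G + inner ℝ (mulLp ν r g) z = inner ℝ (f - Y) w := by
  refine ⟨hf.toLp _, norm_sq_lowerOrder_le (b := b) (c := c) hs hσ hb hc ?_, ?_⟩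
  · refine (MemLp.coeFn_toLp hf).trans ?_
    filter_upwards [hU, ae_all_iff.2 hΓ] with x h1 h2
    simp only [h1, h2]
  · intro w G z φ dφ ψ h1 h2 h3 h
    have e1 := quadForm_sub_inner_eq_integral hA hΓ (MemLp.coeFn_toLp hf) hY h1 h2
    have e2 : inner ℝ (mulLp ν r g) z = ∫ x, r x * g x * ψ x ∂ν :=
      L2.real_inner_eq_integral_of_ae_eq (coeFn_mulLp r g) h3
    rw [h, ← e2] at e1
    linarith

theorem MeasureTheory.MemLp.exists_ae_norm_le {α : Type*} {m : MeasurableSpace α} {μ : Measure α}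
    {f : α → ℝ} (hf : MemLp f ⊤ μ) : ∃ C, ∀ᵐ x ∂μ, ‖f x‖ ≤ C := by
  have hlt := hf.2
  rw [eLpNorm_exponent_top] at hlt
  refine ⟨(eLpNormEssSup f μ).toReal, ?_⟩
  filter_upwards [enorm_ae_le_eLpNormEssSup f μ] with x hx
  rw [← toReal_enorm]
  exact ENNReal.toReal_mono hlt.ne hx

set_option maxHeartbeats 400000 in
/-- The energy method for the equation, for boundary conditions that are encoded by a space `P` of
smooth functions and a boundary weight `r`. -/
theorem exists_logBound {d : ℕ} {Ω : Set (Eu d)} (hΩo : IsOpen Ω)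
    (hΩb : Bornology.IsBounded Ω) {T : ℝ} (hT : 0 < T)
    {a a' : Fin d → Fin d → Eu d × ℝ → ℝ} {b : Fin d → Eu d × ℝ → ℝ} {c : Eu d × ℝ → ℝ}
    (ha : ∀ i j, IsC1Linfty Ω T (a i j) (a' i j))
    (hsymm : ∀ i j, ∀ t ∈ Icc 0 T, ∀ᵐ x ∂(volume.restrict Ω), a i j (x, t) = a j i (x, t))
    {σ : Eu d → ℝ} (hσ0 : ∀ x ∈ closure Ω, 0 ≤ σ x)
    (hell : ∀ t ∈ Ioo 0 T, ∀ᵐ x ∂(volume.restrict Ω), ∀ ξ : Fin d → ℝ,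
      σ x * ∑ k, ξ k ^ 2 ≤ ∑ i, ∑ j, a i j (x, t) * ξ i * ξ j)
    (hb : ∀ k, MemLp (b k) ∞ (volume.restrict (stCylinder Ω T)))
    (hc : MemLp c ∞ (volume.restrict (stCylinder Ω T)))
    (hdeg : ∃ lam : ℝ, 0 < lam ∧ ∀ t ∈ Icc 0 T, ∀ᵐ x ∂(volume.restrict Ω), ∀ ξ : Fin d → ℝ,
      0 ≤ ∑ i, ∑ j, (lam * a i j (x, t) - a' i j (x, t)) * ξ i * ξ j)
    (hbσ : ∃ K : ℝ, 0 < K ∧ ∀ᵐ p ∂(volume.restrict (stCylinder Ω T)),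
      √(∑ k, b k p ^ 2) ≤ K * √(σ p.1))
    {s : Lp ℝ ∞ (volume.restrict Ω)} (hs : s =ᵐ[volume.restrict Ω] σ)
    {r : Lp ℝ ∞ (surfaceMeasure Ω)} {P : Submodule ℝ (Eu d → ℝ)} {κ Ct : ℝ} (hκ : 0 ≤ κ)
    (hSC : ∀ p ∈ traceSubmodule Ω P, ‖p.2‖ ≤ Ct * ‖p.1‖)
    (hSκ : ∀ p ∈ traceSubmodule Ω P, |inner ℝ (mulLp (surfaceMeasure Ω) r p.2) p.2|
      ≤ (∑ i, inner ℝ (mulLp (volume.restrict Ω) s (p.1.2 i)) (p.1.2 i)) / 2 + κ * ‖p.1.1‖ ^ 2)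
    {M : ℝ} (hM : 0 < M) {α : ℝ} (hα : α ∈ Ioo (0 : ℝ) 1) :
    ∃ C : ℝ, 0 < C ∧
      ∀ (u : Fin 3 → Eu d × ℝ → ℝ) (Du : Fin d → Eu d × ℝ → ℝ) (v w : Fin 3 → Eu d → ℝ),
        IsRegularSolution Ω T a b c u Du v w →
        (∀ᵐ t ∂(volume.restrict (Ioo 0 T)), ∀ (U : Lp ℝ 2 (volume.restrict Ω))
          (Γ : Fin d → Lp ℝ 2 (volume.restrict Ω)),
          (U =ᵐ[volume.restrict Ω] fun x => u 0 (x, t)) →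
          (∀ i, Γ i =ᵐ[volume.restrict Ω] fun x => Du i (x, t)) →
          ∃ g : Lp ℝ 2 (surfaceMeasure Ω),
            ((U, Γ), g) ∈ (traceSubmodule Ω P).topologicalClosure ∧
            ∀ φ ∈ P, ContDiff ℝ ∞ φ →
              ∫ x in Ω, ((u 1 (x, t) - (∑ k, b k (x, t) * Du k (x, t) + c (x, t) * u 0 (x, t)))
                  * φ x + ∑ i, (∑ j, a i j (x, t) * Du j (x, t)) * fderiv ℝ φ x (basisVec i))
                = -∫ x, r x * g x * φ x ∂(surfaceMeasure Ω)) →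
        ∑ k, h1Norm Ω (v k) ≤ ENNReal.ofReal M →
        LogBound Ω C α (∑ k, h1Norm Ω (w k)) (v 0) := by
  obtain ⟨lam, hlam, hdeg⟩ := hdeg
  obtain ⟨K, -, hbσ⟩ := hbσ
  have hσΩ : ∀ᵐ x ∂(volume.restrict Ω), 0 ≤ σ x :=
    ae_restrict_of_forall_mem hΩo.measurableSet fun x hx => hσ0 x (subset_closure hx)
  obtain ⟨Cc, hCc⟩ : ∃ Cc, ∀ᵐ p ∂(volume.restrict (stCylinder Ω T)), ‖c p‖ ≤ Cc :=
    hc.exists_ae_norm_le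
  choose A A' hA hA' hAa hAa' using fun i j => (ha i j).exists_curve hT
  set B := 2 * K ^ 2 + 2 * Cc ^ 2 with hBdef
  have hB : 0 ≤ B := by positivity
  -- The exponent of `energy_lower_bound`; it depends on the coefficients, `T` and `κ`, but not on
  -- the solution.
  set E := (3 + (4 * B + 8 * κ ^ 2))
      * Real.exp ((2 * lam + (4 * B + 8 * κ ^ 2) / 2) * T) * T * (2 + (4 * B + 8 * κ ^ 2)) with hE
  have hE0 : 0 ≤ E := by positivity
  refine ⟨1 + E * M + M, by positivity, fun u Du v w h hbc hv => ?_⟩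
  obtain ⟨U, Y, Γ, Γ', hU, hY, hUY, hΓ, hΓ', hU0, hY0, hUT, hsl⟩ := h.exists_curves hΩo hΩb hT
  refine logBound_of_curve hM hE0 hα hU0 hY0 hUT hv fun hne => ?_
  have hquad : ∀ t ∈ Ioo 0 T, ∀ i j, A i j t =ᵐ[volume.restrict Ω] fun x => a i j (x, t) :=
    fun t ht i j => hAa i j t (Ioo_subset_Icc_self ht)
  have hquad' : ∀ t ∈ Ioo 0 T, ∀ i j, A' i j t =ᵐ[volume.restrict Ω] fun x => a' i j (x, t) :=
    fun t ht i j => hAa' i j t (Ioo_subset_Icc_self ht)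
  have hsym : ∀ t ∈ Ioo 0 T, ∀ i j, A i j t = A j i t := fun t ht i j =>
    Lp.ext (((hquad t ht i j).trans (hsymm i j t (Ioo_subset_Icc_self ht))).trans
      (hquad t ht j i).symm)
  have hweak : ∀ᵐ t ∂(volume.restrict (Ioo 0 T)),
      ∃ (f : Lp ℝ 2 (volume.restrict Ω)) (g : Lp ℝ 2 (surfaceMeasure Ω)),
      ((U t, Γ t), g) ∈ (traceSubmodule Ω P).topologicalClosure ∧
      ‖f‖ ^ 2 ≤ B * ((∑ i, inner ℝ (mulLp (volume.restrict Ω) s (Γ t i)) (Γ t i))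
        + ‖U t‖ ^ 2) ∧
      ∀ p ∈ traceSubmodule Ω P,
        quadForm (volume.restrict Ω) (fun i j => A i j t) (Γ t) p.1.2
          + inner ℝ (mulLp (surfaceMeasure Ω) r g) p.2 = inner ℝ (f - Y t) p.1.1 := by
    filter_upwards [hbc, hsl, h.ae_slice_equation hΩo hΩb ha hb hc, ae_time_of_ae_stCylinder hbσ,
      ae_time_of_ae_stCylinder hCc, ae_restrict_mem measurableSet_Ioo]
      with t hbct hslt heq hbt hct ht
    obtain ⟨hUt, hYt, hΓt⟩ := hslt
    obtain ⟨g, hg, hw⟩ := hbct (U t) (Γ t) hUt hΓt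
    obtain ⟨f, hf, hfw⟩ := exists_weak_identity_of_slice (hquad t ht) hs hσΩ
      (b := fun k x => b k (x, t)) (c := fun x => c (x, t)) hbt hct hUt hYt hΓt heq.1 r g
    exact ⟨f, g, hg, hf, fun p ⟨φ, hφP, hφ, h1, h2, h3⟩ =>
      hfw p.1.1 p.1.2 p.2 φ _ φ h1 h2 h3 (hw φ hφP hφ)⟩
  exact energy_lower_bound hT hlam.le hB hκ (fun t ht i j => hA i j t ht) hA' hsym
    (sum_inner_mulLp_nonneg hs hσΩ)
    (fun t ht G => sum_inner_mulLp_le_quadForm hs (hquad t ht) (hell t ht) G)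
    (fun t ht G => quadForm_le_mul_quadForm (hquad t ht) (hquad' t ht)
      (hdeg t (Ioo_subset_Icc_self ht)) G)
    hSC hSκ hU hY hUY hΓ hΓ' hweak hne

/-! ### The two boundary conditions -/

theorem norm_le_of_norm_sq_le_sum {H Z ι : Type*} [Fintype ι] [NormedAddCommGroup H]
    [InnerProductSpace ℝ H] [NormedAddCommGroup Z] (L : H →L[ℝ] H) {ε C : ℝ} (hε : 0 ≤ ε)
    (hC : 0 ≤ C) {p : (H × (ι → H)) × Z}
    (h : ‖p.2‖ ^ 2 ≤ ε * (∑ i, inner ℝ (L (p.1.2 i)) (p.1.2 i)) + C * ‖p.1.1‖ ^ 2) :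
    ‖p.2‖ ≤ √(ε * (Fintype.card ι * ‖L‖) + C) * ‖p.1‖ := by
  have h1 : ‖p.1.1‖ ≤ ‖p.1‖ := norm_fst_le p.1
  have h2 : ∀ i, ‖p.1.2 i‖ ≤ ‖p.1‖ := fun i => (norm_le_pi_norm p.1.2 i).trans (norm_snd_le p.1)
  have h3 : ∑ i, inner ℝ (L (p.1.2 i)) (p.1.2 i) ≤ Fintype.card ι * ‖L‖ * ‖p.1‖ ^ 2 := by
    calc ∑ i, inner ℝ (L (p.1.2 i)) (p.1.2 i) ≤ ∑ _i : ι, ‖L‖ * ‖p.1‖ ^ 2 := by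
          refine Finset.sum_le_sum fun i _ => (real_inner_le_norm _ _).trans ?_
          calc ‖L (p.1.2 i)‖ * ‖p.1.2 i‖ ≤ (‖L‖ * ‖p.1.2 i‖) * ‖p.1.2 i‖ := by
                gcongr
                exact L.le_opNorm _
            _ ≤ (‖L‖ * ‖p.1‖) * ‖p.1‖ := by
                gcongr <;> exact h2 i
            _ = ‖L‖ * ‖p.1‖ ^ 2 := by ring
      _ = Fintype.card ι * ‖L‖ * ‖p.1‖ ^ 2 := by
          rw [Finset.sum_const, Finset.card_univ, nsmul_eq_mul, mul_assoc]
  have h4 : ‖p.2‖ ^ 2 ≤ (ε * (Fintype.card ι * ‖L‖) + C) * ‖p.1‖ ^ 2 := by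
    calc ‖p.2‖ ^ 2 ≤ ε * (Fintype.card ι * ‖L‖ * ‖p.1‖ ^ 2) + C * ‖p.1‖ ^ 2 := by
          refine h.trans ?_
          gcongr
      _ = _ := by ring
  calc ‖p.2‖ = √(‖p.2‖ ^ 2) := (Real.sqrt_sq (norm_nonneg _)).symm
    _ ≤ √((ε * (Fintype.card ι * ‖L‖) + C) * ‖p.1‖ ^ 2) := Real.sqrt_le_sqrt h4
    _ = √(ε * (Fintype.card ι * ‖L‖) + C) * ‖p.1‖ := by
        rw [Real.sqrt_mul (by positivity), Real.sqrt_sq (norm_nonneg _)]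

/-- For `L` the multiplication by the Robin coefficient, the small factor in the trace inequality is
chosen so that, after multiplication by `‖L‖`, at most half of the energy `S` is spent. -/
theorem abs_inner_le_of_norm_sq_le {Z : Type*} [NormedAddCommGroup Z] [InnerProductSpace ℝ Z]
    (L : Z →L[ℝ] Z) {z : Z} {S K x : ℝ} (hS : 0 ≤ S)
    (h : ‖z‖ ^ 2 ≤ 1 / (2 * (‖L‖ + 1)) * S + K * x) :
    |inner ℝ (L z) z| ≤ S / 2 + ‖L‖ * K * x := by
  have h1 : ‖L‖ * (1 / (2 * (‖L‖ + 1))) ≤ 1 / 2 := by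
    rw [mul_one_div, div_le_div_iff₀ (by positivity) two_pos]
    linarith
  have h2 := mul_le_mul_of_nonneg_right h1 hS
  calc |inner ℝ (L z) z| ≤ ‖L z‖ * ‖z‖ := abs_real_inner_le_norm _ _
    _ ≤ (‖L‖ * ‖z‖) * ‖z‖ := by
      gcongr
      exact L.le_opNorm _
    _ = ‖L‖ * ‖z‖ ^ 2 := by ring
    _ ≤ ‖L‖ * (1 / (2 * (‖L‖ + 1)) * S + K * x) := by gcongr
    _ ≤ S / 2 + ‖L‖ * K * x := by linarith

theorem HasTrace.mem_topologicalClosure {d : ℕ} {Ω : Set (Eu d)} (hΩ : IsOpen Ω)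
    (hΩb : Bornology.IsBounded Ω) [IsFiniteMeasure (surfaceMeasure Ω)] {v g : Eu d → ℝ}
    (h : HasTrace Ω v g) {U : Lp ℝ 2 (volume.restrict Ω)}
    {Γ : Fin d → Lp ℝ 2 (volume.restrict Ω)} {Dv : Fin d → Eu d → ℝ}
    (hU : U =ᵐ[volume.restrict Ω] v) (hΓ : ∀ i, Γ i =ᵐ[volume.restrict Ω] Dv i)
    (hDv : ∀ i, HasWeakPartial Ω i v (Dv i)) :
    ((U, Γ), h.1.toLp g) ∈ (traceSubmodule Ω ⊤).topologicalClosure := by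
  obtain ⟨hg, φ, hφ, hφv, hφg⟩ := h
  exact hφv.mem_topologicalClosure hΩ hΩb hφ (fun _ => Submodule.mem_top)
    (fun n => memLp_surfaceMeasure_of_continuousOn hΩb (hφ n).continuous.continuousOn 2) hg hφg
    hU hΓ hDv

theorem theorem2 {d : ℕ} (hd : 0 < d)
    (Ω : Set (Eu d)) (hΩo : IsOpen Ω) (hΩc : IsConnected Ω) (hΩb : Bornology.IsBounded Ω)
    (hΩs : HasSmoothBoundary Ω) (T : ℝ) (hT : 0 < T)
    -- the coefficients; `a' i j` is the time derivative of `a i j`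
    (a a' : Fin d → Fin d → Eu d × ℝ → ℝ) (b : Fin d → Eu d × ℝ → ℝ) (c : Eu d × ℝ → ℝ)
    (ha : ∀ i j, IsC1Linfty Ω T (a i j) (a' i j))
    (hsymm : ∀ i j, ∀ t ∈ Icc 0 T, ∀ᵐ x ∂(volume.restrict Ω), a i j (x, t) = a j i (x, t))
    (σ : Eu d → ℝ) (hσ : ContinuousOn σ (closure Ω)) (hσ0 : ∀ x ∈ closure Ω, 0 ≤ σ x)
    (hell : ∀ t ∈ Ioo 0 T, ∀ᵐ x ∂(volume.restrict Ω), ∀ ξ : Fin d → ℝ,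
      σ x * ∑ k, ξ k ^ 2 ≤ ∑ i, ∑ j, a i j (x, t) * ξ i * ξ j)
    (hb : ∀ k, MemLp (b k) ∞ (volume.restrict (stCylinder Ω T)))
    (hc : MemLp c ∞ (volume.restrict (stCylinder Ω T)))
    (hdeg : ∃ lam : ℝ, 0 < lam ∧ ∀ t ∈ Icc 0 T, ∀ᵐ x ∂(volume.restrict Ω), ∀ ξ : Fin d → ℝ,
      0 ≤ ∑ i, ∑ j, (lam * a i j (x, t) - a' i j (x, t)) * ξ i * ξ j)
    (hbσ : ∃ K : ℝ, 0 < K ∧ ∀ᵐ p ∂(volume.restrict (stCylinder Ω T)),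
      √(∑ k, b k p ^ 2) ≤ K * √(σ p.1)) :
    -- the Dirichlet case
    (∀ M : ℝ, 0 < M → ∀ α ∈ Ioo (0 : ℝ) 1, ∃ C : ℝ, 0 < C ∧
      ∀ (u : Fin 3 → Eu d × ℝ → ℝ) (Du : Fin d → Eu d × ℝ → ℝ) (v w : Fin 3 → Eu d → ℝ),
        IsRegularSolution Ω T a b c u Du v w → DirichletBC Ω T (u 0) →
        ∑ k, h1Norm Ω (v k) ≤ ENNReal.ofReal M →
        LogBound Ω C α (∑ k, h1Norm Ω (w k)) (v 0)) ∧
    -- the Robin case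
    ((∀ x ∈ frontier Ω, 0 < σ x) → ∀ r : Eu d → ℝ, ContinuousOn r (frontier Ω) →
      ∀ M : ℝ, 0 < M → ∀ α ∈ Ioo (0 : ℝ) 1, ∃ C : ℝ, 0 < C ∧
      ∀ (u : Fin 3 → Eu d × ℝ → ℝ) (Du : Fin d → Eu d × ℝ → ℝ) (v w : Fin 3 → Eu d → ℝ),
        IsRegularSolution Ω T a b c u Du v w → RobinBC Ω T a r (u 0) Du →
        ∑ k, h1Norm Ω (v k) ≤ ENNReal.ofReal M →
        LogBound Ω C α (∑ k, h1Norm Ω (w k)) (v 0)) := by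
  have hs := MemLp.coeFn_toLp (memLp_restrict_of_continuous hΩo hΩb hσ ⊤)
  have hσΩ : ∀ᵐ x ∂(volume.restrict Ω), 0 ≤ σ x :=
    ae_restrict_of_forall_mem hΩo.measurableSet fun x hx => hσ0 x (subset_closure hx)
  constructor
  · intro M hM α hα
    obtain ⟨C, hC, h⟩ := exists_logBound hΩo hΩb hT ha hsymm hσ0 hell hb hc hdeg hbσ hs
      -- Test functions have zero trace, so the boundary component is trivial and no condition on
      -- `σ` at the boundary is needed.
      (r := (0 : Lp ℝ ∞ (surfaceMeasure Ω))) (P := testSubmodule Ω) (κ := 0) (Ct := 0) le_rfl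
      (fun p hp => by simp [eq_zero_of_mem_traceSubmodule_testSubmodule hΩo hp])
      (fun p hp => by
        rw [eq_zero_of_mem_traceSubmodule_testSubmodule hΩo hp, inner_zero_right, abs_zero]
        have := sum_inner_mulLp_nonneg hs hσΩ p.1.2
        positivity) hM hα
    refine ⟨C, hC, fun u Du v w hu hbc hv => h u Du v w hu ?_ hv⟩
    filter_upwards [hbc, hu.ae_slice_equation hΩo hΩb ha hb hc, ae_all_iff.2 fun i =>
      (hu.grad i).ae_hasWeakPartial hΩb (hu.memH21 0).1 (hu.memL2Q_grad hΩo i)]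
      with t h1 h2 h3 U Γ hU hΓ
    refine ⟨0, h1.mem_topologicalClosure hΩo hΩb hU hΓ h3, fun φ hφ _ => ?_⟩
    rw [h2.2.2 φ hφ, eq_comm, neg_eq_zero]
    refine integral_eq_zero_of_ae ?_
    filter_upwards [IsTestFunction.ae_surfaceMeasure_eq_zero hΩo hφ] with x hx
    simp [hx]
  · intro hσpos r hr M hM α hα
    have := hΩs.isFiniteMeasure_surfaceMeasure hd hΩo hΩb
    have hrL := memLp_surfaceMeasure_of_continuousOn hΩb hr ⊤
    have hrr := MemLp.coeFn_toLp hrL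
    set R := ‖mulLp (surfaceMeasure Ω) (hrL.toLp r)‖
    -- The trace inequality is used with this `ε`, so that the Robin term costs at most half of the
    -- weighted energy; the `1` covers `R = 0`.
    have hε : 0 < 1 / (2 * (R + 1)) := by positivity
    obtain ⟨K, hK0, hK⟩ := hΩs.norm_trace_sq_le hd hΩo hΩb hσ hσ0 hσpos hs hε
    obtain ⟨C, hC, h⟩ := exists_logBound hΩo hΩb hT ha hsymm hσ0 hell hb hc hdeg hbσ hs
      (r := hrL.toLp r) (P := ⊤) (κ := R * K) (mul_nonneg (norm_nonneg _) hK0)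
      (fun p hp => norm_le_of_norm_sq_le_sum (mulLp (volume.restrict Ω) _) hε.le hK0 (hK p hp))
      (fun p hp => abs_inner_le_of_norm_sq_le (mulLp (surfaceMeasure Ω) (hrL.toLp r))
        (sum_inner_mulLp_nonneg hs hσΩ p.1.2) (hK p hp)) hM hα
    refine ⟨C, hC, fun u Du v w hu hbc hv => h u Du v w hu ?_ hv⟩
    filter_upwards [hbc, hu.ae_slice_equation hΩo hΩb ha hb hc, (hu.memH21 1).1.ae_memLp,
      ae_all_iff.2 fun i =>
        (hu.grad i).ae_hasWeakPartial hΩb (hu.memH21 0).1 (hu.memL2Q_grad hΩo i)]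
      with t h1 h2 h3 h4 U Γ hU hΓ
    obtain ⟨g, f, hg, hf, hfg⟩ := h1
    refine ⟨hg.1.toLp g, hg.mem_topologicalClosure hΩo hΩb hU hΓ h4, fun φ _ hφ => ?_⟩
    -- Gauss' formula extends the equation from test functions in `Ω` to functions smooth up to the
    -- boundary, and the Robin condition replaces the normal trace by `-r g`.
    refine (hf.integral_eq hΩo hΩb (h3.sub h2.1) h2.2.2 hφ).trans ?_
    rw [← integral_neg]
    refine integral_congr_ae ?_
    filter_upwards [hfg, hrr, MemLp.coeFn_toLp hg.1] with x k1 k2 k3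
    rw [k2, k3, eq_neg_of_add_eq_zero_left k1]
    ring
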